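/- Let $2<\alpha<3$, $\beta=\alpha-2$, and let $C_1\le 0$ and $C_2\in\mathbb R$ be constants, not both zero. Let $(r,\phi,z)$ be cylindrical coordinates in $\mathbb R^3$ and $\rho^2=z^2+r^2$. Consider pairs $(u,p)$, with $u,p\in C^1(\mathbb R^3\setminus\{0\})$, $u^re_r+u^ze_z,\ p\in C^2(\mathbb R^3\setminus\{0\})$ and $u^\phi e_\phi\in C^1(\mathbb R^3\setminus\{0\})$, that solve the Euler equations $$u\cdot\nabla u+\nabla p=0,\qquad \nabla\cdot u=0\qquad\text{in }\mathbb R^3\setminus\{0\},$$ that are axisymmetric, rotational ($\nabla\times u\not\equiv0$) and $(-\alpha)$-homogeneous ($u(x)=\lambda^{\alpha}u(\lambda x)$ and $p(x)=\lambda^{2\alpha}p(\lambda x)$ for all $\lambda>0$), and that have for $r>0$ the Clebsch representation $$u=\nabla\times(\psi\nabla\phi)+\Gamma\nabla\phi,\qquad \Pi:=p+\tfrac12|u|^2=C_1|\psi|^{2+\frac4\beta},\qquad \Gamma=C_2\,\psi|\psi|^{\frac1\beta},$$ with a stream function $\psi=\psi(z,r)$ that is $C^2$ and positive for $r>0$,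 continuous on $\{r\ge0\}\setminus\{(0,0)\}$, zero for $r=0$, and homogeneous of degree $-\beta$. Such solutions exist for all these $\alpha,C_1,C_2$. For every such solution the following holds. 1. For every $c\in\mathbb R$, the level set $\{(z,r): r>0,\ \psi=c\}$ is homeomorphic to the level set $\{(z,r): r>0,\ r^2/(2\rho^3)=c\}$ of the stream function of the irrotational axisymmetric $(-3)$-homogeneous solution. 2. If $C_1\neq0$, the level sets of the Bernoulli function $\Pi$ in $\mathbb R^3\setminus\{0\}$ are nested surfaces created by the rotation of the sign "$\infty$" around the $z$-axis, in the sense below with $F=\Pi$ and $s=C_1$. 3. If $C_1=0$, then $u$ is a Beltrami flow, $\nabla\times u=\varphi u$ in $\mathbb R^3\setminus\{0\}$ for some function $\varphi$. Any such $\varphi$ is given by $\varphi=C_2\left(1+\frac1\beta\right)|\psi|^{\frac1\beta}$, and its level sets in $\mathbb R^3\setminus\{0\}$ are nested surfaces created by the rotation of the sign "$\infty$" around the $z$-axis, in the sense below with $F=\varphi$ and $s=C_2$. Here a sign "$\infty$" is a set $J\cup J^*$ in a plane containing the $z$-axis, with coordinates $(a,z)$, where $J$ is a Jordan curve through the origin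 with $J\setminus\{(0,0)\}\subset\{a>0\}$ and $J^*$ is its mirror image under $a\mapsto -a$. That the level sets of $F$ are nested surfaces created by the rotation of the sign "$\infty$" means the following: * for every $c$ with $sc>0$, the set $S_c=\{x\neq0: F(x)=c\}\cup\{0\}$ is the rotation of a sign "$\infty$" around the $z$-axis, and at each point of $S_c\setminus\{0\}$ the function $F$ is $C^1$ near that point with $\nabla F\neq0$; * if $sc>0$, $sc'>0$ and $|c|<|c'|$, then $S_{c'}\setminus\{0\}$ is enclosed by $S_c$, i.e. it lies in the union of the bounded connected components of $\mathbb R^3\setminus S_c$; * $\{x\ne0:F(x)=0\}$ is the $z$-axis without the origin, and $\{x\ne0:F(x)=c\}=\emptyset$ if $sc<0$. -/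

import Mathlib

/-- Euclidean three-space, with Cartesian coordinates `x 0, x 1, x 2`. -/
abbrev E3 : Type := EuclideanSpace ℝ (Fin 3)

noncomputable section

namespace HomEuler

/-! ### Vector calculus in Cartesian coordinates -/

/-- The partial derivative `∂ᵢ uʲ`. -/
def partialD (u : E3 → E3) (i j : Fin 3) (x : E3) : ℝ :=
  (fderiv ℝ u x (EuclideanSpace.single i 1)) j

def curl (u : E3 → E3) (x : E3) : E3 :=
  !₂[partialD u 1 2 x - partialD u 2 1 x,
     partialD u 2 0 x - partialD u 0 2 x,
     partialD u 0 1 x - partialD u 1 0 x]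

def div (u : E3 → E3) (x : E3) : ℝ := ∑ i, partialD u i i x

/-- `(u, p)` is a classical solution of the stationary Euler equations
`u · ∇u + ∇p = 0`, `∇ · u = 0` in `ℝ³ ∖ {0}`. -/
def IsEulerSolution (u : E3 → E3) (p : E3 → ℝ) : Prop :=
  ContDiffOn ℝ 1 u {0}ᶜ ∧ ContDiffOn ℝ 1 p {0}ᶜ ∧
    ∀ x : E3, x ≠ 0 → fderiv ℝ u x (u x) + gradient p x = 0 ∧ div u x = 0

/-- The Bernoulli function `Π = p + |u|² / 2`. -/
def bernoulli (u : E3 → E3) (p : E3 → ℝ) (x : E3) : ℝ := p x + ‖u x‖ ^ 2 / 2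

/-- `φ` is a proportionality factor of `u` in `ℝ³ ∖ {0}`: `∇ × u = φ u`. -/
def IsProportionalityFactor (u : E3 → E3) (φ : E3 → ℝ) : Prop :=
  ∀ x : E3, x ≠ 0 → curl u x = φ x • u x

/-! ### Homogeneity, axisymmetry, cylindrical coordinates -/

/-- `(u, p)` is `(-α)`-homogeneous: `u` has degree `-α` and `p` has degree `-2α`. -/
def IsHomogeneous (α : ℝ) (u : E3 → E3) (p : E3 → ℝ) : Prop :=
  ∀ l : ℝ, 0 < l → ∀ x : E3, x ≠ 0 →
    u x = l ^ α • u (l • x) ∧ p x = l ^ (2 * α) * p (l • x)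

/-- Rotation by the angle `ϑ` around the `z`-axis. -/
def rotZ (ϑ : ℝ) (x : E3) : E3 :=
  !₂[Real.cos ϑ * x 0 - Real.sin ϑ * x 1, Real.sin ϑ * x 0 + Real.cos ϑ * x 1, x 2]

def IsAxisymmetric (u : E3 → E3) (p : E3 → ℝ) : Prop :=
  ∀ (ϑ : ℝ) (x : E3), x ≠ 0 → u (rotZ ϑ x) = rotZ ϑ (u x) ∧ p (rotZ ϑ x) = p x

/-- The distance `r` to the `z`-axis. -/
def cylR (x : E3) : ℝ := Real.sqrt (x 0 ^ 2 + x 1 ^ 2)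

/-- The gradient `∇φ = e_φ / r` of the azimuthal angle (used where `r > 0`). -/
def gradAngle (x : E3) : E3 := !₂[-x 1 / cylR x ^ 2, x 0 / cylR x ^ 2, 0]

/-- The toroidal component `u^φ e_φ` (it is zero on the `z`-axis). -/
def toroidal (u : E3 → E3) (x : E3) : E3 :=
  (-x 1 * u x 0 + x 0 * u x 1) • gradAngle x

/-- The poloidal component `u^r e_r + u^z e_z`. -/
def poloidal (u : E3 → E3) (x : E3) : E3 := u x - toroidal u x

/-! ### The solutions -/

/-- `(u, p)` is a rotational axisymmetric `(-α)`-homogeneous solution of the Euler equations in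
`ℝ³ ∖ {0}` given by the Clebsch representation `u = ∇ × (ψ ∇φ) + Γ ∇φ` with a positive axisymmetric
stream function `ψ = ψ(z, r)` and with `Π = C₁ |ψ|^(2 + 4/(α-2))`, `Γ = C₂ ψ |ψ|^(1/(α-2))`. -/
structure IsDipoleSolution (α C₁ C₂ : ℝ) (ψ : ℝ → ℝ → ℝ) (u : E3 → E3) (p : E3 → ℝ) : Prop where
  euler : IsEulerSolution u p
  homogeneous : IsHomogeneous α u p
  axisymmetric : IsAxisymmetric u p
  rotational : ∃ x : E3, x ≠ 0 ∧ curl u x ≠ 0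
  poloidal_regular : ContDiffOn ℝ 2 (poloidal u) {0}ᶜ
  pressure_regular : ContDiffOn ℝ 2 p {0}ᶜ
  toroidal_regular : ContDiffOn ℝ 1 (toroidal u) {0}ᶜ
  stream_regular : ContDiffOn ℝ 2 (fun q : ℝ × ℝ => ψ q.1 q.2) {q | 0 < q.2}
  stream_continuous : ContinuousOn (fun q : ℝ × ℝ => ψ q.1 q.2) {q | 0 ≤ q.2 ∧ q ≠ 0}
  stream_axis : ∀ z : ℝ, z ≠ 0 → ψ z 0 = 0
  stream_homogeneous : ∀ l z r : ℝ, 0 < l → 0 < r → ψ z r = l ^ (α - 2) * ψ (l * z) (l * r)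
  stream_pos : ∀ z r : ℝ, 0 < r → 0 < ψ z r
  clebsch : ∀ x : E3, 0 < cylR x →
    u x = curl (fun y => ψ (y 2) (cylR y) • gradAngle y) x
      + (C₂ * ψ (x 2) (cylR x) * |ψ (x 2) (cylR x)| ^ (1 / (α - 2))) • gradAngle x
  bernoulli_eq : ∀ x : E3, 0 < cylR x →
    bernoulli u p x = C₁ * |ψ (x 2) (cylR x)| ^ (2 + 4 / (α - 2))

/-- The stream function `sin² θ / (2ρ) = r² / (2ρ³)`, `ρ² = z² + r²`, of the irrotational
axisymmetric `(-3)`-homogeneous solution. -/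
def dipoleStream (z r : ℝ) : ℝ := r ^ 2 / (2 * Real.sqrt (z ^ 2 + r ^ 2) ^ 3)

/-- A level set of a stream function in the cross-section `{(z, r) : r > 0}`. -/
def streamLevel (ψ : ℝ → ℝ → ℝ) (c : ℝ) : Set (ℝ × ℝ) := {q | 0 < q.2 ∧ ψ q.1 q.2 = c}

/-! ### Rotated signs "∞" and nested surfaces -/

/-- A Jordan curve (simple closed curve) in the plane. -/
def IsJordanCurve (J : Set (ℝ × ℝ)) : Prop :=
  ∃ γ : ℝ → ℝ × ℝ, ContinuousOn γ (Set.Icc 0 1) ∧ Set.InjOn γ (Set.Ico 0 1) ∧ γ 0 = γ 1 ∧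
    J = γ '' Set.Icc 0 1

/-- A sign "∞" in a plane containing the `z`-axis, with coordinates `(a, z)` where `a` is the signed
distance to the axis: a Jordan curve through the origin that otherwise stays in `{a > 0}`,
together with its mirror image. -/
def IsInftySign (E : Set (ℝ × ℝ)) : Prop :=
  ∃ J : Set (ℝ × ℝ), IsJordanCurve J ∧ (0, 0) ∈ J ∧ (∀ q ∈ J, q ≠ (0, 0) → 0 < q.1) ∧
    E = J ∪ (fun q : ℝ × ℝ => (-q.1, q.2)) '' J

/-- The subset of `ℝ³` created by rotating a subset of the `(a, z)`-plane around the `z`-axis. -/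
def rotated (E : Set (ℝ × ℝ)) : Set E3 :=
  {x | ∃ q ∈ E, ∃ ϑ : ℝ, x = !₂[q.1 * Real.cos ϑ, q.1 * Real.sin ϑ, q.2]}

/-- The points enclosed by `S`: those lying in bounded connected components of the complement. -/
def enclosed (S : Set E3) : Set E3 :=
  {x | x ∉ S ∧ Bornology.IsBounded (connectedComponentIn Sᶜ x)}

/-- The level set `{F = c}` in `ℝ³ ∖ {0}`. -/
def levelSet (F : E3 → ℝ) (c : ℝ) : Set E3 := {x | x ≠ 0 ∧ F x = c}

/-- The level sets of `F` in `ℝ³ ∖ {0}` are nested surfaces created by the rotation of the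
sign "∞" around the `z`-axis. Here `s ≠ 0` and the values of `F` off the axis have the sign of `s`;
the value `0` is taken exactly on the axis, and values of the other sign are not taken. -/
structure HasNestedInftyLevels (F : E3 → ℝ) (s : ℝ) : Prop where
  /-- Together with the origin, the level set is a rotated sign "∞". -/
  infty : ∀ c : ℝ, 0 < s * c → ∃ E : Set (ℝ × ℝ), IsInftySign E ∧ levelSet F c ∪ {0} = rotated E
  /-- The level sets are regular surfaces in `ℝ³ ∖ {0}`. -/
  regular : ∀ c : ℝ, 0 < s * c → ∀ x ∈ levelSet F c, ContDiffAt ℝ 1 F x ∧ fderiv ℝ F x ≠ 0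
  /-- The surface of the larger value of `|F|` is enclosed by that of the smaller one. -/
  nested : ∀ c c' : ℝ, 0 < s * c → 0 < s * c' → |c| < |c'| →
    levelSet F c' ⊆ enclosed (levelSet F c ∪ {0})
  axis : levelSet F 0 = {x | x ≠ 0 ∧ cylR x = 0}
  empty : ∀ c : ℝ, s * c < 0 → levelSet F c = ∅

end HomEuler

end

/-! Put β = α - 2 and ψ = ρ^(-β) g(θ), with g > 0 for 0 < θ < π.

Level sets. Along each ray with r > 0, ψ decreases strictly from ∞ to 0, so {ψ = d} with d > 0 is
met exactly once, at ρ = (g/d)^(1/β). It is therefore a graph over the angle, homeomorphic to ℝ for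
every such ψ, which gives claim 1. Since g vanishes at θ = 0, π, the curve closes up at the origin
to a Jordan curve. Claims 2 and 3 both concern a function F = C ψ^κ with κ > 0
(`IsAxisStream.hasNestedInftyLevels`). Its gradient is nonzero by Euler's identity x·∇F = -βκF. Its
levels are nested because {ψ > d} and {ψ < d} are open and disjoint, and the former is bounded.

Beltrami case. If C₁ = 0 then Π = 0 and the Euler equations become (∇ × u) × u = 0. The Clebsch form
gives ∇ × u = Γ'(ψ) u + (azimuthal field). The azimuthal part must vanish, because the poloidal
velocity has no zero off the axis: x·∇ψ = -βψ ≠ 0. The factor is unique only if u has no zeros at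
all, and the axis is the delicate place (`apply_ne_zero_of_axis`). A zero of u there would make a
weighted u^z strictly decreasing in r from 0, hence ∂_r ψ < 0 and ψ < 0.

Existence. For ψ = r² ρ^(-α) f(τ), τ = cos θ, the Euler equations follow from an ODE for f. With w =
(1 - τ²) f it reads -w'' = N(1 - τ², f), w(±1) = 0, where N is the linear term κ f, now with κ =
(α-2)(α-1), plus superlinear terms. The linear problem -w'' = λ w/(1 - τ²) has first eigenvalue 2
with eigenfunction 1 - τ², and κ < 2 exactly because α < 3 in the range α > 2. An even solution is
found by shooting from a pole with slope b (`exists_half_solution`). For small b, comparison with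
the eigenfunction gives a positive slope at the equator. For large b an a priori bound excludes a
nonnegative one. In between some b gives slope zero. The Green operator, divided by 1 - τ², then
raises f to class C³ up to the poles (`Nonlinearity.exists_profile`), and the fields built from f
are checked off the axis and extended to it by continuity (`IsProfile.isDipoleSolution`). -/

noncomputable section

namespace HomEuler

open Set Filter Topology

/-! ### Level curves of homogeneous stream functions; cylindrical and polar coordinates. -/

section

/-- A positive function on the half plane `r > 0` that is homogeneous of degree `-β`. -/
structure IsHomogeneousStream (β : ℝ) (ψ : ℝ → ℝ → ℝ) : Prop where
  pos : ∀ z r : ℝ, 0 < r → 0 < ψ z r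
  homog : ∀ l z r : ℝ, 0 < l → 0 < r → ψ z r = l ^ β * ψ (l * z) (l * r)

theorem rpow_inv_rpow_self {x y : ℝ} (hx : 0 ≤ x) (hy : y ≠ 0) : (x ^ (1 / y)) ^ y = x := by
  rw [← Real.rpow_mul hx, one_div_mul_cancel hy, Real.rpow_one]

theorem rpow_rpow_inv_self {x y : ℝ} (hx : 0 ≤ x) (hy : y ≠ 0) : (x ^ y) ^ (1 / y) = x := by
  rw [← Real.rpow_mul hx, mul_one_div_cancel hy, Real.rpow_one]

/-- The level set meets each ray once, so the cotangent z/r of the polar angle is a global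
coordinate on it. The inverse sends t to R(t)·(t, 1), where ψ(t, 1) = R^β c fixes R(t). -/
theorem IsHomogeneousStream.streamLevel_homeomorph_real {β : ℝ} {ψ : ℝ → ℝ → ℝ}
    (h : IsHomogeneousStream β ψ) (hβ : 0 < β)
    (hcont : ContinuousOn (fun q : ℝ × ℝ => ψ q.1 q.2) {q | 0 < q.2}) {c : ℝ} (hc : 0 < c) :
    Nonempty (streamLevel ψ c ≃ₜ ℝ) := by
  have hβ0 : β ≠ 0 := hβ.ne'
  have hd : ∀ t, 0 < ψ t 1 / c := fun t => div_pos (h.pos t 1 one_pos) hc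
  have hR : ∀ t, 0 < (ψ t 1 / c) ^ (1 / β) := fun t => Real.rpow_pos_of_pos (hd t) _
  have hψ : Continuous fun t : ℝ => ψ t 1 := by
    have : Continuous fun t : ℝ => (t, (1 : ℝ)) := by fun_prop
    exact hcont.comp_continuous this (fun t => by simp)
  have hRc : Continuous fun t : ℝ => (ψ t 1 / c) ^ (1 / β) :=
    (hψ.div_const c).rpow_const fun t => Or.inl (hd t).ne'
  refine ⟨{ toFun := fun q => q.1.1 / q.1.2
            invFun := fun t => ⟨((ψ t 1 / c) ^ (1 / β) * t, (ψ t 1 / c) ^ (1 / β)), hR t, ?_⟩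
            left_inv := ?_
            right_inv := ?_
            continuous_toFun := ?_
            continuous_invFun := ?_ }⟩
  · have h1 := h.homog _ t 1 (hR t) one_pos
    rw [rpow_inv_rpow_self (hd t).le hβ0, mul_one] at h1
    have h2 := (h.pos t 1 one_pos).ne'
    field_simp at h1
    simpa using h1.symm
  · rintro ⟨⟨z, r⟩, hr, hq⟩
    dsimp only at hr hq
    have h1 := h.homog r (z / r) 1 hr one_pos
    rw [mul_one, mul_div_cancel₀ _ hr.ne', hq] at h1
    have h2 : (ψ (z / r) 1 / c) ^ (1 / β) = r := by
      rw [h1, mul_div_cancel_right₀ _ hc.ne', rpow_rpow_inv_self hr.le hβ0]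
    apply Subtype.ext
    simp only [h2]
    rw [mul_div_cancel₀ _ hr.ne']
  · intro t
    exact mul_div_cancel_left₀ _ (hR t).ne'
  · exact (continuous_fst.comp continuous_subtype_val).div
      (continuous_snd.comp continuous_subtype_val) fun q => q.2.1.ne'
  · exact Continuous.subtype_mk ((hRc.mul continuous_id).prodMk hRc) _

theorem IsHomogeneousStream.streamLevel_eq_empty {β : ℝ} {ψ : ℝ → ℝ → ℝ}
    (h : IsHomogeneousStream β ψ) {c : ℝ} (hc : c ≤ 0) : streamLevel ψ c = ∅ :=
  eq_empty_of_forall_notMem fun q hq => absurd (h.pos q.1 q.2 hq.1) (by rw [hq.2]; exact hc.not_gt)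

theorem IsHomogeneousStream.streamLevel_homeomorph {β β' : ℝ} {ψ ψ' : ℝ → ℝ → ℝ}
    (h : IsHomogeneousStream β ψ) (h' : IsHomogeneousStream β' ψ') (hβ : 0 < β) (hβ' : 0 < β')
    (hcont : ContinuousOn (fun q : ℝ × ℝ => ψ q.1 q.2) {q | 0 < q.2})
    (hcont' : ContinuousOn (fun q : ℝ × ℝ => ψ' q.1 q.2) {q | 0 < q.2}) (c : ℝ) :
    Nonempty (streamLevel ψ c ≃ₜ streamLevel ψ' c) := by
  rcases le_or_gt c 0 with hc | hc
  · rw [h.streamLevel_eq_empty hc, h'.streamLevel_eq_empty hc]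
    exact ⟨Homeomorph.refl _⟩
  · obtain ⟨e⟩ := h.streamLevel_homeomorph_real hβ hcont hc
    obtain ⟨e'⟩ := h'.streamLevel_homeomorph_real hβ' hcont' hc
    exact ⟨e.trans e'.symm⟩

theorem isHomogeneousStream_dipoleStream : IsHomogeneousStream 1 dipoleStream where
  pos z r hr := by
    unfold dipoleStream
    have : 0 < z ^ 2 + r ^ 2 := by positivity
    positivity
  homog l z r hl hr := by
    unfold dipoleStream
    have h0 : 0 < z ^ 2 + r ^ 2 := by positivity
    have h1 : (l * z) ^ 2 + (l * r) ^ 2 = l ^ 2 * (z ^ 2 + r ^ 2) := by ring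
    rw [h1, Real.sqrt_mul (sq_nonneg l), Real.sqrt_sq hl.le, Real.rpow_one]
    have h2 : 0 < Real.sqrt (z ^ 2 + r ^ 2) := Real.sqrt_pos.2 h0
    field_simp

theorem continuousOn_dipoleStream :
    ContinuousOn (fun q : ℝ × ℝ => dipoleStream q.1 q.2) {q | 0 < q.2} := by
  unfold dipoleStream
  refine ContinuousOn.div (by fun_prop) (by fun_prop) fun q hq => ?_
  have hq : 0 < q.2 := hq
  have : 0 < q.1 ^ 2 + q.2 ^ 2 := by positivity
  positivity

/-! ### The distance to the axis -/

theorem cylR_nonneg (x : E3) : 0 ≤ cylR x := Real.sqrt_nonneg _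

theorem cylR_sq (x : E3) : cylR x ^ 2 = x 0 ^ 2 + x 1 ^ 2 := Real.sq_sqrt (by positivity)

theorem cylR_eq_zero {x : E3} : cylR x = 0 ↔ x 0 = 0 ∧ x 1 = 0 := by
  rw [cylR, Real.sqrt_eq_zero (by positivity)]
  constructor
  · intro h
    constructor <;> nlinarith [sq_nonneg (x 0), sq_nonneg (x 1)]
  · rintro ⟨h0, h1⟩
    simp [h0, h1]

theorem cylR_vec (a b c : ℝ) : cylR !₂[a, b, c] = Real.sqrt (a ^ 2 + b ^ 2) := by
  simp [cylR]

theorem continuous_cylR : Continuous cylR := by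
  unfold cylR
  fun_prop

theorem cylR_smul {l : ℝ} (hl : 0 ≤ l) (x : E3) : cylR (l • x) = l * cylR x := by
  simp only [cylR, PiLp.smul_apply, smul_eq_mul]
  rw [show (l * x 0) ^ 2 + (l * x 1) ^ 2 = l ^ 2 * (x 0 ^ 2 + x 1 ^ 2) by ring,
    Real.sqrt_mul (sq_nonneg l), Real.sqrt_sq hl]

theorem norm_sq_eq_cyl (x : E3) : ‖x‖ ^ 2 = x 2 ^ 2 + cylR x ^ 2 := by
  rw [EuclideanSpace.real_norm_sq_eq, Fin.sum_univ_three, cylR_sq]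
  ring

theorem ne_zero_of_cylR_pos {x : E3} (hx : 0 < cylR x) : x ≠ 0 := by
  rintro rfl
  simp [cylR] at hx

theorem apply_two_ne_zero {x : E3} (hx : x ≠ 0) (hr : cylR x = 0) : x 2 ≠ 0 := by
  intro h
  have := norm_sq_eq_cyl x
  rw [h, hr] at this
  exact hx (norm_eq_zero.1 (by nlinarith [norm_nonneg x]))

theorem cyl_mem_iff {x : E3} : ((x 2, cylR x) : ℝ × ℝ) ≠ 0 ↔ x ≠ 0 := by
  constructor
  · rintro h rfl
    exact h (by simp [cylR])
  · intro h h'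
    rw [Prod.mk_eq_zero] at h'
    exact apply_two_ne_zero h h'.2 h'.1

theorem exists_azimuth (x : E3) :
    ∃ ϑ : ℝ, x = !₂[cylR x * Real.cos ϑ, cylR x * Real.sin ϑ, x 2] := by
  have h : cylR x = ‖(⟨x 0, x 1⟩ : ℂ)‖ := by
    rw [cylR, Complex.norm_def, Complex.normSq_mk]
    ring_nf
  refine ⟨Complex.arg ⟨x 0, x 1⟩, ?_⟩
  ext i
  fin_cases i
  · simp [h, Complex.norm_mul_cos_arg]
  · simp [h, Complex.norm_mul_sin_arg]
  · simp

theorem exists_polar {z r : ℝ} (hr : 0 < r) :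
    ∃ t ∈ Ioo (0 : ℝ) 1, ∃ ρ : ℝ, 0 < ρ ∧
      z = ρ * Real.cos (Real.pi * t) ∧ r = ρ * Real.sin (Real.pi * t) := by
  have h0 : 0 < z ^ 2 + r ^ 2 := by positivity
  set ρ := Real.sqrt (z ^ 2 + r ^ 2) with hρ
  have hρ0 : 0 < ρ := Real.sqrt_pos.2 h0
  have hρ2 : ρ ^ 2 = z ^ 2 + r ^ 2 := Real.sq_sqrt h0.le
  have hz1 : z / ρ < 1 := by
    rw [div_lt_one hρ0]; nlinarith
  have hz2 : -1 < z / ρ := by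
    rw [lt_div_iff₀ hρ0]; nlinarith
  have hpi := Real.pi_pos
  have hcos : Real.cos (Real.pi * (Real.arccos (z / ρ) / Real.pi)) = z / ρ := by
    rw [mul_div_cancel₀ _ hpi.ne', Real.cos_arccos hz2.le hz1.le]
  have ht0 : 0 < Real.arccos (z / ρ) := Real.arccos_pos.2 hz1
  have ht1 : Real.arccos (z / ρ) < Real.pi := by
    refine lt_of_le_of_ne (Real.arccos_le_pi _) fun h => ?_
    rw [Real.arccos_eq_pi] at h
    linarith
  refine ⟨Real.arccos (z / ρ) / Real.pi, ⟨by positivity, by rwa [div_lt_one hpi]⟩, ρ, hρ0, ?_, ?_⟩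
  · rw [hcos, mul_div_cancel₀ _ hρ0.ne']
  · rw [mul_div_cancel₀ _ hpi.ne', Real.sin_arccos,
      show 1 - (z / ρ) ^ 2 = (r / ρ) ^ 2 by field_simp; linarith,
      Real.sqrt_sq (by positivity), mul_div_cancel₀ _ hρ0.ne']

end

/-! ### Surfaces swept by the level curves, for functions C ψ^κ on ℝ³. -/

section

/-- A homogeneous stream function that is continuous up to the axis and zero there. -/
structure IsAxisStream (β : ℝ) (ψ : ℝ → ℝ → ℝ) : Prop extends IsHomogeneousStream β ψ where
  smooth : ContDiffOn ℝ 1 (fun q : ℝ × ℝ => ψ q.1 q.2) {q | 0 < q.2}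
  cont : ContinuousOn (fun q : ℝ × ℝ => ψ q.1 q.2) {q | 0 ≤ q.2 ∧ q ≠ 0}
  axis : ∀ z : ℝ, z ≠ 0 → ψ z 0 = 0

theorem isOpen_offAxis : IsOpen {x : E3 | 0 < cylR x} :=
  isOpen_lt continuous_const continuous_cylR

theorem contDiffAt_cylR {n : WithTop ℕ∞} {x : E3} (hx : 0 < cylR x) : ContDiffAt ℝ n cylR x := by
  have h : x 0 ^ 2 + x 1 ^ 2 ≠ 0 := by rw [← cylR_sq]; positivity
  unfold cylR
  exact ContDiffAt.sqrt (by fun_prop) h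

theorem contDiffAt_cyl {n : WithTop ℕ∞} {x : E3} (hx : 0 < cylR x) :
    ContDiffAt ℝ n (fun y : E3 => (y 2, cylR y)) x :=
  ContDiffAt.prodMk (by fun_prop) (contDiffAt_cylR hx)

theorem isOpen_upperHalf : IsOpen {q : ℝ × ℝ | 0 < q.2} := isOpen_lt continuous_const continuous_snd

theorem contDiffAt_comp_cyl {n : WithTop ℕ∞} {ψ : ℝ → ℝ → ℝ}
    (h : ContDiffOn ℝ n (fun q : ℝ × ℝ => ψ q.1 q.2) {q | 0 < q.2}) {x : E3} (hx : 0 < cylR x) :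
    ContDiffAt ℝ n (fun y : E3 => ψ (y 2) (cylR y)) x := by
  have h1 : ContDiffAt ℝ n (fun q : ℝ × ℝ => ψ q.1 q.2) (x 2, cylR x) :=
    h.contDiffAt (isOpen_upperHalf.mem_nhds hx)
  exact h1.comp x (contDiffAt_cyl hx)

/-- Euler's identity for homogeneous functions. -/
theorem fderiv_apply_self_of_homogeneous {E : Type*} [NormedAddCommGroup E] [NormedSpace ℝ E]
    {F : E → ℝ} {x : E} {m : ℝ} (hF : DifferentiableAt ℝ F x)
    (h : ∀ l : ℝ, 0 < l → F (l • x) = l ^ m * F x) : fderiv ℝ F x x = m * F x := by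
  have h1 : HasDerivAt (fun l : ℝ => l • x) ((1 : ℝ) • x) 1 := (hasDerivAt_id (1 : ℝ)).smul_const x
  have hF' : HasFDerivAt F (fderiv ℝ F x) ((1 : ℝ) • x) := by
    rw [one_smul]; exact hF.hasFDerivAt
  have h2 := hF'.comp_hasDerivAt (1 : ℝ) h1
  have h3 : HasDerivAt (fun l : ℝ => l ^ m * F x) (m * 1 ^ (m - 1) * F x) 1 :=
    (Real.hasDerivAt_rpow_const (Or.inl one_ne_zero)).mul_const _
  have h4 : (F ∘ fun l : ℝ => l • x) =ᶠ[𝓝 1] fun l : ℝ => l ^ m * F x := by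
    filter_upwards [lt_mem_nhds (zero_lt_one (α := ℝ))] with l hl using h l hl
  have h5 := (h3.congr_of_eventuallyEq h4).unique h2
  rw [Real.one_rpow, mul_one, one_smul] at h5
  exact h5.symm

namespace IsAxisStream

variable {β : ℝ} {ψ : ℝ → ℝ → ℝ}

theorem scale (h : IsAxisStream β ψ) {l z r : ℝ} (hl : 0 < l) (hr : 0 < r) :
    ψ (l * z) (l * r) = l ^ (-β) * ψ z r := by
  rw [h.homog l z r hl hr, ← mul_assoc, ← Real.rpow_add hl]
  simp

theorem continuousOn_polar (h : IsAxisStream β ψ) :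
    ContinuousOn (fun t : ℝ => ψ (Real.cos (Real.pi * t)) (Real.sin (Real.pi * t))) (Icc 0 1) := by
  have h1 : Continuous fun t : ℝ => (Real.cos (Real.pi * t), Real.sin (Real.pi * t)) := by fun_prop
  refine h.cont.comp h1.continuousOn fun t ht => ⟨?_, fun h0 => ?_⟩
  · exact Real.sin_nonneg_of_nonneg_of_le_pi (mul_nonneg Real.pi_pos.le ht.1)
      (mul_le_of_le_one_right Real.pi_pos.le ht.2)
  · rw [Prod.mk_eq_zero] at h0
    have := Real.sin_sq_add_cos_sq (Real.pi * t)
    rw [h0.1, h0.2] at this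
    norm_num at this

theorem sin_pi_mul_pos {t : ℝ} (ht : t ∈ Ioo (0 : ℝ) 1) : 0 < Real.sin (Real.pi * t) :=
  Real.sin_pos_of_pos_of_lt_pi (mul_pos Real.pi_pos ht.1) (mul_lt_of_lt_one_right Real.pi_pos ht.2)

variable {κ C s : ℝ} {F : E3 → ℝ}

/-- On the axis ψ = 0, so no nonzero value of F is taken there. Off the axis ψ > 0 is recovered from
its power. -/
theorem level_iff (h : IsAxisStream β ψ) (hκ : 0 < κ) (hC : C ≠ 0)
    (hF : ∀ x : E3, x ≠ 0 → F x = C * ψ (x 2) (cylR x) ^ κ) {c : ℝ} (hc : 0 < c / C) (x : E3) :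
    x ∈ levelSet F c ↔ 0 < cylR x ∧ ψ (x 2) (cylR x) = (c / C) ^ (1 / κ) := by
  constructor
  · rintro ⟨hx, hFx⟩
    rw [hF x hx] at hFx
    have hpow : ψ (x 2) (cylR x) ^ κ = c / C := by rw [← hFx]; field_simp
    rcases (cylR_nonneg x).eq_or_lt with h0 | h0
    · rw [← h0, h.axis _ (apply_two_ne_zero hx h0.symm), Real.zero_rpow hκ.ne'] at hpow
      exact absurd hpow hc.ne
    · exact ⟨h0, by rw [← hpow, rpow_rpow_inv_self (h.pos _ _ h0).le hκ.ne']⟩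
  · rintro ⟨hr, hψ⟩
    refine ⟨ne_zero_of_cylR_pos hr, ?_⟩
    rw [hF x (ne_zero_of_cylR_pos hr), hψ, rpow_inv_rpow_self hc.le hκ.ne']
    field_simp

/-- The curve `ψ = d` in the half plane, closed up at the origin. -/
def levelCurve (β : ℝ) (ψ : ℝ → ℝ → ℝ) (d t : ℝ) : ℝ × ℝ :=
  ((ψ (Real.cos (Real.pi * t)) (Real.sin (Real.pi * t)) / d) ^ (1 / β) * Real.sin (Real.pi * t),
   (ψ (Real.cos (Real.pi * t)) (Real.sin (Real.pi * t)) / d) ^ (1 / β) * Real.cos (Real.pi * t))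

theorem levelCurve_zero (h : IsAxisStream β ψ) (hβ : 0 < β) (d : ℝ) :
    levelCurve β ψ d 0 = 0 := by
  simp [levelCurve, h.axis 1 one_ne_zero, Real.zero_rpow (inv_ne_zero hβ.ne')]

theorem levelCurve_one (h : IsAxisStream β ψ) (hβ : 0 < β) (d : ℝ) :
    levelCurve β ψ d 1 = 0 := by
  simp [levelCurve, h.axis (-1) (by norm_num), Real.zero_rpow (inv_ne_zero hβ.ne')]

theorem radius_pos (h : IsAxisStream β ψ) {d t : ℝ} (hd : 0 < d) (ht : t ∈ Ioo (0 : ℝ) 1) :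
    0 < (ψ (Real.cos (Real.pi * t)) (Real.sin (Real.pi * t)) / d) ^ (1 / β) :=
  Real.rpow_pos_of_pos (div_pos (h.pos _ _ (sin_pi_mul_pos ht)) hd) _

theorem levelCurve_fst_pos (h : IsAxisStream β ψ) {d t : ℝ} (hd : 0 < d)
    (ht : t ∈ Ioo (0 : ℝ) 1) : 0 < (levelCurve β ψ d t).1 :=
  mul_pos (h.radius_pos hd ht) (sin_pi_mul_pos ht)

/-- The radius is positive for 0 < t < 1 and zero at both ends, because ψ vanishes on the axis.
Injectivity: the distance to the origin determines the radius, and then cos is injective on [0, π].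
-/
theorem isJordanCurve_levelCurve (h : IsAxisStream β ψ) (hβ : 0 < β) {d : ℝ} (hd : 0 < d) :
    IsJordanCurve (levelCurve β ψ d '' Icc 0 1) := by
  refine ⟨levelCurve β ψ d, ?_, ?_, ?_, rfl⟩
  · have h1 : ContinuousOn (fun t : ℝ =>
        (ψ (Real.cos (Real.pi * t)) (Real.sin (Real.pi * t)) / d) ^ (1 / β)) (Icc 0 1) :=
      (h.continuousOn_polar.div_const d).rpow_const fun t _ => Or.inr (by positivity)
    exact (h1.mul (by fun_prop)).prodMk (h1.mul (by fun_prop))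
  · intro t ht t' ht' heq
    rcases ht.1.eq_or_lt with rfl | h0
    · rcases ht'.1.eq_or_lt with h0' | h0'
      · exact h0'
      · have := h.levelCurve_fst_pos hd ⟨h0', ht'.2⟩
        rw [← heq, h.levelCurve_zero hβ] at this
        exact absurd this (lt_irrefl _)
    · rcases ht'.1.eq_or_lt with h0' | h0'
      · have := h.levelCurve_fst_pos hd ⟨h0, ht.2⟩
        rw [heq, ← h0', h.levelCurve_zero hβ] at this
        exact absurd this (lt_irrefl _)
      · have hR := h.radius_pos hd ⟨h0, ht.2⟩
        have hR' := h.radius_pos hd ⟨h0', ht'.2⟩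
        simp only [levelCurve, Prod.mk.injEq] at heq
        set R := (ψ (Real.cos (Real.pi * t)) (Real.sin (Real.pi * t)) / d) ^ (1 / β)
        set R' := (ψ (Real.cos (Real.pi * t')) (Real.sin (Real.pi * t')) / d) ^ (1 / β)
        have e1 : R ^ 2 = R' ^ 2 := by
          have a1 := Real.sin_sq_add_cos_sq (Real.pi * t)
          have a2 := Real.sin_sq_add_cos_sq (Real.pi * t')
          calc R ^ 2 = (R * Real.sin (Real.pi * t)) ^ 2 + (R * Real.cos (Real.pi * t)) ^ 2 := by
                linear_combination -R ^ 2 * a1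
            _ = R' ^ 2 := by rw [heq.1, heq.2]; linear_combination R' ^ 2 * a2
        have e2 : R = R' := by
          rwa [sq_eq_sq₀ hR.le hR'.le] at e1
        have e3 : Real.cos (Real.pi * t) = Real.cos (Real.pi * t') := by
          have := heq.2
          rw [e2] at this
          exact mul_left_cancel₀ hR'.ne' this
        have hpi := Real.pi_pos
        have e4 := Real.injOn_cos
          ⟨mul_nonneg hpi.le ht.1, mul_le_of_le_one_right hpi.le ht.2.le⟩
          ⟨mul_nonneg hpi.le ht'.1, mul_le_of_le_one_right hpi.le ht'.2.le⟩ e3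
        exact mul_left_cancel₀ hpi.ne' e4
  · rw [h.levelCurve_zero hβ, h.levelCurve_one hβ]

theorem mem_levelCurve_iff (h : IsAxisStream β ψ) (hβ : 0 < β) {d : ℝ} (hd : 0 < d)
    {z r : ℝ} (hr : 0 < r) : (r, z) ∈ levelCurve β ψ d '' Icc 0 1 ↔ ψ z r = d := by
  constructor
  · rintro ⟨t, ht, hq⟩
    have ht' : t ∈ Ioo (0 : ℝ) 1 := by
      refine ⟨ht.1.lt_of_ne' ?_, ht.2.lt_of_ne ?_⟩
      · rintro rfl
        rw [h.levelCurve_zero hβ] at hq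
        exact hr.ne (congrArg Prod.fst hq)
      · rintro rfl
        rw [h.levelCurve_one hβ] at hq
        exact hr.ne (congrArg Prod.fst hq)
    have hs := sin_pi_mul_pos ht'
    have hR := h.radius_pos hd ht'
    have hp := h.pos (Real.cos (Real.pi * t)) _ hs
    simp only [levelCurve, Prod.mk.injEq] at hq
    rw [← hq.1, ← hq.2, h.scale hR hs, Real.rpow_neg hR.le,
      rpow_inv_rpow_self (div_pos hp hd).le hβ.ne']
    field_simp
  · intro hψ
    obtain ⟨t, ht, ρ, hρ, rfl, rfl⟩ := exists_polar (z := z) hr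
    refine ⟨t, Ioo_subset_Icc_self ht, ?_⟩
    have h1 := h.homog ρ (Real.cos (Real.pi * t)) (Real.sin (Real.pi * t)) hρ (sin_pi_mul_pos ht)
    rw [hψ] at h1
    have h2 : (ψ (Real.cos (Real.pi * t)) (Real.sin (Real.pi * t)) / d) ^ (1 / β) = ρ := by
      rw [h1, mul_div_cancel_right₀ _ hd.ne', rpow_rpow_inv_self hρ.le hβ.ne']
    simp only [levelCurve, h2]

theorem infty_level (h : IsAxisStream β ψ) (hβ : 0 < β) (hκ : 0 < κ) (hC : C ≠ 0)
    (hF : ∀ x : E3, x ≠ 0 → F x = C * ψ (x 2) (cylR x) ^ κ) {c : ℝ} (hc : 0 < c / C) :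
    ∃ E : Set (ℝ × ℝ), IsInftySign E ∧ levelSet F c ∪ {0} = rotated E := by
  set d := (c / C) ^ (1 / κ) with hd_def
  have hd : 0 < d := Real.rpow_pos_of_pos hc _
  have hpos : ∀ q ∈ levelCurve β ψ d '' Icc 0 1, q ≠ (0, 0) → 0 < q.1 := by
    rintro q ⟨t, ht, rfl⟩ hq
    refine h.levelCurve_fst_pos hd ⟨ht.1.lt_of_ne' ?_, ht.2.lt_of_ne ?_⟩
    · rintro rfl
      exact hq (h.levelCurve_zero hβ d)
    · rintro rfl
      exact hq (h.levelCurve_one hβ d)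
  have h0 : ((0, 0) : ℝ × ℝ) ∈ levelCurve β ψ d '' Icc 0 1 :=
    ⟨0, by simp, h.levelCurve_zero hβ d⟩
  refine ⟨_, ⟨_, h.isJordanCurve_levelCurve hβ hd, h0, hpos, rfl⟩, ?_⟩
  have key : ∀ q ∈ levelCurve β ψ d '' Icc 0 1, ∀ (x : E3), x 2 = q.2 → cylR x = q.1 →
      x ∈ levelSet F c ∪ {0} := by
    rintro ⟨r, z⟩ hq x hx2 hxr
    simp only at hx2 hxr
    by_cases hq0 : (r, z) = (0, 0)
    · right
      simp only [Prod.mk.injEq] at hq0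
      by_contra hx
      exact apply_two_ne_zero hx (hxr.trans hq0.1) (hx2.trans hq0.2)
    · left
      have hr : 0 < r := hpos _ hq hq0
      rw [h.level_iff hκ hC hF hc, hx2, hxr]
      exact ⟨hr, (h.mem_levelCurve_iff hβ hd hr).1 hq⟩
  ext x
  constructor
  · rintro (hx | rfl)
    · rw [h.level_iff hκ hC hF hc] at hx
      obtain ⟨ϑ, hϑ⟩ := exists_azimuth x
      exact ⟨(cylR x, x 2), Or.inl ((h.mem_levelCurve_iff hβ hd hx.1).2 hx.2), ϑ, hϑ⟩
    · refine ⟨(0, 0), Or.inl h0, 0, ?_⟩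
      ext i
      fin_cases i <;> simp
  · rintro ⟨q, hq, ϑ, rfl⟩
    -- Because of the absolute value, the loop and its mirror image sweep the same surface.
    have hcyl : ∀ a b : ℝ, cylR !₂[a * Real.cos ϑ, a * Real.sin ϑ, b] = |a| := by
      intro a b
      rw [cylR_vec, show (a * Real.cos ϑ) ^ 2 + (a * Real.sin ϑ) ^ 2 = a ^ 2 by
        linear_combination a ^ 2 * Real.sin_sq_add_cos_sq ϑ, Real.sqrt_sq_eq_abs]
    have hnn : ∀ q ∈ levelCurve β ψ d '' Icc 0 1, 0 ≤ q.1 := by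
      intro q hq
      by_cases hq0 : q = (0, 0)
      · rw [hq0]
      · exact (hpos q hq hq0).le
    rcases hq with hq | ⟨q, hq, rfl⟩
    · exact key q hq _ (by simp) (by rw [hcyl, abs_of_nonneg (hnn q hq)])
    · exact key q hq _ (by simp) (by rw [hcyl, abs_neg, abs_of_nonneg (hnn q hq)])

/-- F is homogeneous of degree -βκ, so its derivative at x in the direction x is -βκ F(x), which is
nonzero off the axis. -/
theorem regular_level (h : IsAxisStream β ψ) (hβ : 0 < β) (hκ : 0 < κ) (hC : C ≠ 0)
    (hF : ∀ x : E3, x ≠ 0 → F x = C * ψ (x 2) (cylR x) ^ κ) {x : E3} (hx : 0 < cylR x) :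
    ContDiffAt ℝ 1 F x ∧ fderiv ℝ F x ≠ 0 := by
  have hx0 := ne_zero_of_cylR_pos hx
  have hψ : 0 < ψ (x 2) (cylR x) := h.pos _ _ hx
  have h1 : ContDiffAt ℝ 1 F x := by
    have : ContDiffAt ℝ 1 (fun y : E3 => C * ψ (y 2) (cylR y) ^ κ) x :=
      contDiffAt_const.mul ((contDiffAt_comp_cyl h.smooth hx).rpow_const_of_ne hψ.ne')
    refine this.congr_of_eventuallyEq ?_
    filter_upwards [isOpen_compl_singleton.mem_nhds hx0] with y hy using hF y hy
  refine ⟨h1, fun h0 => ?_⟩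
  have h2 := fderiv_apply_self_of_homogeneous (m := -β * κ) (h1.differentiableAt one_ne_zero)
    (fun l hl => by
      rw [hF _ (smul_ne_zero hl.ne' hx0), hF x hx0, cylR_smul hl.le]
      simp only [PiLp.smul_apply, smul_eq_mul]
      rw [h.scale hl hx, Real.mul_rpow (Real.rpow_pos_of_pos hl _).le hψ.le, ← Real.rpow_mul hl.le]
      ring)
  rw [h0, hF x hx0] at h2
  have h3 : ψ (x 2) (cylR x) ^ κ ≠ 0 := (Real.rpow_pos_of_pos hψ _).ne'
  simp [hβ.ne', hκ.ne', hC, h3] at h2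

theorem continuousOn_cyl (h : IsAxisStream β ψ) :
    ContinuousOn (fun x : E3 => ψ (x 2) (cylR x)) {0}ᶜ := by
  have h1 : Continuous fun x : E3 => (x 2, cylR x) :=
    (by fun_prop : Continuous fun x : E3 => x 2).prodMk continuous_cylR
  exact h.cont.comp h1.continuousOn fun x hx => ⟨cylR_nonneg x, cyl_mem_iff.2 hx⟩

theorem nonneg_cyl (h : IsAxisStream β ψ) {x : E3} (hx : x ≠ 0) : 0 ≤ ψ (x 2) (cylR x) := by
  rcases (cylR_nonneg x).eq_or_lt with h0 | h0
  · rw [← h0, h.axis _ (apply_two_ne_zero hx h0.symm)]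
  · exact (h.pos _ _ h0).le

/-- The angular part ρ^β ψ is continuous on a closed interval, hence at most some M. Then ψ > d
forces ρ^β ≤ M/d. -/
theorem isBounded_superlevel (h : IsAxisStream β ψ) (hβ : 0 < β) {d : ℝ} (hd : 0 < d) :
    Bornology.IsBounded {x : E3 | x ≠ 0 ∧ d < ψ (x 2) (cylR x)} := by
  obtain ⟨M, hM⟩ := (isCompact_Icc.image_of_continuousOn h.continuousOn_polar).bddAbove
  refine (Metric.isBounded_closedBall (x := (0 : E3)) (r := (M / d) ^ (1 / β))).subset ?_
  rintro x ⟨hx, hdx⟩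
  rw [mem_closedBall_zero_iff]
  have hr : 0 < cylR x := by
    refine (cylR_nonneg x).lt_of_ne fun h0 => ?_
    rw [← h0, h.axis _ (apply_two_ne_zero hx h0.symm)] at hdx
    exact absurd hdx hd.not_gt
  obtain ⟨t, ht, ρ, hρ, hz, hr'⟩ := exists_polar (z := x 2) hr
  have hρx : ‖x‖ = ρ := by
    have := norm_sq_eq_cyl x
    rw [hz, hr', show (ρ * Real.cos (Real.pi * t)) ^ 2 + (ρ * Real.sin (Real.pi * t)) ^ 2 = ρ ^ 2 by
      linear_combination ρ ^ 2 * Real.sin_sq_add_cos_sq (Real.pi * t)] at this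
    rwa [sq_eq_sq₀ (norm_nonneg x) hρ.le] at this
  have hg : ψ (Real.cos (Real.pi * t)) (Real.sin (Real.pi * t)) ≤ M :=
    hM ⟨t, Ioo_subset_Icc_self ht, rfl⟩
  rw [h.homog ρ _ _ hρ (sin_pi_mul_pos ht), ← hz, ← hr'] at hg
  have hρβ : 0 < ρ ^ β := Real.rpow_pos_of_pos hρ _
  have : ρ ^ β ≤ M / d := by
    rw [le_div_iff₀ hd]
    exact (mul_le_mul_of_nonneg_left hdx.le hρβ.le).trans hg
  rw [hρx, ← rpow_rpow_inv_self hρ.le hβ.ne']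
  exact Real.rpow_le_rpow hρβ.le this (by positivity)

/-- The complement of the surface is the union of the disjoint open sets {ψ > d} and {ψ < d}. The
component of a point of the higher level stays in {ψ > d}, which is bounded. -/
theorem nested_level (h : IsAxisStream β ψ) (hβ : 0 < β) (hκ : 0 < κ) (hC : C ≠ 0)
    (hF : ∀ x : E3, x ≠ 0 → F x = C * ψ (x 2) (cylR x) ^ κ) {c c' : ℝ} (hc : 0 < c / C)
    (hcc : c / C < c' / C) : levelSet F c' ⊆ enclosed (levelSet F c ∪ {0}) := by
  intro x hx
  set d := (c / C) ^ (1 / κ) with hd_def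
  have hd : 0 < d := Real.rpow_pos_of_pos hc _
  have hlev : ∀ y : E3, y ≠ 0 → ψ (y 2) (cylR y) = d → y ∈ levelSet F c := by
    intro y hy hyd
    refine ⟨hy, ?_⟩
    rw [hF y hy, hyd, rpow_inv_rpow_self hc.le hκ.ne']
    field_simp
  have hx' := (h.level_iff hκ hC hF (hc.trans hcc) x).1 hx
  have hx0 : x ≠ 0 := hx.1
  have hdx : d < ψ (x 2) (cylR x) := by
    rw [hx'.2]
    exact Real.rpow_lt_rpow hc.le hcc (by positivity)
  have hxS : x ∉ levelSet F c ∪ {0} := by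
    rintro (hx1 | hx1)
    · have := ((h.level_iff hκ hC hF hc x).1 hx1).2
      exact hdx.ne' this
    · exact hx0 hx1
  refine ⟨hxS, ?_⟩
  refine (h.isBounded_superlevel hβ hd).subset ?_
  have hU : IsOpen {y : E3 | y ≠ 0 ∧ d < ψ (y 2) (cylR y)} :=
    h.continuousOn_cyl.isOpen_inter_preimage isOpen_compl_singleton isOpen_Ioi
  have hV : IsOpen {y : E3 | y ≠ 0 ∧ ψ (y 2) (cylR y) < d} :=
    h.continuousOn_cyl.isOpen_inter_preimage isOpen_compl_singleton isOpen_Iio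
  refine isPreconnected_connectedComponentIn.subset_left_of_subset_union hU hV ?_ ?_ ?_
  · rw [Set.disjoint_left]
    exact fun y hy hy' => lt_asymm hy.2 hy'.2
  · intro y hy
    have hyS := connectedComponentIn_subset _ _ hy
    have hy0 : y ≠ 0 := fun h0 => hyS (Or.inr h0)
    rcases lt_trichotomy (ψ (y 2) (cylR y)) d with h1 | h1 | h1
    · exact Or.inr ⟨hy0, h1⟩
    · exact absurd (Or.inl (hlev y hy0 h1)) hyS
    · exact Or.inl ⟨hy0, h1⟩
  · exact ⟨x, mem_connectedComponentIn hxS, hx0, hdx⟩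

theorem hasNestedInftyLevels (h : IsAxisStream β ψ) (hβ : 0 < β) (hκ : 0 < κ) (hsC : 0 < s * C)
    (hF : ∀ x : E3, x ≠ 0 → F x = C * ψ (x 2) (cylR x) ^ κ) : HasNestedInftyLevels F s := by
  have hC : C ≠ 0 := right_ne_zero_of_mul hsC.ne'
  have hdiv : ∀ c : ℝ, 0 < s * c → 0 < c / C := by
    intro c hc
    have : 0 < (s * c) / (s * C) := div_pos hc hsC
    rwa [mul_div_mul_left _ _ (left_ne_zero_of_mul hsC.ne')] at this
  refine ⟨fun c hc => h.infty_level hβ hκ hC hF (hdiv c hc), fun c hc x hx => ?_,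
    fun c c' hc hc' hcc => ?_, ?_, fun c hc => ?_⟩
  · exact h.regular_level hβ hκ hC hF ((h.level_iff hκ hC hF (hdiv c hc) x).1 hx).1
  · refine h.nested_level hβ hκ hC hF (hdiv c hc) ?_
    rw [← abs_of_pos (hdiv c hc), ← abs_of_pos (hdiv c' hc'), abs_div, abs_div]
    exact div_lt_div_of_pos_right hcc (abs_pos.2 hC)
  · ext x
    constructor
    · rintro ⟨hx, hFx⟩
      refine ⟨hx, ?_⟩
      by_contra h0
      have hr := (cylR_nonneg x).lt_of_ne' h0
      rw [hF x hx] at hFx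
      exact mul_ne_zero hC (Real.rpow_pos_of_pos (h.pos _ _ hr) κ).ne' hFx
    · rintro ⟨hx, h0⟩
      refine ⟨hx, ?_⟩
      rw [hF x hx, h0, h.axis _ (apply_two_ne_zero hx h0), Real.zero_rpow hκ.ne', mul_zero]
  · refine eq_empty_of_forall_notMem ?_
    rintro x ⟨hx, hFx⟩
    rw [hF x hx] at hFx
    have h1 : 0 ≤ (s * C) * ψ (x 2) (cylR x) ^ κ :=
      mul_nonneg hsC.le (Real.rpow_nonneg (h.nonneg_cyl hx) κ)
    rw [mul_assoc, hFx] at h1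
    exact absurd hc h1.not_gt

end IsAxisStream

end

/-! ### Vector calculus of axisymmetric fields and the Lamb form of the Euler equations. -/

section

/-- The axisymmetric vector field with components `u^r = r a`, `u^φ = r b`, `u^z = c`, where
`a`, `b`, `c` are functions of `(z, r)`. -/
def axisField (a b c : ℝ × ℝ → ℝ) (x : E3) : E3 :=
  !₂[x 0 * a (x 2, cylR x) - x 1 * b (x 2, cylR x),
     x 1 * a (x 2, cylR x) + x 0 * b (x 2, cylR x), c (x 2, cylR x)]

/-- The azimuthal vector field `r e_φ`. -/
def azimuthal (x : E3) : E3 := !₂[-x 1, x 0, 0]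

theorem hasFDerivAt_coord (i : Fin 3) (x : E3) :
    HasFDerivAt (fun y : E3 => y i) (EuclideanSpace.proj (𝕜 := ℝ) i : E3 →L[ℝ] ℝ) x :=
  (EuclideanSpace.proj (𝕜 := ℝ) i : E3 →L[ℝ] ℝ).hasFDerivAt

theorem hasFDerivAt_cylR {x : E3} (hx : 0 < cylR x) :
    HasFDerivAt cylR ((x 0 / cylR x) • (EuclideanSpace.proj (𝕜 := ℝ) 0 : E3 →L[ℝ] ℝ)
      + (x 1 / cylR x) • (EuclideanSpace.proj (𝕜 := ℝ) 1 : E3 →L[ℝ] ℝ)) x := by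
  have h0 : x 0 ^ 2 + x 1 ^ 2 ≠ 0 := by rw [← cylR_sq]; positivity
  have h := (((hasFDerivAt_coord 0 x).pow 2).add ((hasFDerivAt_coord 1 x).pow 2)).sqrt h0
  refine h.congr_fderiv ?_
  ext v
  simp only [Pi.add_apply, Nat.cast_ofNat, Nat.add_one_sub_one, pow_one, _root_.smul_apply,
    _root_.add_apply, PiLp.proj_apply, smul_eq_mul, nsmul_eq_mul]
  have hr : Real.sqrt (x 0 ^ 2 + x 1 ^ 2) = cylR x := rfl
  rw [hr]
  field_simp

theorem hasFDerivAt_comp_cyl {g : ℝ × ℝ → ℝ} {g' : ℝ × ℝ →L[ℝ] ℝ} {x : E3} (hx : 0 < cylR x)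
    (hg : HasFDerivAt g g' (x 2, cylR x)) :
    HasFDerivAt (fun y : E3 => g (y 2, cylR y))
      (g' (1, 0) • (EuclideanSpace.proj (𝕜 := ℝ) 2 : E3 →L[ℝ] ℝ)
        + g' (0, 1) • ((x 0 / cylR x) • (EuclideanSpace.proj (𝕜 := ℝ) 0 : E3 →L[ℝ] ℝ)
          + (x 1 / cylR x) • (EuclideanSpace.proj (𝕜 := ℝ) 1 : E3 →L[ℝ] ℝ))) x := by
  have h1 := HasFDerivAt.comp x hg ((hasFDerivAt_coord 2 x).prodMk (hasFDerivAt_cylR hx))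
  refine h1.congr_fderiv ?_
  ext v
  simp only [ContinuousLinearMap.comp_apply, ContinuousLinearMap.prod_apply,
    _root_.smul_apply, _root_.add_apply, PiLp.proj_apply,
    smul_eq_mul]
  have h2 : ∀ s t : ℝ, g' (s, t) = g' (1, 0) * s + g' (0, 1) * t := by
    intro s t
    have : (s, t) = s • ((1, 0) : ℝ × ℝ) + t • ((0, 1) : ℝ × ℝ) := by simp
    rw [this, map_add, map_smul, map_smul, smul_eq_mul, smul_eq_mul]
    ring
  rw [h2]

variable {a b c : ℝ × ℝ → ℝ} {a' b' c' : ℝ × ℝ →L[ℝ] ℝ} {x : E3}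

theorem hasFDerivAt_axisField (hx : 0 < cylR x) (ha : HasFDerivAt a a' (x 2, cylR x))
    (hb : HasFDerivAt b b' (x 2, cylR x)) (hc : HasFDerivAt c c' (x 2, cylR x)) :
    DifferentiableAt ℝ (axisField a b c) x ∧ ∀ v : E3, fderiv ℝ (axisField a b c) x v =
      !₂[v 0 * a (x 2, cylR x)
          + x 0 * (a' (1, 0) * v 2 + a' (0, 1) * ((x 0 * v 0 + x 1 * v 1) / cylR x))
          - v 1 * b (x 2, cylR x)
          - x 1 * (b' (1, 0) * v 2 + b' (0, 1) * ((x 0 * v 0 + x 1 * v 1) / cylR x)),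
         v 1 * a (x 2, cylR x)
          + x 1 * (a' (1, 0) * v 2 + a' (0, 1) * ((x 0 * v 0 + x 1 * v 1) / cylR x))
          + v 0 * b (x 2, cylR x)
          + x 0 * (b' (1, 0) * v 2 + b' (0, 1) * ((x 0 * v 0 + x 1 * v 1) / cylR x)),
         c' (1, 0) * v 2 + c' (0, 1) * ((x 0 * v 0 + x 1 * v 1) / cylR x)] := by
  have hA := hasFDerivAt_comp_cyl hx ha
  have hB := hasFDerivAt_comp_cyl hx hb
  have hC := hasFDerivAt_comp_cyl hx hc
  have h0 := ((hasFDerivAt_coord 0 x).fun_mul hA).fun_sub ((hasFDerivAt_coord 1 x).fun_mul hB)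
  have h1 := ((hasFDerivAt_coord 1 x).fun_mul hA).fun_add ((hasFDerivAt_coord 0 x).fun_mul hB)
  have hd : DifferentiableAt ℝ (axisField a b c) x := by
    rw [differentiableAt_euclidean]
    intro i
    fin_cases i
    · exact h0.differentiableAt
    · exact h1.differentiableAt
    · exact hC.differentiableAt
  refine ⟨hd, fun v => ?_⟩
  have hcomp : ∀ i : Fin 3, fderiv ℝ (axisField a b c) x v i
      = fderiv ℝ (fun y => axisField a b c y i) x v := by
    intro i
    have h2 : HasFDerivAt (fun y => axisField a b c y i) _ x :=
      (EuclideanSpace.proj (𝕜 := ℝ) i : E3 →L[ℝ] ℝ).hasFDerivAt.comp x hd.hasFDerivAt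
    rw [h2.fderiv]
    rfl
  ext i
  rw [hcomp i]
  fin_cases i
  · have e : (fun y => axisField a b c y 0) = fun y : E3 =>
        y 0 * a (y 2, cylR y) - y 1 * b (y 2, cylR y) := by
      ext y; simp [axisField]
    show fderiv ℝ (fun y => axisField a b c y 0) x v = _
    rw [e, HasFDerivAt.fderiv h0]
    simp
    ring
  · have e : (fun y => axisField a b c y 1) = fun y : E3 =>
        y 1 * a (y 2, cylR y) + y 0 * b (y 2, cylR y) := by
      ext y; simp [axisField]
    show fderiv ℝ (fun y => axisField a b c y 1) x v = _
    rw [e, HasFDerivAt.fderiv h1]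
    simp
    ring
  · have e : (fun y => axisField a b c y 2) = fun y : E3 => c (y 2, cylR y) := by
      ext y; simp [axisField]
    show fderiv ℝ (fun y => axisField a b c y 2) x v = _
    rw [e, hC.fderiv]
    simp
    ring

theorem curl_axisField (hx : 0 < cylR x) (ha : HasFDerivAt a a' (x 2, cylR x))
    (hb : HasFDerivAt b b' (x 2, cylR x)) (hc : HasFDerivAt c c' (x 2, cylR x)) :
    curl (axisField a b c) x =
      !₂[-x 0 * b' (1, 0) + x 1 * (c' (0, 1) / cylR x - a' (1, 0)),
         -x 1 * b' (1, 0) - x 0 * (c' (0, 1) / cylR x - a' (1, 0)),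
         2 * b (x 2, cylR x) + cylR x * b' (0, 1)] := by
  obtain ⟨-, h⟩ := hasFDerivAt_axisField hx ha hb hc
  have hr := cylR_sq x
  unfold curl partialD
  simp only [h]
  ext i
  fin_cases i
  · simp
    ring
  · simp
    ring
  · simp
    field_simp
    linear_combination -b' (0, 1) * hr

theorem div_axisField (hx : 0 < cylR x) (ha : HasFDerivAt a a' (x 2, cylR x))
    (hb : HasFDerivAt b b' (x 2, cylR x)) (hc : HasFDerivAt c c' (x 2, cylR x)) :
    div (axisField a b c) x =
      2 * a (x 2, cylR x) + cylR x * a' (0, 1) + c' (1, 0) := by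
  obtain ⟨-, h⟩ := hasFDerivAt_axisField hx ha hb hc
  have hr := cylR_sq x
  unfold div partialD
  simp only [h, Fin.sum_univ_three]
  simp
  field_simp
  linear_combination -a' (0, 1) * hr

theorem fderiv_norm_sq_apply {u : E3 → E3} (hu : DifferentiableAt ℝ u x) (v : E3) :
    fderiv ℝ (fun y => ‖u y‖ ^ 2 / 2) x v = ∑ j, u x j * fderiv ℝ u x v j := by
  have h := (hu.hasFDerivAt.norm_sq).mul_const (1 / 2)
  have e : (fun y => ‖u y‖ ^ 2 / 2) = fun y => ‖u y‖ ^ 2 * (1 / 2) := by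
    ext y; ring
  rw [e, HasFDerivAt.fderiv h]
  simp [PiLp.inner_apply, mul_comm]

/-- The cross product of two vectors. -/
def cross (v w : E3) : E3 :=
  !₂[v 1 * w 2 - v 2 * w 1, v 2 * w 0 - v 0 * w 2, v 0 * w 1 - v 1 * w 0]

theorem gradient_apply {F : E3 → ℝ} (i : Fin 3) :
    gradient F x i = fderiv ℝ F x (EuclideanSpace.single i 1) := by
  have : inner ℝ (gradient F x) (EuclideanSpace.single i (1 : ℝ)) = gradient F x i := by
    rw [EuclideanSpace.inner_single_right, one_mul, conj_trivial]
  rw [← this, gradient, InnerProductSpace.toDual_symm_apply]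

/-- The Lamb form of the convective term. -/
theorem fderiv_apply_self_eq_lamb {u : E3 → E3} (hu : DifferentiableAt ℝ u x) :
    fderiv ℝ u x (u x) = cross (curl u x) (u x) + gradient (fun y => ‖u y‖ ^ 2 / 2) x := by
  have hv : u x = ∑ i, u x i • EuclideanSpace.single i (1 : ℝ) := by
    ext j
    fin_cases j <;> simp [Fin.sum_univ_three]
  have h1 : fderiv ℝ u x (u x) = ∑ i, u x i • fderiv ℝ u x (EuclideanSpace.single i (1 : ℝ)) := by
    conv_lhs => rw [hv]
    simp only [map_sum, map_smul]
  ext j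
  rw [h1, PiLp.add_apply, gradient_apply, fderiv_norm_sq_apply hu]
  simp only [Fin.sum_univ_three]
  fin_cases j <;> simp [cross, curl, partialD] <;> ring

theorem euler_iff_lamb {u : E3 → E3} {p : E3 → ℝ} (hu : DifferentiableAt ℝ u x)
    (hp : DifferentiableAt ℝ p x) :
    fderiv ℝ u x (u x) + gradient p x = cross (curl u x) (u x) + gradient (bernoulli u p) x := by
  have h1 : DifferentiableAt ℝ (fun y => ‖u y‖ ^ 2 / 2) x := by
    simpa only [div_eq_mul_inv] using (hu.norm_sq ℝ).mul_const (2⁻¹ : ℝ)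
  have h2 : gradient (bernoulli u p) x = gradient p x + gradient (fun y => ‖u y‖ ^ 2 / 2) x := by
    ext j
    rw [PiLp.add_apply, gradient_apply, gradient_apply, gradient_apply]
    have : bernoulli u p = p + fun y => ‖u y‖ ^ 2 / 2 := rfl
    rw [this, fderiv_add hp h1]
    rfl
  rw [fderiv_apply_self_eq_lamb hu, h2]
  abel

/-- Identities that hold off the axis hold on the axis away from the origin by continuity. -/
theorem eq_of_eq_offAxis {X : Type*} [TopologicalSpace X] [T2Space X] {f g : E3 → X}
    (hf : ContinuousOn f {0}ᶜ) (hg : ContinuousOn g {0}ᶜ)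
    (h : ∀ x : E3, 0 < cylR x → f x = g x) {x : E3} (hx : x ≠ 0) : f x = g x := by
  rcases (cylR_nonneg x).eq_or_lt with h0 | h0
  · obtain ⟨hx0, hx1⟩ := cylR_eq_zero.1 h0.symm
    have hcont : Continuous fun t : ℝ => x + t • (EuclideanSpace.single 0 (1 : ℝ) : E3) := by fun_prop
    have ht : Tendsto (fun t : ℝ => x + t • EuclideanSpace.single 0 (1 : ℝ)) (𝓝[>] 0) (𝓝 x) := by
      have := (hcont.tendsto 0).mono_left (nhdsWithin_le_nhds (s := Ioi (0 : ℝ)))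
      simpa using this
    have hfx := (hf.continuousAt (isOpen_compl_singleton.mem_nhds hx)).tendsto.comp ht
    have hgx := (hg.continuousAt (isOpen_compl_singleton.mem_nhds hx)).tendsto.comp ht
    refine tendsto_nhds_unique_of_eventuallyEq hfx hgx ?_
    filter_upwards [self_mem_nhdsWithin] with t ht
    have ht : 0 < t := ht
    refine h _ ?_
    unfold cylR
    simp [hx0, hx1]
    positivity
  · exact h x h0

theorem continuousOn_curl {u : E3 → E3} (hu : ContDiffOn ℝ 1 u {0}ᶜ) :
    ContinuousOn (curl u) {0}ᶜ := by
  have h1 : ContinuousOn (fderiv ℝ u) {0}ᶜ :=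
    hu.continuousOn_fderiv_of_isOpen isOpen_compl_singleton le_rfl
  have h2 : ∀ i j, ContinuousOn (partialD u i j) {0}ᶜ := fun i j =>
    (continuous_apply j |>.comp (PiLp.continuous_ofLp 2 _)).comp_continuousOn
      (h1.clm_apply continuousOn_const)
  unfold curl
  refine (PiLp.continuous_toLp 2 _).comp_continuousOn ?_
  rw [continuousOn_pi]
  intro i
  fin_cases i
  · exact (h2 1 2).sub (h2 2 1)
  · exact (h2 2 0).sub (h2 0 2)
  · exact (h2 0 1).sub (h2 1 0)

end

/-! ### Vorticity of a Clebsch field; the case C₁ = 0. -/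

section

variable {x : E3}

theorem smul_gradAngle_eq_axisField (ψ : ℝ → ℝ → ℝ) :
    (fun y : E3 => ψ (y 2) (cylR y) • gradAngle y)
      = axisField 0 (fun q => ψ q.1 q.2 / q.2 ^ 2) 0 := by
  ext y i
  fin_cases i
  · simp [axisField, gradAngle]
    ring
  · simp [axisField, gradAngle]
    ring
  · simp [axisField, gradAngle]

theorem hasFDerivAt_div_sq {g : ℝ × ℝ → ℝ} {g' : ℝ × ℝ →L[ℝ] ℝ} {q : ℝ × ℝ} (hq : 0 < q.2)
    (hg : HasFDerivAt g g' q) :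
    HasFDerivAt (fun p => g p / p.2 ^ 2)
      ((1 / q.2 ^ 2) • g' - (2 * g q / q.2 ^ 3) • ContinuousLinearMap.snd ℝ ℝ ℝ) q := by
  have h2 : HasFDerivAt (fun p : ℝ × ℝ => p.2) (ContinuousLinearMap.snd ℝ ℝ ℝ) q := hasFDerivAt_snd
  have h3 := (hasDerivAt_zpow (-2) q.2 (Or.inl hq.ne')).comp_hasFDerivAt q h2
  have h4 := hg.mul h3
  have e : (fun p : ℝ × ℝ => g p / p.2 ^ 2) = g * ((fun t : ℝ => t ^ (-2 : ℤ)) ∘ fun p => p.2) := by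
    ext p
    simp [div_eq_mul_inv, zpow_neg]
  rw [e]
  refine h4.congr_fderiv ?_
  have e1 : ∀ v : ℝ × ℝ, (g q * (((-2 : ℤ) : ℝ) * q.2 ^ (-2 - 1 : ℤ))) * v.2
      + q.2 ^ (-2 : ℤ) * g' v = 1 / q.2 ^ 2 * g' v - 2 * g q / q.2 ^ 3 * v.2 := by
    intro v
    rw [show (-2 - 1 : ℤ) = -((3 : ℕ) : ℤ) by norm_num, show (-2 : ℤ) = -((2 : ℕ) : ℤ) by norm_num,
      zpow_neg, zpow_neg, zpow_natCast, zpow_natCast]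
    push_cast
    field_simp
    ring
  refine ContinuousLinearMap.ext fun v => ?_
  have := e1 v
  simp only [_root_.add_apply, _root_.sub_apply, _root_.smul_apply, smul_eq_mul, Function.comp_apply,
    ContinuousLinearMap.coe_snd']
  rw [← this]
  ring

theorem curl_stream {ψ : ℝ → ℝ → ℝ} {ψ' : ℝ × ℝ →L[ℝ] ℝ} (hx : 0 < cylR x)
    (hψ : HasFDerivAt (fun q : ℝ × ℝ => ψ q.1 q.2) ψ' (x 2, cylR x)) :
    curl (fun y : E3 => ψ (y 2) (cylR y) • gradAngle y) x =
      !₂[x 0 * (-ψ' (1, 0) / cylR x ^ 2), x 1 * (-ψ' (1, 0) / cylR x ^ 2),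
        ψ' (0, 1) / cylR x] := by
  have h0 : HasFDerivAt (0 : ℝ × ℝ → ℝ) (0 : ℝ × ℝ →L[ℝ] ℝ) (x 2, cylR x) := hasFDerivAt_const 0 _
  rw [smul_gradAngle_eq_axisField, curl_axisField hx h0 (hasFDerivAt_div_sq hx hψ) h0]
  ext i
  fin_cases i
  · simp
    ring
  · simp
    ring
  · simp
    field_simp
    ring

/-- The curl of G(ψ)∇φ is G'(ψ) ∇ψ × ∇φ, that is, G'(ψ) times the poloidal part of the field. The
curl of the poloidal part is azimuthal. Completing the first term to G'(ψ) u changes only the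
azimuthal coefficient. -/
theorem curl_clebsch {ψ : ℝ → ℝ → ℝ} {ψ' a' c' : ℝ × ℝ →L[ℝ] ℝ} {a c : ℝ × ℝ → ℝ} {G : ℝ → ℝ}
    {g : ℝ} (hx : 0 < cylR x)
    (hψ : HasFDerivAt (fun q : ℝ × ℝ => ψ q.1 q.2) ψ' (x 2, cylR x))
    (hG : HasDerivAt G g (ψ (x 2) (cylR x)))
    (ha : HasFDerivAt a a' (x 2, cylR x)) (hc : HasFDerivAt c c' (x 2, cylR x))
    (haψ : a (x 2, cylR x) = -ψ' (1, 0) / cylR x ^ 2) (hcψ : c (x 2, cylR x) = ψ' (0, 1) / cylR x) :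
    curl (axisField a (fun q => G (ψ q.1 q.2) / q.2 ^ 2) c) x =
      g • axisField a (fun q => G (ψ q.1 q.2) / q.2 ^ 2) c x
        + (a' (1, 0) - c' (0, 1) / cylR x - g * (G (ψ (x 2) (cylR x)) / cylR x ^ 2))
          • azimuthal x := by
  have hGψ : HasFDerivAt (fun q : ℝ × ℝ => G (ψ q.1 q.2)) (g • ψ') (x 2, cylR x) :=
    HasDerivAt.comp_hasFDerivAt (x 2, cylR x) hG hψ
  rw [curl_axisField hx ha (hasFDerivAt_div_sq hx hGψ) hc]
  ext i
  fin_cases i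
  · simp [axisField, azimuthal, haψ, hcψ]
    field_simp
    ring
  · simp [axisField, azimuthal, haψ, hcψ]
    field_simp
    ring
  · simp [axisField, azimuthal, haψ, hcψ]
    field_simp
    ring

/-- The multiple of u drops out. When a = -∂_z ψ/r² and c = ∂_r ψ/r, the vector on the right is ∇ψ,
so the Lamb form balances κ∇ψ against ∇Π and amounts to κ = -Π'(ψ) wherever ∇ψ ≠ 0. -/
theorem cross_azimuthal {a b c : ℝ × ℝ → ℝ} (g κ : ℝ) :
    cross (g • axisField a b c x + κ • azimuthal x) (axisField a b c x) =
      κ • !₂[x 0 * c (x 2, cylR x), x 1 * c (x 2, cylR x),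
        -(x 0 ^ 2 + x 1 ^ 2) * a (x 2, cylR x)] := by
  ext i
  fin_cases i <;> simp [cross, axisField, azimuthal] <;> ring

theorem neg_of_deriv_neg_of_tendsto_zero {f f' : ℝ → ℝ} (hd : ∀ r, 0 < r → HasDerivAt f (f' r) r)
    (hn : ∀ r, 0 < r → f' r < 0) (ht : Tendsto f (𝓝[>] 0) (𝓝 0)) {r : ℝ} (hr : 0 < r) :
    f r < 0 := by
  have hanti : StrictAntiOn f (Ioi 0) := by
    refine strictAntiOn_of_deriv_neg (convex_Ioi 0)
      (fun s hs => (hd s hs).continuousAt.continuousWithinAt) fun s hs => ?_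
    rw [interior_Ioi] at hs
    rw [(hd s hs).deriv]
    exact hn s hs
  have h2 : 0 < r / 2 := half_pos hr
  have h1 : f (r / 2) ≤ 0 := by
    refine ge_of_tendsto ht ?_
    filter_upwards [Ioo_mem_nhdsGT h2] with s hs
    exact (hanti hs.1 h2 hs.2).le
  exact (hanti h2 hr (half_lt_self hr)).trans_le h1

/-- The circulation `Γ = C₂ ψ |ψ|^(1/β)` as a function of the value of the stream function. -/
def clebschFactor (C₂ β s : ℝ) : ℝ := C₂ * s * |s| ^ (1 / β)

theorem hasDerivAt_clebschFactor {C₂ β t : ℝ} (ht : 0 < t) :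
    HasDerivAt (clebschFactor C₂ β) (C₂ * (1 + 1 / β) * t ^ (1 / β)) t := by
  have h1 : HasDerivAt (fun s : ℝ => C₂ * s ^ (1 + 1 / β))
      (C₂ * ((1 + 1 / β) * t ^ (1 + 1 / β - 1))) t :=
    (Real.hasDerivAt_rpow_const (Or.inl ht.ne')).const_mul C₂
  rw [add_sub_cancel_left, ← mul_assoc] at h1
  refine h1.congr_of_eventuallyEq ?_
  filter_upwards [lt_mem_nhds ht] with s hs
  rw [clebschFactor, abs_of_pos hs, Real.rpow_add hs, Real.rpow_one, mul_assoc]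

namespace IsDipoleSolution

variable {α C₁ C₂ : ℝ} {ψ : ℝ → ℝ → ℝ} {u : E3 → E3} {p : E3 → ℝ}

theorem isAxisStream (h : IsDipoleSolution α C₁ C₂ ψ u p) : IsAxisStream (α - 2) ψ where
  pos := h.stream_pos
  homog := h.stream_homogeneous
  smooth := h.stream_regular.of_le one_le_two
  cont := h.stream_continuous
  axis := h.stream_axis

theorem differentiableAt (h : IsDipoleSolution α C₁ C₂ ψ u p) (hx : x ≠ 0) :
    DifferentiableAt ℝ u x :=
  (h.euler.1.contDiffAt (isOpen_compl_singleton.mem_nhds hx)).differentiableAt one_ne_zero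

/-- The Clebsch relation is given only for r > 0. Both sides are continuous away from the origin, so
it also holds on the axis. -/
theorem bernoulli_eq_off_origin (h : IsDipoleSolution α C₁ C₂ ψ u p) (hα : 2 < α) (hx : x ≠ 0) :
    bernoulli u p x = C₁ * ψ (x 2) (cylR x) ^ (2 + 4 / (α - 2)) := by
  have hβ : 0 < α - 2 := sub_pos.2 hα
  have hs := h.isAxisStream
  have hb : ContinuousOn (bernoulli u p) {0}ᶜ :=
    h.euler.2.1.continuousOn.add ((h.euler.1.continuousOn.norm.pow 2).div_const 2)
  have hψ : ContinuousOn (fun y : E3 => C₁ * ψ (y 2) (cylR y) ^ (2 + 4 / (α - 2))) {0}ᶜ :=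
    continuousOn_const.mul (hs.continuousOn_cyl.rpow_const fun _ _ => Or.inr (by positivity))
  refine eq_of_eq_offAxis hb hψ (fun y hy => ?_) hx
  rw [h.bernoulli_eq y hy, abs_of_pos (hs.pos _ _ hy)]

/-- The radial coefficient `u^r / r = -∂_z ψ / r²`. -/
def radialCoeff (ψ : ℝ → ℝ → ℝ) (q : ℝ × ℝ) : ℝ :=
  -fderiv ℝ (fun q : ℝ × ℝ => ψ q.1 q.2) q (1, 0) / q.2 ^ 2

/-- The axial velocity `u^z = ∂_r ψ / r`. -/
def axialCoeff (ψ : ℝ → ℝ → ℝ) (q : ℝ × ℝ) : ℝ :=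
  fderiv ℝ (fun q : ℝ × ℝ => ψ q.1 q.2) q (0, 1) / q.2

theorem hasFDerivAt_stream (h : IsDipoleSolution α C₁ C₂ ψ u p) {q : ℝ × ℝ} (hq : 0 < q.2) :
    HasFDerivAt (fun q : ℝ × ℝ => ψ q.1 q.2) (fderiv ℝ (fun q : ℝ × ℝ => ψ q.1 q.2) q) q :=
  ((h.stream_regular.contDiffAt (isOpen_upperHalf.mem_nhds hq)).differentiableAt
    two_ne_zero).hasFDerivAt

theorem contDiffAt_fderiv_stream (h : IsDipoleSolution α C₁ C₂ ψ u p) {q : ℝ × ℝ} (hq : 0 < q.2) :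
    ContDiffAt ℝ 1 (fderiv ℝ (fun q : ℝ × ℝ => ψ q.1 q.2)) q :=
  (h.stream_regular.fderiv_of_isOpen isOpen_upperHalf (by norm_num)).contDiffAt
    (isOpen_upperHalf.mem_nhds hq)

theorem differentiableAt_radialCoeff (h : IsDipoleSolution α C₁ C₂ ψ u p) {q : ℝ × ℝ}
    (hq : 0 < q.2) : DifferentiableAt ℝ (radialCoeff ψ) q := by
  have h1 := (h.contDiffAt_fderiv_stream hq).differentiableAt one_ne_zero
  have h2 : DifferentiableAt ℝ
      (fun q => -fderiv ℝ (fun q : ℝ × ℝ => ψ q.1 q.2) q (1, 0)) q :=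
    (h1.clm_apply (differentiableAt_const _)).fun_neg
  exact (hasFDerivAt_div_sq hq h2.hasFDerivAt).differentiableAt

theorem differentiableAt_axialCoeff (h : IsDipoleSolution α C₁ C₂ ψ u p) {q : ℝ × ℝ}
    (hq : 0 < q.2) : DifferentiableAt ℝ (axialCoeff ψ) q := by
  have h1 := (h.contDiffAt_fderiv_stream hq).differentiableAt one_ne_zero
  have h2 : DifferentiableAt ℝ
      (fun q => fderiv ℝ (fun q : ℝ × ℝ => ψ q.1 q.2) q (0, 1)) q :=
    h1.clm_apply (differentiableAt_const _)
  have h3 : DifferentiableAt ℝ (fun q : ℝ × ℝ => q.2⁻¹) q :=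
    (differentiableAt_inv hq.ne').comp q differentiableAt_snd
  exact h2.mul h3

theorem eq_axisField (h : IsDipoleSolution α C₁ C₂ ψ u p) (hx : 0 < cylR x) :
    u x = axisField (radialCoeff ψ)
      (fun q => clebschFactor C₂ (α - 2) (ψ q.1 q.2) / q.2 ^ 2)
      (axialCoeff ψ) x := by
  rw [h.clebsch x hx, curl_stream hx (h.hasFDerivAt_stream hx)]
  ext i
  fin_cases i
  · simp [axisField, gradAngle, radialCoeff, clebschFactor]
    ring
  · simp [axisField, gradAngle, radialCoeff, clebschFactor]
    ring
  · simp [axisField, gradAngle, axialCoeff]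

theorem eventuallyEq_axisField (h : IsDipoleSolution α C₁ C₂ ψ u p) (hx : 0 < cylR x) :
    u =ᶠ[𝓝 x] axisField (radialCoeff ψ)
      (fun q => clebschFactor C₂ (α - 2) (ψ q.1 q.2) / q.2 ^ 2)
      (axialCoeff ψ) := by
  filter_upwards [isOpen_offAxis.mem_nhds hx] with y hy using h.eq_axisField hy

theorem curl_congr {u v : E3 → E3} (h : u =ᶠ[𝓝 x] v) : curl u x = curl v x := by
  simp only [curl, partialD, h.fderiv_eq]

theorem div_congr {u v : E3 → E3} (h : u =ᶠ[𝓝 x] v) : div u x = div v x := by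
  simp only [div, partialD, h.fderiv_eq]

/-- The coefficient of the azimuthal part of `∇ × u - Γ'(ψ) u`. -/
def defect (α C₂ : ℝ) (ψ : ℝ → ℝ → ℝ) (q : ℝ × ℝ) : ℝ :=
  fderiv ℝ (radialCoeff ψ) q (1, 0) - fderiv ℝ (axialCoeff ψ) q (0, 1) / q.2
    - C₂ * (1 + 1 / (α - 2)) * ψ q.1 q.2 ^ (1 / (α - 2))
      * (clebschFactor C₂ (α - 2) (ψ q.1 q.2) / q.2 ^ 2)

theorem curl_eq (h : IsDipoleSolution α C₁ C₂ ψ u p) (hx : 0 < cylR x) :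
    curl u x = (C₂ * (1 + 1 / (α - 2)) * ψ (x 2) (cylR x) ^ (1 / (α - 2))) • u x
      + defect α C₂ ψ (x 2, cylR x) • azimuthal x := by
  rw [curl_congr (h.eventuallyEq_axisField hx), h.eq_axisField hx]
  exact curl_clebsch hx (h.hasFDerivAt_stream hx)
    (hasDerivAt_clebschFactor (h.stream_pos _ _ hx))
    (h.differentiableAt_radialCoeff hx).hasFDerivAt
    (h.differentiableAt_axialCoeff hx).hasFDerivAt rfl rfl

/-- Euler's identity for ψ, divided by r². For α > 2 the right side is nonzero, so the poloidal
velocity cannot vanish off the axis. -/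
theorem fderiv_stream_self (h : IsDipoleSolution α C₁ C₂ ψ u p) {q : ℝ × ℝ} (hq : 0 < q.2) :
    -q.1 * radialCoeff ψ q + axialCoeff ψ q = -(α - 2) * ψ q.1 q.2 / q.2 ^ 2 := by
  have h1 := fderiv_apply_self_of_homogeneous (m := -(α - 2))
    (h.hasFDerivAt_stream hq).differentiableAt
    (fun l hl => by simpa using h.isAxisStream.scale hl hq)
  have h2 : q = q.1 • ((1, 0) : ℝ × ℝ) + q.2 • ((0, 1) : ℝ × ℝ) := by simp
  have h3 : fderiv ℝ (fun q : ℝ × ℝ => ψ q.1 q.2) q q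
      = q.1 * fderiv ℝ (fun q : ℝ × ℝ => ψ q.1 q.2) q (1, 0)
        + q.2 * fderiv ℝ (fun q : ℝ × ℝ => ψ q.1 q.2) q (0, 1) := by
    conv_lhs => rw [h2]
    rw [map_add, map_smul, map_smul, smul_eq_mul, smul_eq_mul, ← h2]
  rw [← h1, h3, radialCoeff, axialCoeff]
  field_simp

/-- With Π = 0 the Lamb form leaves defect · ∇ψ = 0. Here ∇ψ ≠ 0, since otherwise both poloidal
coefficients vanish, against `fderiv_stream_self`. -/
theorem defect_eq_zero (h : IsDipoleSolution α 0 C₂ ψ u p) (hα : 2 < α) (hx : 0 < cylR x) :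
    defect α C₂ ψ (x 2, cylR x) = 0 := by
  have hx0 := ne_zero_of_cylR_pos hx
  have hu := h.differentiableAt hx0
  have hp : DifferentiableAt ℝ p x :=
    (h.euler.2.1.contDiffAt (isOpen_compl_singleton.mem_nhds hx0)).differentiableAt one_ne_zero
  have hE := (h.euler.2.2 x hx0).1
  have hB : gradient (bernoulli u p) x = 0 := by
    have : bernoulli u p =ᶠ[𝓝 x] fun _ => 0 := by
      filter_upwards [isOpen_compl_singleton.mem_nhds hx0] with y hy
      rw [h.bernoulli_eq_off_origin hα hy, zero_mul]
    rw [gradient, this.fderiv_eq]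
    simp
  rw [euler_iff_lamb hu hp, hB, add_zero, h.curl_eq hx, h.eq_axisField hx, cross_azimuthal] at hE
  by_contra hk
  have hE' := (smul_eq_zero.1 hE).resolve_left hk
  have e0 := congrArg (fun v : E3 => v 0) hE'
  have e1 := congrArg (fun v : E3 => v 1) hE'
  have e2 := congrArg (fun v : E3 => v 2) hE'
  simp only [Matrix.cons_val_zero, Matrix.cons_val_one, Matrix.cons_val,
    PiLp.zero_apply] at e0 e1 e2
  have hr2 := cylR_sq x
  have hr2' : 0 < x 0 ^ 2 + x 1 ^ 2 := by rw [← hr2]; positivity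
  have ha : radialCoeff ψ (x 2, cylR x) = 0 := by
    have e3 : (x 0 ^ 2 + x 1 ^ 2) * radialCoeff ψ (x 2, cylR x) = 0 := by
      linear_combination -e2
    simpa [hr2'.ne'] using e3
  have hc : axialCoeff ψ (x 2, cylR x) = 0 := by
    have : (x 0 ^ 2 + x 1 ^ 2) * axialCoeff ψ (x 2, cylR x) = 0 := by
      linear_combination x 0 * e0 + x 1 * e1
    simpa [hr2'.ne'] using this
  have hs := h.fderiv_stream_self (q := (x 2, cylR x)) hx
  rw [ha, hc] at hs
  have hψ := h.stream_pos (x 2) _ hx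
  have : (α - 2) * ψ (x 2) (cylR x) / cylR x ^ 2 > 0 := by
    have := sub_pos.2 hα
    positivity
  simp only [mul_zero, add_zero, neg_mul, neg_div] at hs
  linarith

theorem curl_eq_smul (h : IsDipoleSolution α 0 C₂ ψ u p) (hα : 2 < α) (hx : x ≠ 0) :
    curl u x = (C₂ * (1 + 1 / (α - 2)) * ψ (x 2) (cylR x) ^ (1 / (α - 2))) • u x := by
  have hβ : 0 < α - 2 := sub_pos.2 hα
  refine eq_of_eq_offAxis (g := fun x =>
    (C₂ * (1 + 1 / (α - 2)) * ψ (x 2) (cylR x) ^ (1 / (α - 2))) • u x)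
    (continuousOn_curl h.euler.1) ?_ (fun y hy => ?_) hx
  · exact (continuousOn_const.mul (h.isAxisStream.continuousOn_cyl.rpow_const fun _ _ =>
      Or.inr (by positivity))).smul h.euler.1.continuousOn
  · rw [h.curl_eq hy, h.defect_eq_zero hα hy, zero_smul, add_zero]

/-! ### Beltrami solutions have no zeros, so the proportionality factor is unique. -/

/-- The point with cylindrical coordinates `(r, 0, z)`. -/
def meridian (q : ℝ × ℝ) : E3 := !₂[q.2, 0, q.1]

theorem cylR_meridian {q : ℝ × ℝ} (hq : 0 ≤ q.2) : cylR (meridian q) = q.2 := by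
  simp [meridian, cylR, Real.sqrt_sq hq]

theorem meridian_two (q : ℝ × ℝ) : meridian q 2 = q.1 := by simp [meridian]

theorem smul_meridian (l : ℝ) (q : ℝ × ℝ) : l • meridian q = meridian (l • q) := by
  ext i
  fin_cases i <;> simp [meridian]

theorem apply_meridian (h : IsDipoleSolution α C₁ C₂ ψ u p) {q : ℝ × ℝ} (hq : 0 < q.2) :
    u (meridian q) 0 = q.2 * radialCoeff ψ q ∧ u (meridian q) 2 = axialCoeff ψ q := by
  have hx : 0 < cylR (meridian q) := by rwa [cylR_meridian hq.le]
  rw [h.eq_axisField hx]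
  simp only [axisField, cylR_meridian hq.le, meridian_two]
  simp [meridian]

/-- Homogeneity of u, read off in one meridian half plane. The radial coefficient has an extra
degree -1 from the division of u^r by r. -/
theorem scale_coeff (h : IsDipoleSolution α C₁ C₂ ψ u p) {q : ℝ × ℝ} (hq : 0 < q.2) {l : ℝ}
    (hl : 0 < l) : radialCoeff ψ (l • q) = l ^ (-(α + 1)) * radialCoeff ψ q ∧
      axialCoeff ψ (l • q) = l ^ (-α) * axialCoeff ψ q := by
  have hlq : 0 < (l • q).2 := mul_pos hl hq
  have hx : 0 < cylR (meridian q) := by rwa [cylR_meridian hq.le]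
  have h1 := (h.homogeneous l hl _ (ne_zero_of_cylR_pos hx)).1
  rw [smul_meridian] at h1
  have e0 := congrArg (fun v : E3 => v 0) h1
  have e2 := congrArg (fun v : E3 => v 2) h1
  simp only [PiLp.smul_apply, smul_eq_mul, (h.apply_meridian hq).1, (h.apply_meridian hq).2,
    (h.apply_meridian hlq).1, (h.apply_meridian hlq).2, Prod.smul_snd] at e0 e2
  have hlα : 0 < l ^ α := Real.rpow_pos_of_pos hl _
  constructor
  · rw [Real.rpow_neg hl.le, Real.rpow_add hl, Real.rpow_one]
    field_simp
    have : q.2 * radialCoeff ψ q = q.2 * (l ^ α * l * radialCoeff ψ (l • q)) := by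
      rw [e0]; ring
    linarith [mul_left_cancel₀ hq.ne' this]
  · rw [Real.rpow_neg hl.le, e2]
    field_simp

theorem apply_eq_fst_snd (g' : ℝ × ℝ →L[ℝ] ℝ) (q : ℝ × ℝ) :
    g' q = q.1 * g' (1, 0) + q.2 * g' (0, 1) := by
  have h2 : q = q.1 • ((1, 0) : ℝ × ℝ) + q.2 • ((0, 1) : ℝ × ℝ) := by simp
  conv_lhs => rw [h2]
  rw [map_add, map_smul, map_smul, smul_eq_mul, smul_eq_mul]

/-- Up to the positive factor (z² + r²)^(α - 3/2), the left side is the r-derivative of (z² + r²)^(α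
- 1/2) u^z at fixed z. Incompressibility, the vorticity equation and Euler's identities for ψ, u^r/r
and u^z eliminate all other derivatives. What remains is -r((α-1)(α-2)ψ/r² + z² ΓΓ'/r²), and ΓΓ' ≥
0. -/
theorem deriv_axialCoeff (h : IsDipoleSolution α 0 C₂ ψ u p) (hα : 2 < α) {q : ℝ × ℝ}
    (hq : 0 < q.2) :
    (2 * α - 1) * q.2 * axialCoeff ψ q
      + (q.1 ^ 2 + q.2 ^ 2) * fderiv ℝ (axialCoeff ψ) q (0, 1) < 0 := by
  have hx : 0 < cylR (meridian q) := by rwa [cylR_meridian hq.le]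
  have hβ : 0 < α - 2 := sub_pos.2 hα
  have hq' : ((meridian q) 2, cylR (meridian q)) = q := by
    rw [meridian_two, cylR_meridian hq.le]
  have hψ : 0 < ψ q.1 q.2 := h.stream_pos _ _ hq
  have hG : HasFDerivAt (fun q : ℝ × ℝ =>
      clebschFactor C₂ (α - 2) (ψ q.1 q.2)) _ q :=
    HasDerivAt.comp_hasFDerivAt q (hasDerivAt_clebschFactor hψ) (h.hasFDerivAt_stream hq)
  have hdiv := (h.euler.2.2 _ (ne_zero_of_cylR_pos hx)).2
  rw [div_congr (h.eventuallyEq_axisField hx), div_axisField hx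
    (by rw [hq']; exact (h.differentiableAt_radialCoeff hq).hasFDerivAt)
    (by rw [hq']; exact hasFDerivAt_div_sq hq hG)
    (by rw [hq']; exact (h.differentiableAt_axialCoeff hq).hasFDerivAt), hq',
    cylR_meridian hq.le] at hdiv
  have ha := fderiv_apply_self_of_homogeneous (m := -(α + 1)) (h.differentiableAt_radialCoeff hq)
    (fun l hl => (h.scale_coeff hq hl).1)
  have hc := fderiv_apply_self_of_homogeneous (m := -α) (h.differentiableAt_axialCoeff hq)
    (fun l hl => (h.scale_coeff hq hl).2)
  rw [apply_eq_fst_snd] at ha hc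
  have hs := h.fderiv_stream_self hq
  have hd := h.defect_eq_zero hα hx
  rw [hq', defect] at hd
  set A := radialCoeff ψ q
  set C := axialCoeff ψ q
  set Az := fderiv ℝ (radialCoeff ψ) q (1, 0)
  set Ar := fderiv ℝ (radialCoeff ψ) q (0, 1)
  set Cz := fderiv ℝ (axialCoeff ψ) q (1, 0)
  set Cr := fderiv ℝ (axialCoeff ψ) q (0, 1)
  set B := C₂ * (1 + 1 / (α - 2)) * ψ q.1 q.2 ^ (1 / (α - 2))
      * (clebschFactor C₂ (α - 2) (ψ q.1 q.2) / q.2 ^ 2) with hB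
  have hB0 : 0 ≤ B := by
    have : B = C₂ ^ 2 * ((1 + 1 / (α - 2)) * ψ q.1 q.2 ^ (1 / (α - 2))
      * (ψ q.1 q.2 * |ψ q.1 q.2| ^ (1 / (α - 2)) / q.2 ^ 2)) := by
      rw [hB, clebschFactor]; ring
    rw [this]
    positivity
  have hP : 0 < (α - 2) * ψ q.1 q.2 / q.2 ^ 2 := by positivity
  have hcr : Cr = q.2 * (Az - B) := by
    field_simp at hd
    linarith
  have key : (2 * α - 1) * q.2 * C + (q.1 ^ 2 + q.2 ^ 2) * Cr =
      -q.2 * ((α - 1) * ((α - 2) * ψ q.1 q.2 / q.2 ^ 2) + q.1 ^ 2 * B) := by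
    have hs' : q.1 * A = C + (α - 2) * ψ q.1 q.2 / q.2 ^ 2 := by
      rw [neg_mul, neg_mul, neg_div] at hs
      linarith
    have h3 : q.1 ^ 2 * Az = -(α - 1) * (q.1 * A) - α * C - q.2 * Cr := by
      linear_combination q.1 * ha - q.1 * hdiv + hc
    rw [hs'] at h3
    linear_combination q.1 ^ 2 * hcr + q.2 * h3
  rw [key]
  have : 0 < q.2 * ((α - 1) * ((α - 2) * ψ q.1 q.2 / q.2 ^ 2) + q.1 ^ 2 * B) := by
    have : 0 < α - 1 := by linarith
    positivity
  linarith

/-- If u vanished at (z, 0), then (z² + r²)^(α - 1/2) u^z would tend to 0 as r → 0 and decrease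
strictly, so u^z = ∂_r ψ/r < 0 for r > 0. As ψ also tends to 0 at the axis, ψ would be negative. -/
theorem apply_ne_zero_of_axis (h : IsDipoleSolution α 0 C₂ ψ u p) (hα : 2 < α) {z : ℝ}
    (hz : z ≠ 0) : u (meridian (z, 0)) ≠ 0 := by
  intro h0
  have hm0 : meridian (z, 0) ≠ 0 := by
    intro h1
    have := congrArg (fun v : E3 => v 2) h1
    simp [meridian, hz] at this
  have hpath : Tendsto (fun r : ℝ => meridian (z, r)) (𝓝[>] 0) (𝓝 (meridian (z, 0))) := by
    have : Continuous fun r : ℝ => meridian (z, r) := by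
      unfold meridian
      fun_prop
    exact (this.tendsto 0).mono_left nhdsWithin_le_nhds
  have hC0 : Tendsto (fun r : ℝ => axialCoeff ψ (z, r)) (𝓝[>] 0) (𝓝 0) := by
    have h1 := (h.euler.1.continuousOn.continuousAt
      (isOpen_compl_singleton.mem_nhds hm0)).tendsto.comp hpath
    rw [h0] at h1
    have h2 : Tendsto (fun r : ℝ => u (meridian (z, r)) 2) (𝓝[>] 0) (𝓝 ((0 : E3) 2)) :=
      ((EuclideanSpace.proj (𝕜 := ℝ) 2 : E3 →L[ℝ] ℝ).continuous.tendsto 0).comp h1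
    refine h2.congr' ?_
    filter_upwards [self_mem_nhdsWithin] with r hr using (h.apply_meridian (q := (z, r)) hr).2
  have hinc : ∀ r : ℝ, HasDerivAt (fun s : ℝ => ((z, s) : ℝ × ℝ)) ((0, 1) : ℝ × ℝ) r := fun r =>
    (hasDerivAt_const r z).prodMk (hasDerivAt_id r)
  have hCd : ∀ r : ℝ, 0 < r → HasDerivAt (fun s => axialCoeff ψ (z, s))
      (fderiv ℝ (axialCoeff ψ) (z, r) (0, 1)) r := fun r hr =>
    (h.differentiableAt_axialCoeff (q := (z, r)) hr).hasFDerivAt.comp_hasDerivAt r (hinc r)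
  have hCneg : ∀ r : ℝ, 0 < r → axialCoeff ψ (z, r) < 0 := by
    intro r hr
    have hw : ∀ s : ℝ, 0 < z ^ 2 + s ^ 2 := fun s => by positivity
    have hwd : ∀ s : ℝ, HasDerivAt (fun s : ℝ => (z ^ 2 + s ^ 2) ^ (α - 1 / 2))
        (2 * s * (α - 1 / 2) * (z ^ 2 + s ^ 2) ^ (α - 1 / 2 - 1)) s := by
      intro s
      have h1 : HasDerivAt (fun s : ℝ => z ^ 2 + s ^ 2) (2 * s) s := by
        simpa using (hasDerivAt_pow 2 s).const_add (z ^ 2)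
      exact h1.rpow_const (Or.inl (hw s).ne')
    have := neg_of_deriv_neg_of_tendsto_zero
      (f := fun s => (z ^ 2 + s ^ 2) ^ (α - 1 / 2) * axialCoeff ψ (z, s))
      (fun s hs => (hwd s).fun_mul (hCd s hs)) (fun s hs => ?_) ?_ hr
    · exact (pos_iff_neg_of_mul_neg this).1 (Real.rpow_pos_of_pos (hw r) _)
    · have h1 := h.deriv_axialCoeff hα (q := (z, s)) hs
      have h2 : (z ^ 2 + s ^ 2) ^ (α - 1 / 2)
          = (z ^ 2 + s ^ 2) ^ (α - 1 / 2 - 1) * (z ^ 2 + s ^ 2) := by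
        rw [Real.rpow_sub_one (hw s).ne', div_mul_cancel₀ _ (hw s).ne']
      have h3 : 0 < (z ^ 2 + s ^ 2) ^ (α - 1 / 2 - 1) := Real.rpow_pos_of_pos (hw s) _
      rw [h2]
      have h4 := mul_neg_of_pos_of_neg h3 h1
      dsimp only at h4
      linarith
    · have h1 : Continuous fun s : ℝ => (z ^ 2 + s ^ 2) ^ (α - 1 / 2) :=
        (by fun_prop : Continuous fun s : ℝ => z ^ 2 + s ^ 2).rpow_const
          fun s => Or.inl (hw s).ne'
      simpa using ((h1.tendsto 0).mono_left nhdsWithin_le_nhds).mul hC0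
  have hψ0 : Tendsto (fun r : ℝ => ψ z r) (𝓝[>] 0) (𝓝 0) := by
    have h1 : Tendsto (fun r : ℝ => ((z, r) : ℝ × ℝ)) (𝓝[>] 0)
        (𝓝[{q : ℝ × ℝ | 0 ≤ q.2 ∧ q ≠ 0}] (z, 0)) := by
      refine tendsto_nhdsWithin_iff.2 ⟨?_, ?_⟩
      · have : Continuous fun r : ℝ => ((z, r) : ℝ × ℝ) := by fun_prop
        exact (this.tendsto 0).mono_left nhdsWithin_le_nhds
      · filter_upwards [self_mem_nhdsWithin] with r hr
        exact ⟨le_of_lt hr, by simp [hz]⟩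
    have h2 := (h.stream_continuous (z, 0) ⟨le_rfl, by simp [hz]⟩).tendsto.comp h1
    simpa [Function.comp_def, h.stream_axis z hz] using h2
  have hlt := neg_of_deriv_neg_of_tendsto_zero (f := fun r => ψ z r)
    (fun r hr => (h.hasFDerivAt_stream (q := (z, r)) hr).comp_hasDerivAt r (hinc r))
    (fun r hr => by
      have h1 := hCneg r hr
      rw [axialCoeff, div_neg_iff] at h1
      rcases h1 with h1 | h1
      · exact absurd hr h1.2.not_gt
      · exact h1.1) hψ0 one_pos
  exact absurd (h.stream_pos z 1 one_pos) hlt.not_gt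

theorem apply_ne_zero (h : IsDipoleSolution α 0 C₂ ψ u p) (hα : 2 < α) (hx : x ≠ 0) :
    u x ≠ 0 := by
  rcases (cylR_nonneg x).eq_or_lt with h0 | h0
  · have hx01 := cylR_eq_zero.1 h0.symm
    have : x = meridian (x 2, 0) := by
      ext i
      fin_cases i <;> simp [meridian, hx01]
    rw [this]
    exact h.apply_ne_zero_of_axis hα (apply_two_ne_zero hx h0.symm)
  · intro hu
    have hB := h.bernoulli_eq_off_origin hα hx
    rw [h.eq_axisField h0] at hu
    have e0 := congrArg (fun v : E3 => x 0 * v 0 + x 1 * v 1) hu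
    have e2 := congrArg (fun v : E3 => v 2) hu
    have hr2 := cylR_sq x
    have hs := h.fderiv_stream_self (q := (x 2, cylR x)) h0
    have hψ := h.stream_pos (x 2) _ h0
    simp [axisField] at e0 e2
    have ha : radialCoeff ψ (x 2, cylR x) = 0 := by
      have : cylR x ^ 2 * radialCoeff ψ (x 2, cylR x) = 0 := by
        rw [hr2]; linear_combination e0
      simpa [h0.ne'] using this
    rw [ha, e2] at hs
    have : (α - 2) * ψ (x 2) (cylR x) / cylR x ^ 2 > 0 := by
      have := sub_pos.2 hα
      positivity
    simp only [mul_zero, add_zero, neg_mul, neg_div] at hs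
    linarith

theorem beltrami (h : IsDipoleSolution α 0 C₂ ψ u p) (hα : 2 < α) :
    IsProportionalityFactor u fun x =>
      C₂ * (1 + 1 / (α - 2)) * ψ (x 2) (cylR x) ^ (1 / (α - 2)) :=
  fun _ hx => h.curl_eq_smul hα hx

theorem proportionalityFactor_eq (h : IsDipoleSolution α 0 C₂ ψ u p) (hα : 2 < α) {φ : E3 → ℝ}
    (hφ : IsProportionalityFactor u φ) (hx : x ≠ 0) :
    φ x = C₂ * (1 + 1 / (α - 2)) * ψ (x 2) (cylR x) ^ (1 / (α - 2)) :=
  smul_left_injective ℝ (h.apply_ne_zero hα hx) ((hφ x hx).symm.trans (h.curl_eq_smul hα hx))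

end IsDipoleSolution

end

/-! ### A Volterra equation with Lipschitz nonlinearity. -/

section

section Volterra

variable {g : ℝ → ℝ → ℝ}

/-- The weighted Volterra operator `Φ ↦ e^(-Kx) (b - ∫₀ˣ (1 - s/x) g(s, e^(Ks) Φ(s)) ds)`. -/
def volterraFun (g : ℝ → ℝ → ℝ) (K b : ℝ) (Φ : C(Icc (0 : ℝ) 1, ℝ)) (x : ℝ) : ℝ :=
  Real.exp (-(K * x)) * (b - x * ∫ σ in (0 : ℝ)..1, (1 - σ) *
    g (x * σ) (Real.exp (K * (x * σ)) * Φ (projIcc 0 1 zero_le_one (x * σ))))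

theorem continuous_volterraIntegrand (hg : Continuous (Function.uncurry g)) (K : ℝ)
    (Φ : C(Icc (0 : ℝ) 1, ℝ)) : Continuous fun q : ℝ × ℝ => (1 - q.2) *
      g (q.1 * q.2) (Real.exp (K * (q.1 * q.2)) * Φ (projIcc 0 1 zero_le_one (q.1 * q.2))) := by
  have h1 : Continuous fun q : ℝ × ℝ => (q.1 * q.2,
      Real.exp (K * (q.1 * q.2)) * Φ (projIcc 0 1 zero_le_one (q.1 * q.2))) := by
    have : Continuous fun q : ℝ × ℝ => Φ (projIcc 0 1 zero_le_one (q.1 * q.2)) :=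
      Φ.continuous.comp (continuous_projIcc.comp (by fun_prop))
    fun_prop
  exact (continuous_const.sub continuous_snd).mul (hg.comp h1)

theorem continuous_volterraFun (hg : Continuous (Function.uncurry g)) (K b : ℝ)
    (Φ : C(Icc (0 : ℝ) 1, ℝ)) : Continuous (volterraFun g K b Φ) := by
  have h2 := intervalIntegral.continuous_parametric_intervalIntegral_of_continuous'
    (μ := MeasureTheory.volume) (f := fun x σ : ℝ => (1 - σ) * g (x * σ)
      (Real.exp (K * (x * σ)) * Φ (projIcc 0 1 zero_le_one (x * σ))))
    (continuous_volterraIntegrand hg K Φ) 0 1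
  unfold volterraFun
  fun_prop

/-- The weighted Volterra operator on `C([0, 1])`. -/
def volterraOp (hg : Continuous (Function.uncurry g)) (K b : ℝ) (Φ : C(Icc (0 : ℝ) 1, ℝ)) :
    C(Icc (0 : ℝ) 1, ℝ) :=
  ⟨fun x => volterraFun g K b Φ x, (continuous_volterraFun hg K b Φ).comp continuous_subtype_val⟩

theorem integral_mul_exp {K : ℝ} (hK : 0 < K) (x : ℝ) :
    ∫ σ in (0 : ℝ)..1, x * Real.exp (K * (x * σ)) = (Real.exp (K * x) - 1) / K := by
  have h : ∀ σ ∈ uIcc (0 : ℝ) 1, HasDerivAt (fun σ => Real.exp (K * (x * σ)) / K)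
      (x * Real.exp (K * (x * σ))) σ := by
    intro σ _
    have h1 : HasDerivAt (fun σ : ℝ => K * (x * σ)) (K * x) σ := by
      simpa using ((hasDerivAt_id σ).const_mul x).const_mul K
    refine (h1.exp.div_const K).congr_deriv ?_
    field_simp
  rw [intervalIntegral.integral_eq_sub_of_hasDerivAt h
    (Continuous.intervalIntegrable (by fun_prop) _ _)]
  simp
  ring

/-- The exponential weight makes the operator a contraction on the whole interval: the integral
contributes at most L/K times the distance, and K = 2L + 1 gives L/K ≤ 1/2. Letting b vary too
yields Lipschitz dependence of the fixed point on b. -/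
theorem abs_volterraFun_sub_le (hg : Continuous (Function.uncurry g)) {L : ℝ} (hL0 : 0 ≤ L)
    (hL : ∀ s ∈ Icc (0 : ℝ) 1, ∀ y y', |g s y - g s y'| ≤ L * |y - y'|) (b b' : ℝ)
    (Φ Ψ : C(Icc (0 : ℝ) 1, ℝ)) {x : ℝ} (hx : x ∈ Icc (0 : ℝ) 1) :
    |volterraFun g (2 * L + 1) b Φ x - volterraFun g (2 * L + 1) b' Ψ x|
      ≤ |b - b'| + 1 / 2 * dist Φ Ψ := by
  set K := 2 * L + 1 with hKdef
  have hK : 0 < K := by positivity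
  set I := fun Φ : C(Icc (0 : ℝ) 1, ℝ) => fun σ : ℝ => (1 - σ) *
    g (x * σ) (Real.exp (K * (x * σ)) * Φ (projIcc 0 1 zero_le_one (x * σ))) with hI
  have hIc : ∀ Φ, Continuous (I Φ) := fun Φ =>
    (continuous_volterraIntegrand hg K Φ).comp (by fun_prop : Continuous fun σ : ℝ => (x, σ))
  have hii : ∀ Φ, IntervalIntegrable (I Φ) MeasureTheory.volume 0 1 := fun Φ =>
    (hIc Φ).intervalIntegrable _ _
  have hD0 : 0 ≤ dist Φ Ψ := dist_nonneg
  have hbound : ∀ σ ∈ Icc (0 : ℝ) 1,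
      ‖I Φ σ - I Ψ σ‖ ≤ L * dist Φ Ψ * Real.exp (K * (x * σ)) := by
    intro σ hσ
    have hxσ : x * σ ∈ Icc (0 : ℝ) 1 :=
      ⟨mul_nonneg hx.1 hσ.1, mul_le_one₀ hx.2 hσ.1 hσ.2⟩
    have h1 := hL _ hxσ (Real.exp (K * (x * σ)) * Φ (projIcc 0 1 zero_le_one (x * σ)))
      (Real.exp (K * (x * σ)) * Ψ (projIcc 0 1 zero_le_one (x * σ)))
    have h2 := ContinuousMap.dist_apply_le_dist (f := Φ) (g := Ψ)
      (projIcc 0 1 zero_le_one (x * σ))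
    rw [Real.dist_eq] at h2
    rw [← mul_sub, abs_mul, abs_of_pos (Real.exp_pos _)] at h1
    have hexp := Real.exp_pos (K * (x * σ))
    rw [Real.norm_eq_abs, hI]
    simp only
    rw [← mul_sub, abs_mul, abs_of_nonneg (sub_nonneg.2 hσ.2)]
    calc (1 - σ) * _ ≤ 1 * (L * (Real.exp (K * (x * σ)) * dist Φ Ψ)) := by
          refine mul_le_mul (by linarith [hσ.1]) (h1.trans ?_) (abs_nonneg _) zero_le_one
          gcongr
      _ = _ := by ring
  have hint : |x * ∫ σ in (0 : ℝ)..1, (I Φ σ - I Ψ σ)|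
      ≤ L * dist Φ Ψ * ((Real.exp (K * x) - 1) / K) := by
    rw [abs_mul, abs_of_nonneg hx.1, ← integral_mul_exp hK x, ← intervalIntegral.integral_const_mul]
    have h3 : |∫ σ in (0 : ℝ)..1, (I Φ σ - I Ψ σ)|
        ≤ ∫ σ in (0 : ℝ)..1, L * dist Φ Ψ * Real.exp (K * (x * σ)) := by
      have hci : IntervalIntegrable (fun σ => L * dist Φ Ψ * Real.exp (K * (x * σ)))
          MeasureTheory.volume 0 1 := Continuous.intervalIntegrable (by fun_prop) _ _
      rw [← Real.norm_eq_abs]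
      refine intervalIntegral.norm_integral_le_of_norm_le zero_le_one ?_ hci
      exact MeasureTheory.ae_of_all _ fun σ hσ => hbound σ (Ioc_subset_Icc_self hσ)
    calc x * _ ≤ x * ∫ σ in (0 : ℝ)..1, L * dist Φ Ψ * Real.exp (K * (x * σ)) :=
          mul_le_mul_of_nonneg_left h3 hx.1
      _ = _ := by
        rw [← intervalIntegral.integral_const_mul]
        congr 1
        ext σ
        ring
  have heq : volterraFun g K b Φ x - volterraFun g K b' Ψ x = Real.exp (-(K * x)) * ((b - b')
      - x * ∫ σ in (0 : ℝ)..1, (I Φ σ - I Ψ σ)) := by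
    rw [intervalIntegral.integral_sub (hii Φ) (hii Ψ)]
    simp only [volterraFun, hI]
    ring
  have hexp1 : Real.exp (-(K * x)) ≤ 1 := by
    rw [Real.exp_le_one_iff]
    have := mul_nonneg hK.le hx.1
    linarith
  have hexp0 := Real.exp_pos (-(K * x))
  have hexpm : Real.exp (-(K * x)) * Real.exp (K * x) = 1 := by
    rw [← Real.exp_add]; simp
  rw [heq, abs_mul, abs_of_pos hexp0]
  calc Real.exp (-(K * x)) * |(b - b') - x * ∫ σ in (0 : ℝ)..1, (I Φ σ - I Ψ σ)|
      ≤ Real.exp (-(K * x)) * (|b - b'| + L * dist Φ Ψ * ((Real.exp (K * x) - 1) / K)) := by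
        gcongr
        exact (abs_sub _ _).trans (by gcongr)
    _ = Real.exp (-(K * x)) * |b - b'|
        + L * dist Φ Ψ / K * (Real.exp (-(K * x)) * Real.exp (K * x) - Real.exp (-(K * x))) := by
        ring
    _ ≤ 1 * |b - b'| + L * dist Φ Ψ / K * 1 := by
        rw [hexpm]
        gcongr
        linarith
    _ ≤ |b - b'| + 1 / 2 * dist Φ Ψ := by
        rw [one_mul, mul_one]
        gcongr
        rw [div_le_iff₀ hK, hKdef]
        nlinarith

theorem exists_volterra_solution (hg : Continuous (Function.uncurry g)) {L : ℝ} (hL0 : 0 ≤ L)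
    (hL : ∀ s ∈ Icc (0 : ℝ) 1, ∀ y y', |g s y - g s y'| ≤ L * |y - y'|) :
    ∃ F : ℝ → ℝ → ℝ, (∀ b, Continuous (F b)) ∧
      (∀ b, ∀ x ∈ Icc (0 : ℝ) 1,
        F b x = b - x * ∫ σ in (0 : ℝ)..1, (1 - σ) * g (x * σ) (F b (x * σ))) ∧
      ∃ C, ∀ b b', ∀ x ∈ Icc (0 : ℝ) 1, |F b x - F b' x| ≤ C * |b - b'| := by
  set K := 2 * L + 1 with hKdef
  have hK : 0 < K := by positivity
  have hdist : ∀ b b' Φ Ψ, dist (volterraOp hg K b Φ) (volterraOp hg K b' Ψ)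
      ≤ |b - b'| + 1 / 2 * dist Φ Ψ := by
    intro b b' Φ Ψ
    rw [ContinuousMap.dist_le (by positivity)]
    intro x
    exact abs_volterraFun_sub_le hg hL0 hL b b' Φ Ψ x.2
  have hcontr : ∀ b, ContractingWith (1 / 2) (volterraOp hg K b) := by
    intro b
    refine ⟨by rw [← NNReal.coe_lt_coe]; norm_num, LipschitzWith.of_dist_le_mul fun Φ Ψ => ?_⟩
    simpa using hdist b b Φ Ψ
  set Φ := fun b => ContractingWith.fixedPoint _ (hcontr b) with hΦ
  have hfix : ∀ b, volterraOp hg K b (Φ b) = Φ b := fun b =>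
    ContractingWith.fixedPoint_isFixedPt (hcontr b)
  refine ⟨fun b s => Real.exp (K * s) * Φ b (projIcc 0 1 zero_le_one s), fun b => ?_,
    fun b x hx => ?_, 2 * Real.exp K, fun b b' x hx => ?_⟩
  · have : Continuous fun s : ℝ => Φ b (projIcc 0 1 zero_le_one s) :=
      (Φ b).continuous.comp continuous_projIcc
    fun_prop
  · have h1 := congrArg (fun f : C(Icc (0 : ℝ) 1, ℝ) => f ⟨x, hx⟩) (hfix b)
    simp only [volterraOp, ContinuousMap.coe_mk, volterraFun] at h1
    simp only [projIcc_of_mem zero_le_one hx]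
    rw [← h1, ← mul_assoc, ← Real.exp_add]
    simp
  · have h1 : dist (Φ b) (Φ b') ≤ 2 * |b - b'| := by
      have := hdist b b' (Φ b) (Φ b')
      rw [hfix, hfix] at this
      linarith
    have h2 := ContinuousMap.dist_apply_le_dist (f := Φ b) (g := Φ b')
      (projIcc 0 1 zero_le_one x)
    rw [Real.dist_eq] at h2
    simp only
    rw [← mul_sub, abs_mul, abs_of_pos (Real.exp_pos _)]
    have h3 : Real.exp (K * x) ≤ Real.exp K :=
      Real.exp_le_exp.2 (mul_le_of_le_one_right hK.le hx.2)
    calc Real.exp (K * x) * _ ≤ Real.exp K * (2 * |b - b'|) :=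
          mul_le_mul h3 (h2.trans h1) (abs_nonneg _) (Real.exp_pos _).le
      _ = _ := by ring

end Volterra

end

/-! ### The boundary value problem by shooting. -/

section

/-- Parameters of the nonlinearity `κ f + c₁ (v f)^(1+m) + c₂ v^q f^(1+q)`, where `κ` lies below
the first eigenvalue `2` of the linear problem. -/
structure Nonlinearity where
  κ : ℝ
  c₁ : ℝ
  c₂ : ℝ
  m : ℝ
  q : ℝ
  κ_nonneg : 0 ≤ κ
  κ_lt : κ < 2
  c₁_nonneg : 0 ≤ c₁
  c₂_nonneg : 0 ≤ c₂
  c_ne : c₁ ≠ 0 ∨ c₂ ≠ 0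
  m_gt : 2 < m
  q_gt : 2 < q

namespace Nonlinearity

variable (P : Nonlinearity)

/-- The value of the nonlinearity. -/
def N (v f : ℝ) : ℝ := P.κ * f + P.c₁ * (v * f) ^ (1 + P.m) + P.c₂ * (v ^ P.q * f ^ (1 + P.q))

theorem m_pos : 0 < P.m := two_pos.trans P.m_gt

theorem q_pos : 0 < P.q := two_pos.trans P.q_gt

/-- All powers have exponents above 2, so they are C² even where the base is zero or negative. This
is what limits the later bootstrap to C³. -/
theorem contDiff_N : ContDiff ℝ 2 fun z : ℝ × ℝ => P.N z.1 z.2 := by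
  have hm := P.m_gt
  have hq := P.q_gt
  have h1 : ContDiff ℝ 2 fun z : ℝ × ℝ => (z.1 * z.2) ^ (1 + P.m) :=
    (contDiff_fst.mul contDiff_snd).rpow_const_of_le (m := 2) (by push_cast; linarith)
  have h2 : ContDiff ℝ 2 fun z : ℝ × ℝ => z.1 ^ P.q :=
    contDiff_fst.rpow_const_of_le (m := 2) (by push_cast; linarith)
  have h3 : ContDiff ℝ 2 fun z : ℝ × ℝ => z.2 ^ (1 + P.q) :=
    contDiff_snd.rpow_const_of_le (m := 2) (by push_cast; linarith)
  unfold N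
  exact ((contDiff_const.mul contDiff_snd).add (contDiff_const.mul h1)).add
    (contDiff_const.mul (h2.mul h3))

theorem N_nonneg {v f : ℝ} (hv : 0 ≤ v) (hf : 0 ≤ f) : 0 ≤ P.N v f := by
  have := P.κ_nonneg
  have := P.c₁_nonneg
  have := P.c₂_nonneg
  unfold N
  positivity

theorem exists_lipschitz (R : ℝ) : ∃ L : ℝ, 0 ≤ L ∧ ∀ v ∈ Icc (0 : ℝ) 1, ∀ f ∈ Icc 0 R,
    ∀ f' ∈ Icc 0 R, |P.N v f - P.N v f'| ≤ L * |f - f'| := by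
  obtain ⟨L, hL⟩ := (P.contDiff_N.contDiffOn (s := Icc (0 : ℝ) 1 ×ˢ Icc 0 R)).exists_lipschitzOnWith
    two_ne_zero ((convex_Icc _ _).prod (convex_Icc _ _)) (isCompact_Icc.prod isCompact_Icc)
  refine ⟨L, L.2, fun v hv f hf f' hf' => ?_⟩
  have := hL.dist_le_mul (v, f) ⟨hv, hf⟩ (v, f') ⟨hv, hf'⟩
  simpa [Real.dist_eq, Prod.dist_eq] using this

/-- The factor in `N v f ≤ f * growth M` for `v f ≤ M`. -/
def growth (M : ℝ) : ℝ := P.κ + P.c₁ * M ^ P.m + P.c₂ * M ^ P.q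

theorem growth_nonneg {M : ℝ} (hM : 0 ≤ M) : 0 ≤ P.growth M := by
  have := P.κ_nonneg
  have := P.c₁_nonneg
  have := P.c₂_nonneg
  unfold growth
  positivity

/-- The second superlinear term is f (v f)^q, and the first is at most f (v f)^m because v ≤ 1. Thus
a bound on w = v f alone controls N/f. -/
theorem N_le {v f M : ℝ} (hv : 0 ≤ v) (hv1 : v ≤ 1) (hf : 0 ≤ f) (hM : v * f ≤ M) :
    P.N v f ≤ f * P.growth M := by
  have hm := P.m_pos
  have hq := P.q_pos
  have hc₁ := P.c₁_nonneg
  have hc₂ := P.c₂_nonneg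
  have hvf : 0 ≤ v * f := mul_nonneg hv hf
  have h1 : (v * f) ^ (1 + P.m) ≤ f * M ^ P.m := by
    rw [Real.rpow_add_of_nonneg hvf zero_le_one hm.le, Real.rpow_one]
    exact mul_le_mul (mul_le_of_le_one_left hf hv1) (Real.rpow_le_rpow hvf hM hm.le)
      (by positivity) hf
  have h2 : v ^ P.q * f ^ (1 + P.q) ≤ f * M ^ P.q := by
    rw [Real.rpow_add_of_nonneg hf zero_le_one hq.le, Real.rpow_one, mul_left_comm,
      ← Real.mul_rpow hv hf]
    exact mul_le_mul_of_nonneg_left (Real.rpow_le_rpow hvf hM hq.le) hf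
  unfold N growth
  calc _ ≤ P.κ * f + P.c₁ * (f * M ^ P.m) + P.c₂ * (f * M ^ P.q) := by gcongr
    _ = _ := by ring

theorem le_N {v f A : ℝ} (hv : 0 ≤ v) (hv1 : v ≤ 1) (hf : 0 ≤ f) (hA : 0 ≤ A) (hAv : A ≤ v * f) :
    P.c₁ * A ^ (1 + P.m) + P.c₂ * A ^ (1 + P.q) ≤ P.N v f := by
  have hm := P.m_pos
  have hq := P.q_pos
  have hκ := P.κ_nonneg
  have hc₁ := P.c₁_nonneg
  have hc₂ := P.c₂_nonneg
  have h1 : A ^ (1 + P.m) ≤ (v * f) ^ (1 + P.m) := Real.rpow_le_rpow hA hAv (by positivity)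
  have h2 : A ^ (1 + P.q) ≤ v ^ P.q * f ^ (1 + P.q) := by
    refine (Real.rpow_le_rpow hA hAv (by positivity)).trans ?_
    rw [Real.mul_rpow hv hf]
    refine mul_le_mul_of_nonneg_right ?_ (by positivity)
    exact Real.rpow_le_rpow_of_exponent_ge_of_imp hv hv1 (by linarith) (by intro _ h; linarith)
  unfold N
  have h3 := mul_le_mul_of_nonneg_left h1 hc₁
  have h4 := mul_le_mul_of_nonneg_left h2 hc₂
  have h5 := mul_nonneg hκ hf
  linarith

theorem le_of_superlinear {c e M : ℝ} (hc : 0 < c) (he : 0 < e) (hM : 0 < M)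
    (h : c * (M / 2) ^ (1 + e) ≤ 4 * M) : M ≤ 2 * (8 / c) ^ (1 / e) := by
  have hM2 : 0 < M / 2 := half_pos hM
  rw [Real.rpow_add hM2, Real.rpow_one] at h
  have h1 : (M / 2) ^ e ≤ 8 / c := by
    rw [le_div_iff₀ hc]
    have : M * ((M / 2) ^ e * c) ≤ M * 8 := by linarith
    exact le_of_mul_le_mul_left this hM
  have h2 := Real.rpow_le_rpow (by positivity) h1 (z := 1 / e) (by positivity)
  rw [← Real.rpow_mul hM2.le, mul_one_div_cancel he.ne', Real.rpow_one] at h2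
  linarith

/-- One of the two superlinear coefficients is positive, and that term alone already bounds M. -/
theorem exists_bound : ∃ M₀ : ℝ, 0 < M₀ ∧ ∀ M, 0 < M →
    P.c₁ * (M / 2) ^ (1 + P.m) + P.c₂ * (M / 2) ^ (1 + P.q) ≤ 4 * M → M ≤ M₀ := by
  have hc₁ := P.c₁_nonneg
  have hc₂ := P.c₂_nonneg
  rcases P.c_ne with h | h
  · have hc : 0 < P.c₁ := hc₁.lt_of_ne' h
    refine ⟨2 * (8 / P.c₁) ^ (1 / P.m), by positivity, fun M hM hle => ?_⟩
    refine le_of_superlinear hc P.m_pos hM (le_trans ?_ hle)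
    have : 0 ≤ P.c₂ * (M / 2) ^ (1 + P.q) := by positivity
    linarith
  · have hc : 0 < P.c₂ := hc₂.lt_of_ne' h
    refine ⟨2 * (8 / P.c₂) ^ (1 / P.q), by positivity, fun M hM hle => ?_⟩
    refine le_of_superlinear hc P.q_pos hM (le_trans ?_ hle)
    have : 0 ≤ P.c₁ * (M / 2) ^ (1 + P.m) := by positivity
    linarith

theorem exists_small {R : ℝ} (hR : 0 < R) : ∃ b : ℝ, 0 < b ∧ b ≤ R ∧ P.growth b < 2 := by
  have hc : ContinuousAt P.growth 0 := by
    have h1 : ContinuousAt (fun M : ℝ => M ^ P.m) 0 :=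
      Real.continuousAt_rpow_const _ _ (Or.inr P.m_pos.le)
    have h2 : ContinuousAt (fun M : ℝ => M ^ P.q) 0 :=
      Real.continuousAt_rpow_const _ _ (Or.inr P.q_pos.le)
    unfold growth
    fun_prop
  have h0 : P.growth 0 < 2 := by
    unfold growth
    rw [Real.zero_rpow P.m_pos.ne', Real.zero_rpow P.q_pos.ne']
    simpa using P.κ_lt
  have h1 : ∀ᶠ b in 𝓝[>] (0 : ℝ), P.growth b < 2 :=
    (hc.eventually (gt_mem_nhds h0)).filter_mono nhdsWithin_le_nhds
  obtain ⟨b, hb, hb'⟩ := (h1.and (Ioc_mem_nhdsGT hR)).exists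
  exact ⟨b, hb'.1, hb'.2, hb⟩

end Nonlinearity

/-! ### Concave profiles -/

/-- The solution of `W'' = -h`, `W 0 = 0`, `W' 0 = b`. -/
def profile (b : ℝ) (h : ℝ → ℝ) (x : ℝ) : ℝ :=
  b * x - x * (∫ s in (0 : ℝ)..x, h s) + ∫ s in (0 : ℝ)..x, s * h s

variable {b : ℝ} {h F : ℝ → ℝ}

theorem hasDerivAt_integral_of_continuous (hh : Continuous h) (x : ℝ) :
    HasDerivAt (fun x => ∫ s in (0 : ℝ)..x, h s) (h x) x :=
  intervalIntegral.integral_hasDerivAt_right (hh.intervalIntegrable _ _)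
    (hh.stronglyMeasurableAtFilter _ _) hh.continuousAt

theorem hasDerivAt_profile (hh : Continuous h) (x : ℝ) :
    HasDerivAt (profile b h) (b - ∫ s in (0 : ℝ)..x, h s) x := by
  have h1 := hasDerivAt_integral_of_continuous hh x
  have h2 := hasDerivAt_integral_of_continuous (h := fun s => s * h s) (by fun_prop) x
  have h3 := (((hasDerivAt_id x).const_mul b).sub ((hasDerivAt_id x).mul h1)).add h2
  refine h3.congr_deriv ?_
  simp only [id_eq]
  ring

theorem hasDerivAt_slope (hh : Continuous h) (x : ℝ) :
    HasDerivAt (fun x => b - ∫ s in (0 : ℝ)..x, h s) (-h x) x :=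
  (hasDerivAt_integral_of_continuous hh x).const_sub b

theorem profile_zero : profile b h 0 = 0 := by simp [profile]

/-- The integral equation for `F = W / x`. -/
def IsQuotientProfile (b : ℝ) (h F : ℝ → ℝ) : Prop :=
  ∀ x ∈ Icc (0 : ℝ) 1, F x = b - x * ∫ σ in (0 : ℝ)..1, (1 - σ) * h (x * σ)

/-- The substitution s = xσ. Working with the quotient F avoids the division of W by x at the pole x
= 0. -/
theorem IsQuotientProfile.mul_eq (hF : IsQuotientProfile b h F) (hh : Continuous h) {x : ℝ}
    (hx : x ∈ Icc (0 : ℝ) 1) : x * F x = profile b h x := by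
  have h1 : x * ∫ σ in (0 : ℝ)..1, (x - x * σ) * h (x * σ) = ∫ s in (0 : ℝ)..x, (x - s) * h s := by
    have := intervalIntegral.mul_integral_comp_mul_left (a := 0) (b := 1) x
      (f := fun s => (x - s) * h s)
    simpa using this
  have h2 : x * ∫ σ in (0 : ℝ)..1, (1 - σ) * h (x * σ)
      = ∫ σ in (0 : ℝ)..1, (x - x * σ) * h (x * σ) := by
    rw [← intervalIntegral.integral_const_mul]
    congr 1
    ext σ
    ring
  have h3 : ∫ s in (0 : ℝ)..x, (x - s) * h s
      = x * (∫ s in (0 : ℝ)..x, h s) - ∫ s in (0 : ℝ)..x, s * h s := by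
    rw [← intervalIntegral.integral_const_mul, ← intervalIntegral.integral_sub
      (Continuous.intervalIntegrable (by fun_prop) _ _)
      (Continuous.intervalIntegrable (by fun_prop) _ _)]
    congr 1
    ext s
    ring
  rw [hF x hx, mul_sub, h2, h1, h3, profile]
  ring

theorem IsQuotientProfile.apply_zero (hF : IsQuotientProfile b h F) : F 0 = b := by
  rw [hF 0 ⟨le_rfl, zero_le_one⟩]
  simp

theorem mul_mem_unit {x σ : ℝ} (hx : x ∈ Icc (0 : ℝ) 1) (hσ : σ ∈ Icc (0 : ℝ) 1) :
    x * σ ∈ Icc (0 : ℝ) 1 :=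
  ⟨mul_nonneg hx.1 hσ.1, mul_le_one₀ hx.2 hσ.1 hσ.2⟩

theorem IsQuotientProfile.le (hF : IsQuotientProfile b h F) (hh0 : ∀ x, 0 ≤ h x) {x : ℝ}
    (hx : x ∈ Icc (0 : ℝ) 1) : F x ≤ b := by
  rw [hF x hx]
  have : 0 ≤ ∫ σ in (0 : ℝ)..1, (1 - σ) * h (x * σ) :=
    intervalIntegral.integral_nonneg zero_le_one fun σ hσ =>
      mul_nonneg (sub_nonneg.2 hσ.2) (hh0 _)
  have := mul_nonneg hx.1 this
  linarith

theorem IsQuotientProfile.le_apply (hF : IsQuotientProfile b h F) (hh : Continuous h) {x C : ℝ}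
    (hx : x ∈ Icc (0 : ℝ) 1) (hC : ∀ σ ∈ Icc (0 : ℝ) 1, (1 - σ) * h (x * σ) ≤ C) :
    b - x * C ≤ F x := by
  rw [hF x hx]
  have h1 : ∫ σ in (0 : ℝ)..1, (1 - σ) * h (x * σ) ≤ ∫ σ in (0 : ℝ)..1, C :=
    intervalIntegral.integral_mono_on zero_le_one
      (Continuous.intervalIntegrable (by fun_prop) _ _) intervalIntegrable_const hC
  have h2 := mul_le_mul_of_nonneg_left h1 hx.1
  simp at h2
  linarith

theorem slope_antitone (hh : Continuous h) (hh0 : ∀ x, 0 ≤ h x) :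
    Antitone fun x => b - ∫ s in (0 : ℝ)..x, h s := by
  refine antitone_of_deriv_nonpos (fun x => (hasDerivAt_slope hh x).differentiableAt) fun x => ?_
  rw [(hasDerivAt_slope hh x).deriv]
  exact neg_nonpos.2 (hh0 x)

theorem profile_monotoneOn (hh : Continuous h) (hh0 : ∀ x, 0 ≤ h x)
    (hslope : 0 ≤ b - ∫ s in (0 : ℝ)..1, h s) : MonotoneOn (profile b h) (Icc 0 1) := by
  refine monotoneOn_of_deriv_nonneg (convex_Icc 0 1)
    (fun x _ => (hasDerivAt_profile hh x).continuousAt.continuousWithinAt)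
    (fun x _ => (hasDerivAt_profile hh x).differentiableAt.differentiableWithinAt) fun x hx => ?_
  rw [interior_Icc] at hx
  rw [(hasDerivAt_profile hh x).deriv]
  exact hslope.trans (slope_antitone hh hh0 hx.2.le)

/-- W is concave with nonnegative slope at 1, hence monotone on [0, 1], and it is positive just
after 0 since F(0) = b > 0. -/
theorem IsQuotientProfile.pos (hF : IsQuotientProfile b h F) (hh : Continuous h)
    (hh0 : ∀ x, 0 ≤ h x) (hFc : Continuous F) (hb : 0 < b)
    (hslope : 0 ≤ b - ∫ s in (0 : ℝ)..1, h s) {x : ℝ} (hx : x ∈ Icc (0 : ℝ) 1) : 0 < F x := by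
  rcases hx.1.eq_or_lt with rfl | hx0
  · rwa [hF.apply_zero]
  · have h1 : ∀ᶠ y in 𝓝[>] (0 : ℝ), 0 < F y :=
      (hFc.continuousAt.eventually (lt_mem_nhds (by rwa [hF.apply_zero]))).filter_mono
        nhdsWithin_le_nhds
    obtain ⟨y, hy, hy'⟩ := (h1.and (Ioc_mem_nhdsGT hx0)).exists
    have hyI : y ∈ Icc (0 : ℝ) 1 := ⟨hy'.1.le, hy'.2.trans hx.2⟩
    have h2 := profile_monotoneOn hh hh0 hslope hyI hx hy'.2
    rw [← hF.mul_eq hh hyI, ← hF.mul_eq hh hx] at h2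
    exact (pos_iff_pos_of_mul_pos ((mul_pos hy'.1 hy).trans_le h2)).1 hx0

theorem half_slope_le_profile (hh : Continuous h) (hh0 : ∀ x, 0 ≤ h x) :
    1 / 2 * (b - ∫ s in (0 : ℝ)..(1 / 2), h s) ≤ profile b h (1 / 2) := by
  obtain ⟨c, hc, hc'⟩ := exists_hasDerivAt_eq_slope (profile b h) _ (by norm_num : (0 : ℝ) < 1 / 2)
    (fun x _ => (hasDerivAt_profile hh x).continuousAt.continuousWithinAt)
    (fun x _ => hasDerivAt_profile (b := b) hh x)
  have h1 := slope_antitone (b := b) hh hh0 hc.2.le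
  dsimp only at h1
  rw [hc', profile_zero, show ∀ y : ℝ, (y - 0) / (1 / 2 - 0) = 2 * y by intro y; ring] at h1
  linarith

theorem profile_one_le (hh : Continuous h) (hh0 : ∀ x, 0 ≤ h x) :
    profile b h 1 ≤ 2 * profile b h (1 / 2) := by
  obtain ⟨c, hc, hc'⟩ := exists_hasDerivAt_eq_slope (profile b h) _ (by norm_num : (1 / 2 : ℝ) < 1)
    (fun x _ => (hasDerivAt_profile hh x).continuousAt.continuousWithinAt)
    (fun x _ => hasDerivAt_profile (b := b) hh x)
  have h1 := slope_antitone (b := b) hh hh0 hc.1.le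
  have h2 := half_slope_le_profile (b := b) hh hh0
  dsimp only at h1
  rw [hc', show ∀ y : ℝ, y / (1 - 1 / 2) = 2 * y by intro y; ring] at h1
  linarith

/-! ### Shooting -/

namespace Nonlinearity

variable (P : Nonlinearity)

/-- `h = N(1 - τ², f)` for `x = 1 - τ`, `f = F / (2 - x)`. -/
def IsSource (h F : ℝ → ℝ) : Prop :=
  ∀ x ∈ Icc (0 : ℝ) 1, h x = P.N (x * (2 - x)) (F x / (2 - x))

variable {P}

theorem weight_mem {x : ℝ} (hx : x ∈ Icc (0 : ℝ) 1) : x * (2 - x) ∈ Icc (0 : ℝ) 1 :=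
  ⟨mul_nonneg hx.1 (by linarith [hx.2]), by nlinarith [sq_nonneg (1 - x)]⟩

theorem weight_mul {x y : ℝ} (hx : x ∈ Icc (0 : ℝ) 1) : x * (2 - x) * (y / (2 - x)) = x * y := by
  have : 2 - x ≠ 0 := by linarith [hx.2]
  field_simp

/-- The factor 1/2 comes from (1 - σ)/(2 - xσ) ≤ 1/2 for x ≤ 1. It is what makes growth < 2 the
right smallness condition later. -/
theorem one_sub_mul_source_le {x σ b y M : ℝ} (hx : x ∈ Icc (0 : ℝ) 1) (hσ : σ ∈ Icc (0 : ℝ) 1)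
    (hb : 0 ≤ b) (hG : 0 ≤ P.growth M) (hy : 0 ≤ y) (hyb : y ≤ b) (hM : x * σ * y ≤ M) :
    (1 - σ) * P.N (x * σ * (2 - x * σ)) (y / (2 - x * σ)) ≤ b * P.growth M / 2 := by
  have hs := mul_mem_unit hx hσ
  have h2 : 0 < 2 - x * σ := by linarith [hs.2]
  have h1 := P.N_le (M := M) (weight_mem hs).1 (weight_mem hs).2 (div_nonneg hy h2.le)
    (by rwa [weight_mul hs])
  have h3 : (1 - σ) * (y / (2 - x * σ)) ≤ b / 2 := by
    rw [← mul_div_assoc, div_le_div_iff₀ h2 two_pos]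
    have h4 : (1 - σ) * 2 ≤ 2 - x * σ := by
      have := mul_le_mul_of_nonneg_right hx.2 hσ.1
      linarith [hσ.1]
    have h5 := mul_le_mul hyb h4 (by linarith [hσ.2]) hb
    linarith
  calc (1 - σ) * P.N (x * σ * (2 - x * σ)) (y / (2 - x * σ))
      ≤ (1 - σ) * (y / (2 - x * σ) * P.growth M) :=
        mul_le_mul_of_nonneg_left h1 (by linarith [hσ.2])
    _ = (1 - σ) * (y / (2 - x * σ)) * P.growth M := by ring
    _ ≤ b / 2 * P.growth M := mul_le_mul_of_nonneg_right h3 hG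
    _ = _ := by ring

/-- The a priori bound. Concavity and superlinearity first bound the maximum M = W(1) by M₀. Then N
≤ f · growth(M₀) keeps F above b/2 up to a fixed x₀, so b/2 ≤ M₀/x₀. -/
theorem exists_slope_bound (P : Nonlinearity) : ∃ B : ℝ, 0 < B ∧ ∀ (b : ℝ) (h F : ℝ → ℝ), 0 < b →
    Continuous h → Continuous F → (∀ x, 0 ≤ h x) → IsQuotientProfile b h F →
    0 ≤ b - (∫ s in (0 : ℝ)..1, h s) → P.IsSource h F → b ≤ B := by
  obtain ⟨M₀, hM₀, hbound⟩ := P.exists_bound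
  have hC := P.growth_nonneg hM₀.le
  refine ⟨2 * M₀ * (P.growth M₀ + 1), by positivity, fun b h F hb hh hFc hh0 hF hslope hsrc => ?_⟩
  have hpos := fun x hx => hF.pos hh hh0 hFc hb hslope (x := x) hx
  have hmono := profile_monotoneOn hh hh0 hslope
  have h1I : (1 : ℝ) ∈ Icc (0 : ℝ) 1 := ⟨zero_le_one, le_rfl⟩
  have h2I : (1 / 2 : ℝ) ∈ Icc (0 : ℝ) 1 := by norm_num
  set M := profile b h 1 with hM
  have hMpos : 0 < M := by
    rw [hM, ← hF.mul_eq hh h1I]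
    exact mul_pos one_pos (hpos 1 h1I)
  have hMle : M ≤ M₀ := by
    refine hbound M hMpos ?_
    -- On [1/2, 1] concavity and monotonicity give W ≥ M/2, which bounds the source from below
    -- there. Its integral over that half is at most the slope W'(1/2) ≤ 2W(1/2) ≤ 2M; hence the
    -- constant 4.
    have e1 := half_slope_le_profile (b := b) hh hh0
    have e2 := profile_one_le (b := b) hh hh0
    have e3 := hmono h2I h1I h2I.2
    have e4 : 1 / 2 * (P.c₁ * (M / 2) ^ (1 + P.m) + P.c₂ * (M / 2) ^ (1 + P.q))
        ≤ ∫ s in (1 / 2 : ℝ)..1, h s := by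
      have := intervalIntegral.integral_mono_on (a := (1 / 2 : ℝ)) (b := 1) (by norm_num)
        (f := fun _ => P.c₁ * (M / 2) ^ (1 + P.m) + P.c₂ * (M / 2) ^ (1 + P.q)) (g := h)
        intervalIntegrable_const (hh.intervalIntegrable _ _) (μ := MeasureTheory.volume)
        (fun x hx => ?_)
      · rw [intervalIntegral.integral_const, smul_eq_mul] at this
        norm_num at this ⊢
        exact this
      · have hxI : x ∈ Icc (0 : ℝ) 1 := ⟨by linarith [hx.1], hx.2⟩
        rw [hsrc x hxI]
        refine P.le_N (weight_mem hxI).1 (weight_mem hxI).2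
          (div_nonneg (hpos x hxI).le (by linarith [hx.2])) (by positivity) ?_
        rw [weight_mul hxI, hF.mul_eq hh hxI]
        have := hmono h2I hxI hx.1
        linarith
    have e5 := intervalIntegral.integral_add_adjacent_intervals
      (hh.intervalIntegrable (μ := MeasureTheory.volume) 0 (1 / 2))
      (hh.intervalIntegrable (1 / 2) 1)
    linarith
  have hc1 : 0 < P.growth M₀ + 1 := by positivity
  have hx₀ : 1 / (P.growth M₀ + 1) ∈ Icc (0 : ℝ) 1 :=
    ⟨by positivity, by rw [div_le_one hc1]; linarith⟩
  set x₀ := 1 / (P.growth M₀ + 1) with hx₀def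
  have hx₀C : x₀ * P.growth M₀ ≤ 1 := by
    rw [hx₀def, one_div_mul_eq_div, div_le_one hc1]; linarith
  have hFx : b - x₀ * (b * P.growth M₀ / 2) ≤ F x₀ := by
    refine hF.le_apply hh hx₀ fun σ hσ => ?_
    have hs := mul_mem_unit hx₀ hσ
    rw [hsrc _ hs]
    refine one_sub_mul_source_le hx₀ hσ hb.le hC (hpos _ hs).le (hF.le hh0 hs) ?_
    rw [hF.mul_eq hh hs]
    exact (hmono hs h1I hs.2).trans hMle
  have h3 : x₀ * F x₀ ≤ M₀ := by
    rw [hF.mul_eq hh hx₀]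
    exact (hmono hx₀ h1I hx₀.2).trans hMle
  have h4 : b / 2 ≤ F x₀ := by
    have := mul_le_mul_of_nonneg_left hx₀C hb.le
    linarith
  have h5 : x₀ * (b / 2) ≤ M₀ := (mul_le_mul_of_nonneg_left h4 hx₀.1).trans h3
  rw [hx₀def, one_div_mul_eq_div, div_le_iff₀ hc1] at h5
  linarith

/-- The nonlinearity truncated to `0 ≤ f ≤ R`. -/
def truncated (P : Nonlinearity) (R s y : ℝ) : ℝ :=
  P.N (max 0 (min s 1) * (2 - max 0 (min s 1))) (max 0 (min (y / (2 - max 0 (min s 1))) R))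

theorem clamp_unit_mem (s : ℝ) : max 0 (min s 1) ∈ Icc (0 : ℝ) 1 :=
  ⟨le_max_left _ _, max_le zero_le_one (min_le_right _ _)⟩

theorem clamp_unit_eq {s : ℝ} (hs : s ∈ Icc (0 : ℝ) 1) : max 0 (min s 1) = s := by
  rw [min_eq_left hs.2, max_eq_right hs.1]

theorem continuous_truncated (P : Nonlinearity) (R : ℝ) :
    Continuous (Function.uncurry (P.truncated R)) := by
  have h1 : Continuous fun z : ℝ × ℝ => (max 0 (min z.1 1) * (2 - max 0 (min z.1 1)),
      max 0 (min (z.2 / (2 - max 0 (min z.1 1))) R)) := by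
    have : ∀ z : ℝ × ℝ, 2 - max 0 (min z.1 1) ≠ 0 := fun z => by
      linarith [(clamp_unit_mem z.1).2]
    fun_prop (disch := assumption)
  exact P.contDiff_N.continuous.comp h1

theorem truncated_nonneg (P : Nonlinearity) (R s y : ℝ) : 0 ≤ P.truncated R s y :=
  P.N_nonneg (weight_mem (clamp_unit_mem s)).1 (le_max_left _ _)

theorem exists_truncated_lipschitz (P : Nonlinearity) {R : ℝ} (hR : 0 ≤ R) : ∃ L : ℝ, 0 ≤ L ∧
    ∀ s ∈ Icc (0 : ℝ) 1, ∀ y y', |P.truncated R s y - P.truncated R s y'| ≤ L * |y - y'| := by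
  obtain ⟨L, hL0, hL⟩ := P.exists_lipschitz R
  refine ⟨L, hL0, fun s hs y y' => ?_⟩
  unfold truncated
  rw [clamp_unit_eq hs]
  have hmem : ∀ t : ℝ, max 0 (min t R) ∈ Icc 0 R := fun t =>
    ⟨le_max_left _ _, max_le hR (min_le_right _ _)⟩
  refine (hL _ (weight_mem hs) _ (hmem _) _ (hmem _)).trans (mul_le_mul_of_nonneg_left ?_ hL0)
  have h2 : 1 ≤ 2 - s := by linarith [hs.2]
  calc |max 0 (min (y / (2 - s)) R) - max 0 (min (y' / (2 - s)) R)|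
      ≤ |min (y / (2 - s)) R - min (y' / (2 - s)) R| := by
        have := abs_max_sub_max_le_max 0 (min (y / (2 - s)) R) 0 (min (y' / (2 - s)) R)
        simpa using this
    _ ≤ |y / (2 - s) - y' / (2 - s)| := by
        have := abs_min_sub_min_le_max (y / (2 - s)) R (y' / (2 - s)) R
        simpa using this
    _ = |y - y'| / (2 - s) := by
        rw [← sub_div, abs_div, abs_of_pos (by linarith : 0 < 2 - s)]
    _ ≤ |y - y'| := div_le_self (abs_nonneg _) h2

theorem truncated_eq (P : Nonlinearity) {R s y : ℝ} (hs : s ∈ Icc (0 : ℝ) 1) (hy : 0 ≤ y)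
    (hyR : y ≤ R) : P.truncated R s y = P.N (s * (2 - s)) (y / (2 - s)) := by
  have h2 : 1 ≤ 2 - s := by linarith [hs.2]
  unfold truncated
  rw [clamp_unit_eq hs, min_eq_left ((div_le_self hy h2).trans hyR),
    max_eq_right (div_nonneg hy (by linarith))]

/-- Sturm comparison with the first eigenfunction V = x(2 - x), V'' = -2. The Wronskian W V' - W' V
vanishes at 0 and equals -W'(1) at 1. Its derivative -2W + hV is negative, since hV ≤ growth(b) W <
2W. -/
theorem slope_pos_of_small (P : Nonlinearity) {R b : ℝ} (hb : 0 < b) (hbR : b ≤ R)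
    (hsmall : P.growth b < 2) (hF : IsQuotientProfile b h F) (hh : Continuous h)
    (hh0 : ∀ x, 0 ≤ h x) (hsrc : ∀ s ∈ Icc (0 : ℝ) 1, h s = P.truncated R s (F s)) :
    0 < b - ∫ s in (0 : ℝ)..1, h s := by
  have hC := P.growth_nonneg hb.le
  have hpos : ∀ x ∈ Icc (0 : ℝ) 1, 0 < F x := by
    intro x hx
    have : b - x * (b * P.growth b / 2) ≤ F x := by
      refine hF.le_apply hh hx fun σ hσ => ?_
      have hs := mul_mem_unit hx hσ
      rw [hsrc _ hs]
      have hle := hF.le hh0 hs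
      have h2 : 0 < 2 - x * σ := by linarith [hs.2]
      -- Positivity of F is not yet known. A negative value is truncated to zero, so the source is N
      -- at the positive part of F.
      have h3 : P.truncated R (x * σ) (F (x * σ))
          = P.N (x * σ * (2 - x * σ)) (max 0 (F (x * σ)) / (2 - x * σ)) := by
        rcases le_total 0 (F (x * σ)) with h0 | h0
        · rw [truncated_eq P hs h0 (hle.trans hbR), max_eq_right h0]
        · unfold truncated
          rw [clamp_unit_eq hs, max_eq_left h0, zero_div, max_eq_left]
          exact (min_le_left _ _).trans (div_nonpos_of_nonpos_of_nonneg h0 h2.le)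
      rw [h3]
      have h4 : max 0 (F (x * σ)) ≤ b := max_le hb.le hle
      refine one_sub_mul_source_le hx hσ hb.le hC (le_max_left _ _) h4 ?_
      exact (mul_le_of_le_one_left (le_max_left _ _) hs.2).trans h4
    have h5 : x * (b * P.growth b / 2) < b := by
      have h6 : x * (b * P.growth b / 2) ≤ b * P.growth b / 2 :=
        mul_le_of_le_one_left (by positivity) hx.2
      have h7 := mul_lt_mul_of_pos_left hsmall hb
      linarith
    linarith
  have hE : ∀ x, HasDerivAt (fun x => profile b h x * (2 - 2 * x)
      - (b - ∫ s in (0 : ℝ)..x, h s) * (x * (2 - x)))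
      (-2 * profile b h x + x * (2 - x) * h x) x := by
    intro x
    have h1 : HasDerivAt (fun x : ℝ => 2 - 2 * x) (-2) x := by
      simpa using ((hasDerivAt_id x).const_mul 2).const_sub 2
    have h2 : HasDerivAt (fun x : ℝ => x * (2 - x)) (2 - 2 * x) x := by
      refine ((hasDerivAt_id x).fun_mul ((hasDerivAt_id x).const_sub 2)).congr_deriv ?_
      simp only [id_eq]
      ring
    refine (((hasDerivAt_profile hh x).fun_mul h1).fun_sub
      ((hasDerivAt_slope hh x).fun_mul h2)).congr_deriv ?_
    ring
  have hanti := strictAntiOn_of_deriv_neg (convex_Icc (0 : ℝ) 1)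
    (fun x _ => (hE x).continuousAt.continuousWithinAt) (fun x hx => by
      rw [interior_Icc] at hx
      have hxI := Ioo_subset_Icc_self hx
      have hle := hF.le hh0 hxI
      have h2 : 0 < 2 - x := by linarith [hx.2]
      rw [(hE x).deriv, ← hF.mul_eq hh hxI, hsrc x hxI,
        truncated_eq P hxI (hpos x hxI).le (hle.trans hbR)]
      have h3 := P.N_le (M := b) (weight_mem hxI).1 (weight_mem hxI).2
        (div_nonneg (hpos x hxI).le h2.le) (by
          rw [weight_mul hxI]
          exact (mul_le_of_le_one_left (hpos x hxI).le hxI.2).trans hle)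
      have h4 := mul_le_mul_of_nonneg_left h3 (weight_mem hxI).1
      rw [← mul_assoc, weight_mul hxI] at h4
      have h5 := mul_lt_mul_of_pos_left hsmall (mul_pos hx.1 (hpos x hxI))
      linarith)
  have := hanti ⟨le_rfl, zero_le_one⟩ ⟨zero_le_one, le_rfl⟩ zero_lt_one
  simp only [profile_zero] at this
  norm_num at this
  linarith

/-- Intermediate value theorem for the terminal slope W'(1) as a function of b in [b₀, B + 1]. If
that slope is nonnegative then 0 < F ≤ b ≤ R, so the truncation is inactive. At b = R = B + 1 this
would contradict the a priori bound, so the slope is negative there. -/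
theorem exists_half_solution (P : Nonlinearity) : ∃ (b : ℝ) (h F : ℝ → ℝ), Continuous h ∧
    Continuous F ∧ IsQuotientProfile b h F ∧ P.IsSource h F ∧ (b = ∫ s in (0 : ℝ)..1, h s) ∧
    ∀ x ∈ Icc (0 : ℝ) 1, 0 < F x := by
  obtain ⟨B, hB, hbound⟩ := P.exists_slope_bound
  set R := B + 1 with hR
  have hR0 : 0 < R := by positivity
  have hg := P.continuous_truncated R
  obtain ⟨L, hL0, hL⟩ := P.exists_truncated_lipschitz hR0.le
  obtain ⟨F, hFc, hF, C, hFC⟩ := exists_volterra_solution hg hL0 hL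
  set h : ℝ → ℝ → ℝ := fun b s => P.truncated R s (F b s) with hh_def
  have hh : ∀ b, Continuous (h b) := fun b =>
    hg.comp (continuous_id.prodMk (hFc b))
  have hh0 : ∀ b s, 0 ≤ h b s := fun b s => P.truncated_nonneg R s _
  have hQ : ∀ b, IsQuotientProfile b (h b) (F b) := hF
  have hsrc : ∀ b, 0 < b → b ≤ R → 0 ≤ b - (∫ s in (0 : ℝ)..1, h b s) →
      P.IsSource (h b) (F b) := fun b hb hbR hs x hx =>
    P.truncated_eq hx ((hQ b).pos (hh b) (hh0 b) (hFc b) hb hs hx).le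
      (((hQ b).le (hh0 b) hx).trans hbR)
  have hcont : Continuous fun b => b - ∫ s in (0 : ℝ)..1, h b s := by
    have hlip : ∀ b b', ‖(∫ s in (0 : ℝ)..1, h b s) - ∫ s in (0 : ℝ)..1, h b' s‖
        ≤ L * C * |b - b'| := by
      intro b b'
      rw [← intervalIntegral.integral_sub ((hh b).intervalIntegrable _ _)
        ((hh b').intervalIntegrable _ _)]
      have := intervalIntegral.norm_integral_le_of_norm_le_const (a := (0 : ℝ)) (b := 1)
        (f := fun s => h b s - h b' s) (C := L * C * |b - b'|) (fun s hs => by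
          rw [uIoc_of_le zero_le_one] at hs
          have hsI := Ioc_subset_Icc_self hs
          rw [Real.norm_eq_abs, mul_assoc]
          exact (hL s hsI _ _).trans (mul_le_mul_of_nonneg_left (hFC b b' s hsI) hL0))
      simpa using this
    have hlc : Continuous fun b => ∫ s in (0 : ℝ)..1, h b s := by
      refine continuous_iff_continuousAt.2 fun b => ?_
      rw [ContinuousAt, tendsto_iff_norm_sub_tendsto_zero]
      have h0 : Tendsto (fun b' => L * C * |b' - b|) (𝓝 b) (𝓝 0) := by
        have : Continuous fun b' => L * C * |b' - b| := by fun_prop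
        simpa using this.tendsto b
      exact squeeze_zero (fun _ => norm_nonneg _) (fun b' => hlip b' b) h0
    exact continuous_id.sub hlc
  obtain ⟨b₀, hb₀, hb₀R, hsmall⟩ := P.exists_small hR0
  have hlow : 0 < b₀ - ∫ s in (0 : ℝ)..1, h b₀ s :=
    P.slope_pos_of_small hb₀ hb₀R hsmall (hQ b₀) (hh b₀) (hh0 b₀) fun s _ => rfl
  have hhigh : R - (∫ s in (0 : ℝ)..1, h R s) < 0 := by
    by_contra hneg
    have hneg := not_lt.1 hneg
    have := hbound R (h R) (F R) hR0 (hh R) (hFc R) (hh0 R) (hQ R) hneg (hsrc R hR0 le_rfl hneg)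
    linarith
  obtain ⟨b, hbI, hb⟩ := intermediate_value_Icc' hb₀R hcont.continuousOn ⟨hhigh.le, hlow.le⟩
  have hb0 : 0 < b := hb₀.trans_le hbI.1
  exact ⟨b, h b, F b, hh b, hFc b, hQ b, hsrc b hb0 hbI.2 hb.ge, sub_eq_zero.1 hb,
    fun x hx => (hQ b).pos (hh b) (hh0 b) (hFc b) hb0 hb.ge hx⟩

end Nonlinearity

end

section

/-! ### The Green operator -/

/-- The weighted mean `∫₀¹ σ^m g(yσ) dσ`. -/
def weightedMean (m : ℕ) (g : ℝ → ℝ) (y : ℝ) : ℝ := ∫ σ in (0 : ℝ)..1, σ ^ m * g (y * σ)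

variable {g h : ℝ → ℝ}

theorem continuous_weightedMean (m : ℕ) (hg : Continuous g) : Continuous (weightedMean m g) := by
  refine intervalIntegral.continuous_parametric_intervalIntegral_of_continuous'
    (f := fun y σ : ℝ => σ ^ m * g (y * σ)) ?_ 0 1
  unfold Function.uncurry
  fun_prop

theorem hasDerivAt_weightedMean (m : ℕ) (hg : ContDiff ℝ 1 g) (y : ℝ) :
    HasDerivAt (weightedMean m g) (weightedMean (m + 1) (deriv g) y) y := by
  have hgc : Continuous g := hg.continuous
  have hg' : Continuous (deriv g) := hg.continuous_deriv le_rfl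
  obtain ⟨C, hC⟩ := (isCompact_closedBall (0 : ℝ) (|y| + 1)).exists_bound_of_continuousOn
    hg'.continuousOn
  refine (intervalIntegral.hasDerivAt_integral_of_dominated_loc_of_deriv_le
    (F := fun y σ : ℝ => σ ^ m * g (y * σ))
    (F' := fun y σ : ℝ => σ ^ (m + 1) * deriv g (y * σ)) (bound := fun _ => C)
    (Metric.ball_mem_nhds y one_pos) (Eventually.of_forall fun z => ?_) ?_ ?_ ?_ ?_ ?_).2
  · exact Continuous.aestronglyMeasurable (by fun_prop)
  · exact Continuous.intervalIntegrable (by fun_prop) _ _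
  · exact Continuous.aestronglyMeasurable (by fun_prop)
  · refine MeasureTheory.ae_of_all _ fun σ hσ z hz => ?_
    rw [uIoc_of_le zero_le_one] at hσ
    have hz' : |z| ≤ |y| + 1 := by
      have h1 : |z - y| < 1 := by simpa [Real.dist_eq] using hz
      have h2 := abs_sub_abs_le_abs_sub z y
      linarith
    have h1 : ‖deriv g (z * σ)‖ ≤ C := by
      refine hC _ ?_
      rw [mem_closedBall_zero_iff, Real.norm_eq_abs, abs_mul, abs_of_pos hσ.1]
      exact (mul_le_of_le_one_right (abs_nonneg _) hσ.2).trans hz'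
    rw [norm_mul, norm_pow, Real.norm_eq_abs σ, abs_of_pos hσ.1]
    exact (mul_le_of_le_one_left (norm_nonneg _) (pow_le_one₀ hσ.1.le hσ.2)).trans h1
  · exact intervalIntegrable_const
  · refine MeasureTheory.ae_of_all _ fun σ _ z _ => ?_
    have h1 : HasDerivAt (fun z : ℝ => z * σ) σ z := by
      simpa using (hasDerivAt_id z).mul_const σ
    have h2 : HasDerivAt g (deriv g (z * σ)) (z * σ) :=
      (hg.differentiable one_ne_zero _).hasDerivAt
    refine ((h2.comp z h1).const_mul (σ ^ m)).congr_deriv ?_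
    ring

theorem contDiff_weightedMean (n m : ℕ) (hg : ContDiff ℝ n g) :
    ContDiff ℝ n (weightedMean m g) := by
  induction n generalizing m g with
  | zero => exact contDiff_zero.2 (continuous_weightedMean m (contDiff_zero.1 hg))
  | succ n ih =>
    have hg1 : ContDiff ℝ 1 g := hg.of_le (by norm_cast; omega)
    have hd := hasDerivAt_weightedMean m hg1
    push_cast
    rw [contDiff_succ_iff_deriv]
    refine ⟨fun y => (hd y).differentiableAt, by simp, ?_⟩
    rw [show deriv (weightedMean m g) = weightedMean (m + 1) (deriv g) from
      funext fun y => (hd y).deriv]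
    push_cast at hg
    exact ih (m + 1) (contDiff_succ_iff_deriv.1 hg).2.2

/-- One half of the Green operator: `y ↦ y⁻¹ ∫₀ʸ s g(s) ds`. -/
def halfGreen (g : ℝ → ℝ) (y : ℝ) : ℝ := y * weightedMean 1 g y

theorem mul_halfGreen (g : ℝ → ℝ) (y : ℝ) : y * halfGreen g y = ∫ s in (0 : ℝ)..y, s * g s := by
  have h1 := intervalIntegral.mul_integral_comp_mul_left (a := 0) (b := 1) y
    (f := fun s => s * g s)
  simp only [mul_zero, mul_one] at h1
  rw [← h1, halfGreen, weightedMean, ← intervalIntegral.integral_const_mul]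
  congr 2
  ext σ
  ring

/-- The derivative involves only g and its mean, with no singular factor, so one derivative is
gained across y = 0. At 0 the difference quotient is the weighted mean itself, and g(0) - g(0)/2 =
g(0)/2. -/
theorem hasDerivAt_halfGreen (hg : Continuous g) (y : ℝ) :
    HasDerivAt (halfGreen g) (g y - weightedMean 1 g y) y := by
  have hQ := continuous_weightedMean 1 hg
  rcases eq_or_ne y 0 with rfl | hy
  · have h0 : g 0 - weightedMean 1 g 0 = weightedMean 1 g 0 := by
      simp [weightedMean]
      ring
    rw [h0, hasDerivAt_iff_tendsto_slope]
    refine ((hQ.tendsto 0).mono_left nhdsWithin_le_nhds).congr' ?_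
    filter_upwards [self_mem_nhdsWithin] with t ht
    have ht : t ≠ 0 := ht
    simp [slope, halfGreen, ht]
  · have h1 := hasDerivAt_integral_of_continuous (h := fun s => s * g s) (by fun_prop) y
    have h2 := h1.fun_div (hasDerivAt_id y) hy
    have h3 : (halfGreen g) =ᶠ[𝓝 y] fun t => (∫ s in (0 : ℝ)..t, s * g s) / id t := by
      filter_upwards [isOpen_ne.mem_nhds hy] with t ht
      rw [← mul_halfGreen, id, mul_div_cancel_left₀ _ ht]
    refine (h2.congr_of_eventuallyEq h3).congr_deriv ?_
    rw [← mul_halfGreen, halfGreen]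
    simp only [id]
    field_simp

theorem contDiff_halfGreen (n : ℕ) (hg : ContDiff ℝ n g) : ContDiff ℝ (n + 1 : ℕ) (halfGreen g) := by
  have hd := hasDerivAt_halfGreen hg.continuous
  push_cast
  rw [contDiff_succ_iff_deriv]
  refine ⟨fun y => (hd y).differentiableAt, by simp, ?_⟩
  rw [show deriv (halfGreen g) = fun y => g y - weightedMean 1 g y from funext fun y => (hd y).deriv]
  exact hg.sub (contDiff_weightedMean n 1 hg)

/-- `green h` is `w / (1 - τ²)` for the solution of `-w'' = h`, `w(±1) = 0`. -/
def green (h : ℝ → ℝ) (τ : ℝ) : ℝ :=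
  (halfGreen (fun s => h (s - 1)) (1 + τ) + halfGreen (fun s => h (1 - s)) (1 - τ)) / 2

theorem contDiff_green (n : ℕ) (hh : ContDiff ℝ n h) : ContDiff ℝ (n + 1 : ℕ) (green h) := by
  have h1 := contDiff_halfGreen n (g := fun s => h (s - 1)) (hh.comp (contDiff_id.sub contDiff_const))
  have h2 := contDiff_halfGreen n (g := fun s => h (1 - s)) (hh.comp (contDiff_const.sub contDiff_id))
  exact ((h1.comp (contDiff_const.add contDiff_id)).add
    (h2.comp (contDiff_const.sub contDiff_id))).div_const 2

/-- Needed because successive bootstrap iterates agree on [-1, 1] but may differ outside. -/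
theorem green_congr {h' : ℝ → ℝ} (hh : EqOn h h' (Icc (-1) 1)) :
    EqOn (green h) (green h') (Icc (-1) 1) := by
  intro τ hτ
  have h1 : weightedMean 1 (fun s => h (s - 1)) (1 + τ)
      = weightedMean 1 (fun s => h' (s - 1)) (1 + τ) := by
    refine intervalIntegral.integral_congr fun σ hσ => ?_
    rw [uIcc_of_le zero_le_one] at hσ
    have a1 : 0 ≤ (1 + τ) * σ := mul_nonneg (by linarith [hτ.1]) hσ.1
    have a2 : (1 + τ) * σ ≤ 1 + τ := mul_le_of_le_one_right (by linarith [hτ.1]) hσ.2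
    simp only
    rw [hh ⟨by linarith, by linarith [hτ.2]⟩]
  have h2 : weightedMean 1 (fun s => h (1 - s)) (1 - τ)
      = weightedMean 1 (fun s => h' (1 - s)) (1 - τ) := by
    refine intervalIntegral.integral_congr fun σ hσ => ?_
    rw [uIcc_of_le zero_le_one] at hσ
    have a1 : 0 ≤ (1 - τ) * σ := mul_nonneg (by linarith [hτ.2]) hσ.1
    have a2 : (1 - τ) * σ ≤ 1 - τ := mul_le_of_le_one_right (by linarith [hτ.2]) hσ.2
    simp only
    rw [hh ⟨by linarith [hτ.1], by linarith⟩]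
  simp only [green, halfGreen, h1, h2]

/-- With w = (1 - τ²) `green h` = ((1 - τ)A + (1 + τ)B)/2 one finds w' = (B - A)/2 and w'' = -h. The
left side is w'' expanded by the product rule. -/
theorem green_ode (hh : Continuous h) (hf : ContDiff ℝ 2 (green h)) (τ : ℝ) :
    (1 - τ ^ 2) * deriv (deriv (green h)) τ - 4 * τ * deriv (green h) τ - 2 * green h τ = -h τ := by
  set A : ℝ → ℝ := fun τ => ∫ s in (0 : ℝ)..(1 + τ), s * h (s - 1) with hA
  set B : ℝ → ℝ := fun τ => ∫ s in (0 : ℝ)..(1 - τ), s * h (1 - s) with hB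
  have hAd : ∀ τ, HasDerivAt A ((1 + τ) * h τ) τ := by
    intro τ
    have h1 := hasDerivAt_integral_of_continuous (h := fun s => s * h (s - 1)) (by fun_prop) (1 + τ)
    refine (h1.comp τ ((hasDerivAt_id τ).const_add 1)).congr_deriv ?_
    simp
  have hBd : ∀ τ, HasDerivAt B (-((1 - τ) * h τ)) τ := by
    intro τ
    have h1 := hasDerivAt_integral_of_continuous (h := fun s => s * h (1 - s)) (by fun_prop) (1 - τ)
    refine (h1.comp τ ((hasDerivAt_id τ).const_sub 1)).congr_deriv ?_
    simp
  have hw : (fun τ => (1 - τ ^ 2) * green h τ) = fun τ => ((1 - τ) * A τ + (1 + τ) * B τ) / 2 := by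
    ext τ
    simp only [hA, hB, ← mul_halfGreen, green]
    ring
  have hw' : ∀ τ, HasDerivAt (fun τ => (1 - τ ^ 2) * green h τ) ((B τ - A τ) / 2) τ := by
    intro τ
    rw [hw]
    have h1 := ((((hasDerivAt_id τ).const_sub 1).fun_mul (hAd τ)).fun_add
      (((hasDerivAt_id τ).const_add 1).fun_mul (hBd τ))).div_const 2
    refine h1.congr_deriv ?_
    simp only [id]
    ring
  have hf1 : ∀ τ, HasDerivAt (green h) (deriv (green h) τ) τ := fun τ =>
    (hf.differentiable two_ne_zero τ).hasDerivAt
  have hf2 : ∀ τ, HasDerivAt (deriv (green h)) (deriv (deriv (green h)) τ) τ := fun τ =>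
    (((contDiff_succ_iff_deriv (n := 1)).1 hf).2.2.differentiable one_ne_zero τ).hasDerivAt
  have hp : ∀ τ : ℝ, HasDerivAt (fun τ : ℝ => 1 - τ ^ 2) (-(2 * τ)) τ := by
    intro τ
    simpa using (hasDerivAt_pow 2 τ).const_sub 1
  have e1 : (fun τ => (B τ - A τ) / 2)
      = fun τ => -(2 * τ) * green h τ + (1 - τ ^ 2) * deriv (green h) τ :=
    funext fun τ => (hw' τ).unique ((hp τ).fun_mul (hf1 τ))
  have h3 : HasDerivAt (fun τ => (B τ - A τ) / 2) (-h τ) τ := by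
    refine (((hBd τ).fun_sub (hAd τ)).div_const 2).congr_deriv ?_
    ring
  have h4 : HasDerivAt (fun τ : ℝ => -(2 * τ)) (-2) τ := by
    simpa using ((hasDerivAt_id τ).const_mul 2).fun_neg
  rw [e1] at h3
  have h5 := h3.unique ((h4.fun_mul (hf1 τ)).fun_add ((hp τ).fun_mul (hf2 τ)))
  linarith

/-- The condition on b says W'(1) = 0, so the even reflection of W at the equator solves the problem
on [-1, 1]. The Green integrals of the reflected source reduce to the integrals over [0, x] that
define W. -/
theorem green_eq_of_half {b : ℝ} {F : ℝ → ℝ} (hh : Continuous h) (hF : IsQuotientProfile b h F)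
    (hb : b = ∫ s in (0 : ℝ)..1, h s) {τ : ℝ} (hτ : τ ∈ Icc (-1 : ℝ) 1) :
    green (fun τ => h (1 - |τ|)) τ = F (1 - |τ|) / (1 + |τ|) := by
  set k : ℝ → ℝ := fun s => h (1 - |s - 1|) with hk
  have hkc : Continuous k := by fun_prop
  have hgr : ∀ τ, green (fun τ => h (1 - |τ|)) τ = (halfGreen k (1 + τ) + halfGreen k (1 - τ)) / 2 := by
    intro τ
    simp only [green, hk, abs_sub_comm]
  have hev : green (fun τ => h (1 - |τ|)) τ = green (fun τ => h (1 - |τ|)) |τ| := by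
    rcases abs_choice τ with h1 | h1
    · rw [h1]
    · rw [h1, hgr, hgr, sub_neg_eq_add, ← sub_eq_add_neg, add_comm]
  have hx : 1 - |τ| ∈ Icc (0 : ℝ) 1 :=
    ⟨by linarith [abs_le.2 hτ], by linarith [abs_nonneg τ]⟩
  rw [hev, hgr]
  set x := 1 - |τ| with hxdef
  have hx2 : 1 + |τ| = 2 - x := by rw [hxdef]; ring
  rw [hx2]
  have hsh : Continuous fun s => s * h s := by fun_prop
  have hsk : Continuous fun s => s * k s := by fun_prop
  have i1 : ∀ y ∈ Icc (0 : ℝ) 1, ∫ s in (0 : ℝ)..y, s * k s = ∫ s in (0 : ℝ)..y, s * h s := by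
    intro y hy
    refine intervalIntegral.integral_congr fun s hs => ?_
    rw [uIcc_of_le hy.1] at hs
    have : |s - 1| = 1 - s := by rw [abs_of_nonpos (by linarith [hs.2, hy.2])]; ring
    simp only [hk, this, sub_sub_cancel]
  have i2 : ∫ s in (1 : ℝ)..(2 - x), s * k s = ∫ s in x..1, (2 - s) * h s := by
    have h1 := intervalIntegral.integral_comp_sub_left (a := 1) (b := 2 - x)
      (fun s => (2 - s) * h s) 2
    rw [sub_sub_cancel, show (2 : ℝ) - 1 = 1 by norm_num] at h1
    rw [← h1]
    refine intervalIntegral.integral_congr fun s hs => ?_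
    rw [uIcc_of_le (by linarith [hx.2])] at hs
    have : |s - 1| = s - 1 := abs_of_nonneg (by linarith [hs.1])
    simp only [hk, this, sub_sub_cancel]
    congr 2
    ring
  have i3 : ∫ s in x..1, (2 - s) * h s = 2 * (b - ∫ s in (0 : ℝ)..x, h s)
      - ((∫ s in (0 : ℝ)..1, s * h s) - ∫ s in (0 : ℝ)..x, s * h s) := by
    have e1 := intervalIntegral.integral_add_adjacent_intervals
      (hh.intervalIntegrable (μ := MeasureTheory.volume) 0 x) (hh.intervalIntegrable x 1)
    have e2 := intervalIntegral.integral_add_adjacent_intervals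
      (hsh.intervalIntegrable (μ := MeasureTheory.volume) 0 x) (hsh.intervalIntegrable x 1)
    have e3 : ∫ s in x..1, (2 - s) * h s = 2 * (∫ s in x..1, h s) - ∫ s in x..1, s * h s := by
      rw [← intervalIntegral.integral_const_mul, ← intervalIntegral.integral_sub
        ((hh.const_mul 2).intervalIntegrable _ _) (hsh.intervalIntegrable _ _)]
      congr 1
      ext s
      ring
    rw [e3, ← e2, hb, ← e1]
    ring
  have i4 : ∫ s in (0 : ℝ)..(2 - x), s * k s
      = 2 * (b - ∫ s in (0 : ℝ)..x, h s) + ∫ s in (0 : ℝ)..x, s * h s := by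
    rw [← intervalIntegral.integral_add_adjacent_intervals (b := 1)
      (hsk.intervalIntegrable _ _) (hsk.intervalIntegrable _ _), i1 1 ⟨zero_le_one, le_rfl⟩, i2, i3]
    ring
  have j1 := mul_halfGreen k (2 - x)
  have j2 := mul_halfGreen k x
  have hx1 : 1 - |τ| = x := rfl
  rw [i4] at j1
  rw [i1 x hx] at j2
  have h2x : 2 - x ≠ 0 := by linarith [hx.2]
  rw [eq_div_iff h2x]
  -- x = 0 is a pole, where the identity for W = xF says nothing and F(0) = b is used instead.
  rcases eq_or_ne x 0 with h0 | h0
  · rw [h0] at j1 ⊢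
    rw [hF.apply_zero]
    simp [halfGreen] at j1 ⊢
    linarith
  · have hm := hF.mul_eq hh hx
    rw [profile] at hm
    refine mul_left_cancel₀ h0 ?_
    rw [hm]
    linear_combination x / 2 * j1 + (2 - x) / 2 * j2

/-- The profile of the positive solution of the boundary value problem, of class `C³` up to and
beyond the poles `τ = ±1`. -/
theorem Nonlinearity.exists_profile (P : Nonlinearity) : ∃ f : ℝ → ℝ, ContDiff ℝ 3 f ∧
    (∀ τ ∈ Icc (-1 : ℝ) 1, 0 < f τ) ∧ ∀ τ ∈ Icc (-1 : ℝ) 1,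
      (1 - τ ^ 2) * deriv (deriv f) τ - 4 * τ * deriv f τ - 2 * f τ = -P.N (1 - τ ^ 2) (f τ) := by
  obtain ⟨b, h, F, hh, hFc, hF, hsrc, hb, hpos⟩ := P.exists_half_solution
  set h₀ : ℝ → ℝ := fun τ => h (1 - |τ|) with hh₀
  set I := Icc (-1 : ℝ) 1
  have hx : ∀ τ ∈ I, 1 - |τ| ∈ Icc (0 : ℝ) 1 := fun τ hτ =>
    ⟨by linarith [abs_le.2 hτ], by linarith [abs_nonneg τ]⟩
  have hN : ∀ n : ℕ, n ≤ 2 → ∀ f : ℝ → ℝ, ContDiff ℝ n f →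
      ContDiff ℝ n fun τ => P.N (1 - τ ^ 2) (f τ) := by
    intro n hn f hf
    have h1 : ContDiff ℝ n fun τ : ℝ => (1 - τ ^ 2, f τ) :=
      ContDiff.prodMk (by fun_prop) hf
    exact (P.contDiff_N.of_le (by exact_mod_cast hn)).comp h1
  -- Bootstrap: the reflected source is only continuous, so f₁ is C¹, f₂ is C² and f₃ is C³. All
  -- three agree on [-1, 1], and each is defined on all of ℝ, so derivatives at the poles are
  -- two-sided.
  set f₁ := green h₀ with hf₁
  have hf₁eq : ∀ τ ∈ I, f₁ τ = F (1 - |τ|) / (1 + |τ|) := fun τ hτ =>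
    green_eq_of_half hh hF hb hτ
  have hh₀eq : EqOn (fun τ => P.N (1 - τ ^ 2) (f₁ τ)) h₀ I := by
    intro τ hτ
    simp only [hh₀]
    rw [hf₁eq τ hτ, hsrc _ (hx τ hτ)]
    congr 1
    · rw [← sq_abs τ]; ring
    · congr 1; ring
  have hc₁ : ContDiff ℝ 1 f₁ := contDiff_green 0 (contDiff_zero.2 (by fun_prop))
  set f₂ := green fun τ => P.N (1 - τ ^ 2) (f₁ τ) with hf₂
  have hc₂ : ContDiff ℝ 2 f₂ := contDiff_green 1 (hN 1 (by norm_num) f₁ hc₁)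
  have hf₂eq : EqOn f₂ f₁ I := green_congr hh₀eq
  have hNeq : EqOn (fun τ => P.N (1 - τ ^ 2) (f₂ τ)) (fun τ => P.N (1 - τ ^ 2) (f₁ τ)) I := by
    intro τ hτ
    simp only [hf₂eq hτ]
  set f₃ := green fun τ => P.N (1 - τ ^ 2) (f₂ τ) with hf₃
  have hc₃ : ContDiff ℝ 3 f₃ := contDiff_green 2 (hN 2 le_rfl f₂ hc₂)
  have hf₃eq : EqOn f₃ f₂ I := green_congr hNeq
  refine ⟨f₃, hc₃, fun τ hτ => ?_, fun τ hτ => ?_⟩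
  · rw [hf₃eq hτ, hf₂eq hτ, hf₁eq τ hτ]
    exact div_pos (hpos _ (hx τ hτ)) (by linarith [abs_nonneg τ])
  · rw [hf₃eq hτ, ← hf₃eq hτ, green_ode (hN 2 le_rfl f₂ hc₂).continuous
      (hc₃.of_le (by norm_num)) τ, hf₃eq hτ]

end

section

/-! ### Homogeneous axisymmetric functions -/

/-- The distance to the origin in the meridian half plane. -/
def merR (q : ℝ × ℝ) : ℝ := Real.sqrt (q.1 ^ 2 + q.2 ^ 2)

/-- The function `ρ^(-γ) k(cos θ)` in the meridian half plane. -/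
def homog (γ : ℝ) (k : ℝ → ℝ) (q : ℝ × ℝ) : ℝ := merR q ^ (-γ) * k (q.1 / merR q)

theorem merR_nonneg (q : ℝ × ℝ) : 0 ≤ merR q := Real.sqrt_nonneg _

theorem merR_sq (q : ℝ × ℝ) : merR q ^ 2 = q.1 ^ 2 + q.2 ^ 2 := Real.sq_sqrt (by positivity)

theorem merR_pos {q : ℝ × ℝ} (hq : q ≠ 0) : 0 < merR q := by
  refine Real.sqrt_pos.2 ?_
  rcases ne_or_eq q.1 0 with h | h
  · positivity
  · have : q.2 ≠ 0 := fun h' => hq (Prod.ext h h')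
    positivity

theorem ne_zero_of_snd_pos {q : ℝ × ℝ} (hq : 0 < q.2) : q ≠ 0 := by
  rintro rfl
  exact lt_irrefl _ hq

theorem merR_cyl (x : E3) : merR (x 2, cylR x) = ‖x‖ := by
  rw [merR, ← norm_sq_eq_cyl, Real.sqrt_sq (norm_nonneg x)]

theorem merR_smul {l : ℝ} (hl : 0 < l) (q : ℝ × ℝ) : merR (l • q) = l * merR q := by
  simp only [merR, Prod.smul_fst, Prod.smul_snd, smul_eq_mul]
  rw [show (l * q.1) ^ 2 + (l * q.2) ^ 2 = l ^ 2 * (q.1 ^ 2 + q.2 ^ 2) by ring,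
    Real.sqrt_mul (sq_nonneg l), Real.sqrt_sq hl.le]

theorem homog_smul {l : ℝ} (hl : 0 < l) (γ : ℝ) (k : ℝ → ℝ) (q : ℝ × ℝ) :
    homog γ k (l • q) = l ^ (-γ) * homog γ k q := by
  rw [homog, homog, merR_smul hl, Real.mul_rpow hl.le (merR_nonneg q), Prod.smul_fst, smul_eq_mul,
    mul_div_mul_left _ _ hl.ne']
  ring

theorem cos_mem (q : ℝ × ℝ) : q.1 / merR q ∈ Icc (-1 : ℝ) 1 := by
  have h := merR_sq q
  have h0 := merR_nonneg q
  have h1 : |q.1| ≤ merR q := by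
    rw [← abs_of_nonneg h0, ← sq_le_sq]
    nlinarith [sq_nonneg q.2]
  rw [mem_Icc, ← abs_le, abs_div, abs_of_nonneg h0]
  exact div_le_one_of_le₀ h1 h0

theorem hasFDerivAt_merR {q : ℝ × ℝ} (hq : q ≠ 0) :
    HasFDerivAt merR ((q.1 / merR q) • ContinuousLinearMap.fst ℝ ℝ ℝ
      + (q.2 / merR q) • ContinuousLinearMap.snd ℝ ℝ ℝ) q := by
  have hR := merR_pos hq
  have h0 : q.1 ^ 2 + q.2 ^ 2 ≠ 0 := by rw [← merR_sq]; positivity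
  have h1 : HasFDerivAt (fun p : ℝ × ℝ => p.1) (ContinuousLinearMap.fst ℝ ℝ ℝ) q := hasFDerivAt_fst
  have h2 : HasFDerivAt (fun p : ℝ × ℝ => p.2) (ContinuousLinearMap.snd ℝ ℝ ℝ) q := hasFDerivAt_snd
  have h := ((h1.pow 2).add (h2.pow 2)).sqrt h0
  refine h.congr_fderiv (ContinuousLinearMap.ext fun v => ?_)
  have e : Real.sqrt (q.1 ^ 2 + q.2 ^ 2) = merR q := rfl
  simp only [Pi.add_apply, Nat.cast_ofNat, Nat.add_one_sub_one, pow_one, _root_.smul_apply,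
    _root_.add_apply, smul_eq_mul, nsmul_eq_mul, ContinuousLinearMap.coe_fst',
    ContinuousLinearMap.coe_snd', e]
  field_simp

theorem exists_hasFDerivAt_homog {γ k' : ℝ} {k : ℝ → ℝ} {q : ℝ × ℝ} (hq : q ≠ 0)
    (hk : HasDerivAt k k' (q.1 / merR q)) :
    ∃ L : ℝ × ℝ →L[ℝ] ℝ, HasFDerivAt (homog γ k) L q ∧
      L (1, 0) = merR q ^ (-γ) / merR q *
        (-γ * (q.1 / merR q) * k (q.1 / merR q) + (1 - (q.1 / merR q) ^ 2) * k') ∧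
      L (0, 1) = merR q ^ (-γ) / merR q * (q.2 / merR q) *
        (-γ * k (q.1 / merR q) - q.1 / merR q * k') := by
  have hR := merR_pos hq
  have hR' := hasFDerivAt_merR hq
  have h1 : HasFDerivAt (fun p : ℝ × ℝ => p.1) (ContinuousLinearMap.fst ℝ ℝ ℝ) q := hasFDerivAt_fst
  have hpow := (Real.hasDerivAt_rpow_const (p := -γ) (Or.inl hR.ne')).comp_hasFDerivAt q hR'
  have hinv := (hasDerivAt_inv hR.ne').comp_hasFDerivAt q hR'
  have hT : HasFDerivAt (fun p : ℝ × ℝ => p.1 / merR p) _ q := h1.mul hinv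
  have hkT := hk.comp_hasFDerivAt q hT
  have hmul := hpow.mul hkT
  refine ⟨_, hmul, ?_, ?_⟩
  · simp only [_root_.add_apply, _root_.smul_apply, smul_eq_mul, ContinuousLinearMap.coe_fst',
      ContinuousLinearMap.coe_snd', Function.comp_apply, Real.rpow_sub_one hR.ne']
    field_simp
    ring
  · simp only [_root_.add_apply, _root_.smul_apply, smul_eq_mul, ContinuousLinearMap.coe_fst',
      ContinuousLinearMap.coe_snd', Function.comp_apply, Real.rpow_sub_one hR.ne']
    field_simp
    ring

theorem contDiffOn_merR {n : WithTop ℕ∞} : ContDiffOn ℝ n merR {0}ᶜ := by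
  intro q hq
  have h0 : q.1 ^ 2 + q.2 ^ 2 ≠ 0 := by
    rw [← merR_sq]
    exact (pow_pos (merR_pos hq) 2).ne'
  exact (ContDiffAt.sqrt (f := fun q : ℝ × ℝ => q.1 ^ 2 + q.2 ^ 2) (by fun_prop)
    h0).contDiffWithinAt

theorem contDiffOn_homog {n : WithTop ℕ∞} (γ : ℝ) {k : ℝ → ℝ} (hk : ContDiff ℝ n k) :
    ContDiffOn ℝ n (homog γ k) {0}ᶜ := by
  have h0 : ∀ q ∈ ({0}ᶜ : Set (ℝ × ℝ)), merR q ≠ 0 := fun q hq => (merR_pos hq).ne'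
  exact (contDiffOn_merR.rpow_const_of_ne h0).mul
    (hk.comp_contDiffOn (contDiff_fst.contDiffOn.div contDiffOn_merR h0))

/-- Regularity across the axis: although r is not smooth there, only ρ = ‖x‖ and x₂/‖x‖ enter, and
both are smooth off the origin. -/
theorem contDiffOn_homog_cyl {n : WithTop ℕ∞} (γ : ℝ) {k : ℝ → ℝ} (hk : ContDiff ℝ n k) :
    ContDiffOn ℝ n (fun x : E3 => homog γ k (x 2, cylR x)) {0}ᶜ := by
  have h1 : ContDiffOn ℝ n (fun x : E3 => ‖x‖) {0}ᶜ := fun x hx =>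
    (contDiffAt_norm ℝ hx).contDiffWithinAt
  have h0 : ∀ x ∈ ({0}ᶜ : Set E3), ‖x‖ ≠ 0 := fun x hx => norm_ne_zero_iff.2 hx
  have h2 : ContDiffOn ℝ n (fun x : E3 => x 2) {0}ᶜ := ContDiff.contDiffOn (by fun_prop)
  have h3 := (h1.rpow_const_of_ne (p := -γ) h0).mul (hk.comp_contDiffOn (h2.div h1 h0))
  refine h3.congr fun x _ => ?_
  simp only [homog, merR_cyl, Pi.div_apply, Function.comp_apply]

end

section

/-! ### Construction of the solutions from a profile -/

variable {x : E3}

theorem azimuthal_eq_smul_gradAngle (x : E3) : azimuthal x = cylR x ^ 2 • gradAngle x := by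
  rcases (cylR_nonneg x).eq_or_lt with h | h
  -- On the axis `gradAngle` is zero by division by zero, and so is the azimuthal field.
  · have h0 := cylR_eq_zero.1 h.symm
    ext i
    fin_cases i <;> simp [azimuthal, gradAngle, h0]
  · ext i
    fin_cases i
    · simp [azimuthal, gradAngle]
      field_simp
    · simp [azimuthal, gradAngle]
      field_simp
    · simp [azimuthal, gradAngle]

theorem toroidal_axisField (a b c : ℝ × ℝ → ℝ) :
    toroidal (axisField a b c) x = b (x 2, cylR x) • azimuthal x := by
  rw [azimuthal_eq_smul_gradAngle, smul_smul, toroidal]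
  congr 1
  rw [cylR_sq]
  simp [axisField]
  ring

theorem poloidal_axisField (a b c : ℝ × ℝ → ℝ) :
    poloidal (axisField a b c) x = axisField a 0 c x := by
  rw [poloidal, toroidal_axisField]
  ext i
  fin_cases i
  · simp [axisField, azimuthal]
    ring
  · simp [axisField, azimuthal]
    ring
  · simp [axisField, azimuthal]

theorem rotZ_apply_two (ϑ : ℝ) (x : E3) : rotZ ϑ x 2 = x 2 := by simp [rotZ]

theorem cylR_rotZ (ϑ : ℝ) (x : E3) : cylR (rotZ ϑ x) = cylR x := by
  rw [rotZ, cylR_vec, cylR]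
  congr 1
  linear_combination (x 0 ^ 2 + x 1 ^ 2) * Real.sin_sq_add_cos_sq ϑ

theorem norm_rotZ (ϑ : ℝ) (x : E3) : ‖rotZ ϑ x‖ = ‖x‖ := by
  rw [← merR_cyl, ← merR_cyl, rotZ_apply_two, cylR_rotZ]

theorem axisField_rotZ (a b c : ℝ × ℝ → ℝ) (ϑ : ℝ) :
    axisField a b c (rotZ ϑ x) = rotZ ϑ (axisField a b c x) := by
  unfold axisField
  rw [cylR_rotZ, rotZ_apply_two]
  ext i
  fin_cases i
  · simp [rotZ]
    ring
  · simp [rotZ]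
    ring
  · simp [rotZ]

theorem norm_sq_axisField (a b c : ℝ × ℝ → ℝ) : ‖axisField a b c x‖ ^ 2 =
    (x 0 ^ 2 + x 1 ^ 2) * (a (x 2, cylR x) ^ 2 + b (x 2, cylR x) ^ 2) + c (x 2, cylR x) ^ 2 := by
  rw [EuclideanSpace.real_norm_sq_eq, Fin.sum_univ_three]
  simp [axisField]
  ring

theorem contDiffOn_axisField {n : WithTop ℕ∞} {a b c : ℝ × ℝ → ℝ} {s : Set E3}
    (ha : ContDiffOn ℝ n (fun x : E3 => a (x 2, cylR x)) s)
    (hb : ContDiffOn ℝ n (fun x : E3 => b (x 2, cylR x)) s)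
    (hc : ContDiffOn ℝ n (fun x : E3 => c (x 2, cylR x)) s) :
    ContDiffOn ℝ n (axisField a b c) s := by
  have hcoord : ∀ i : Fin 3, ContDiffOn ℝ n (fun x : E3 => x i) s := fun i =>
    ContDiff.contDiffOn (by fun_prop)
  rw [contDiffOn_euclidean]
  intro i
  fin_cases i
  · exact ((hcoord 0).mul ha).sub ((hcoord 1).mul hb)
  · exact ((hcoord 1).mul ha).add ((hcoord 0).mul hb)
  · exact hc

/-- The stream function `ψ = r² ρ^(-α) f(cos θ)`. -/
def profileStream (α : ℝ) (f : ℝ → ℝ) (z r : ℝ) : ℝ := r ^ 2 * homog α f (z, r)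

/-- The angular profile of `u^r / r`. -/
def radialProfile (α : ℝ) (f : ℝ → ℝ) (τ : ℝ) : ℝ := α * τ * f τ - (1 - τ ^ 2) * deriv f τ

/-- The angular profile of `u^z`. -/
def axialProfile (α : ℝ) (f : ℝ → ℝ) (τ : ℝ) : ℝ :=
  2 * f τ + (1 - τ ^ 2) * (-α * f τ - τ * deriv f τ)

/-- The coefficient `u^φ / r = Γ / r²`. -/
def swirlCoeff (α C₂ : ℝ) (f : ℝ → ℝ) (q : ℝ × ℝ) : ℝ :=
  C₂ * homog α f q * profileStream α f q.1 q.2 ^ (1 / (α - 2))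

/-- The velocity field with stream function `profileStream α f`. -/
def profileField (α C₂ : ℝ) (f : ℝ → ℝ) : E3 → E3 :=
  axisField (homog (α + 1) (radialProfile α f)) (swirlCoeff α C₂ f) (homog α (axialProfile α f))

/-- The pressure belonging to `profileField α C₂ f`. -/
def profilePressure (α C₁ C₂ : ℝ) (f : ℝ → ℝ) (x : E3) : ℝ :=
  C₁ * profileStream α f (x 2) (cylR x) ^ (2 + 4 / (α - 2)) - ‖profileField α C₂ f x‖ ^ 2 / 2

theorem bernoulli_profile (α C₁ C₂ : ℝ) (f : ℝ → ℝ) (x : E3) :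
    bernoulli (profileField α C₂ f) (profilePressure α C₁ C₂ f) x
      = C₁ * profileStream α f (x 2) (cylR x) ^ (2 + 4 / (α - 2)) := by
  rw [bernoulli, profilePressure]
  ring

section Profile

variable {α C₁ C₂ : ℝ} {f : ℝ → ℝ}

theorem homog_pos (hpos : ∀ τ ∈ Icc (-1 : ℝ) 1, 0 < f τ) {q : ℝ × ℝ} (hq : q ≠ 0) (γ : ℝ) :
    0 < homog γ f q :=
  mul_pos (Real.rpow_pos_of_pos (merR_pos hq) _) (hpos _ (cos_mem q))

theorem profileStream_pos (hpos : ∀ τ ∈ Icc (-1 : ℝ) 1, 0 < f τ) {z r : ℝ} (hr : 0 < r) :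
    0 < profileStream α f z r :=
  mul_pos (pow_pos hr 2) (homog_pos hpos (ne_zero_of_snd_pos (q := (z, r)) hr) α)

theorem profileStream_nonneg (hpos : ∀ τ ∈ Icc (-1 : ℝ) 1, 0 < f τ) (hx : x ≠ 0) :
    0 ≤ profileStream α f (x 2) (cylR x) :=
  mul_nonneg (sq_nonneg _) (homog_pos hpos (cyl_mem_iff.2 hx) α).le

theorem profileStream_smul {l z r : ℝ} (hl : 0 < l) :
    profileStream α f (l * z) (l * r) = l ^ (-(α - 2)) * profileStream α f z r := by
  have h := homog_smul hl α f (z, r)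
  rw [Prod.smul_mk, smul_eq_mul, smul_eq_mul] at h
  rw [profileStream, profileStream, h, show -(α - 2) = -α + (2 : ℕ) by push_cast; ring,
    Real.rpow_add_natCast hl.ne']
  ring

theorem contDiffOn_profileStream (hf : ContDiff ℝ 3 f) :
    ContDiffOn ℝ 3 (fun q : ℝ × ℝ => profileStream α f q.1 q.2) {0}ᶜ :=
  (ContDiff.contDiffOn (by fun_prop)).mul (contDiffOn_homog α hf)

theorem contDiffOn_profileStream_cyl (hf : ContDiff ℝ 3 f) :
    ContDiffOn ℝ 3 (fun x : E3 => profileStream α f (x 2) (cylR x)) {0}ᶜ := by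
  have h1 : ContDiffOn ℝ 3 (fun x : E3 => x 0 ^ 2 + x 1 ^ 2) {0}ᶜ :=
    ContDiff.contDiffOn (by fun_prop)
  refine (h1.mul (contDiffOn_homog_cyl α hf)).congr fun x _ => ?_
  simp only [profileStream, cylR_sq]

theorem contDiff_deriv_of_three (hf : ContDiff ℝ 3 f) : ContDiff ℝ 2 (deriv f) :=
  ((contDiff_succ_iff_deriv (n := 2)).1 hf).2.2

theorem contDiff_radialProfile (hf : ContDiff ℝ 3 f) : ContDiff ℝ 2 (radialProfile α f) := by
  have h1 := contDiff_deriv_of_three hf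
  have h2 : ContDiff ℝ 2 f := hf.of_le (by norm_num)
  unfold radialProfile
  fun_prop

theorem contDiff_axialProfile (hf : ContDiff ℝ 3 f) : ContDiff ℝ 2 (axialProfile α f) := by
  have h1 := contDiff_deriv_of_three hf
  have h2 : ContDiff ℝ 2 f := hf.of_le (by norm_num)
  unfold axialProfile
  fun_prop

theorem hasDerivAt_profiles (hf : ContDiff ℝ 3 f) (τ : ℝ) :
    HasDerivAt (radialProfile α f) (α * f τ + α * τ * deriv f τ + 2 * τ * deriv f τ
      - (1 - τ ^ 2) * deriv (deriv f) τ) τ ∧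
    HasDerivAt (axialProfile α f) (2 * deriv f τ - 2 * τ * (-α * f τ - τ * deriv f τ)
      + (1 - τ ^ 2) * (-α * deriv f τ - deriv f τ - τ * deriv (deriv f) τ)) τ := by
  have h0 : HasDerivAt f (deriv f τ) τ := (hf.differentiable (by norm_num) τ).hasDerivAt
  have h1 : HasDerivAt (deriv f) (deriv (deriv f) τ) τ :=
    ((contDiff_deriv_of_three hf).differentiable two_ne_zero τ).hasDerivAt
  have hp : HasDerivAt (fun τ : ℝ => 1 - τ ^ 2) (-(2 * τ)) τ := by
    simpa using (hasDerivAt_pow 2 τ).const_sub 1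
  have hid := hasDerivAt_id τ
  constructor
  · refine (((hid.const_mul α).fun_mul h0).fun_sub (hp.fun_mul h1)).congr_deriv ?_
    simp only [id]
    ring
  · refine ((h0.const_mul 2).fun_add (hp.fun_mul
      ((h0.const_mul (-α)).fun_sub (hid.fun_mul h1)))).congr_deriv ?_
    simp only [id]
    ring

/-- The pointwise data of the construction in the meridian half plane. -/
theorem exists_profile_derivatives (hf : ContDiff ℝ 3 f) {q : ℝ × ℝ} (hq : 0 < q.2) :
    ∃ ψ' a' c' : ℝ × ℝ →L[ℝ] ℝ,
      HasFDerivAt (fun q : ℝ × ℝ => profileStream α f q.1 q.2) ψ' q ∧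
      HasFDerivAt (homog (α + 1) (radialProfile α f)) a' q ∧
      HasFDerivAt (homog α (axialProfile α f)) c' q ∧
      homog (α + 1) (radialProfile α f) q = -ψ' (1, 0) / q.2 ^ 2 ∧
      homog α (axialProfile α f) q = ψ' (0, 1) / q.2 ∧
      2 * homog (α + 1) (radialProfile α f) q + q.2 * a' (0, 1) + c' (1, 0) = 0 ∧
      a' (1, 0) - c' (0, 1) / q.2 = -merR q ^ (-α) / merR q ^ 2 *
        ((1 - (q.1 / merR q) ^ 2) * deriv (deriv f) (q.1 / merR q)
          - 4 * (q.1 / merR q) * deriv f (q.1 / merR q)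
          - 2 * f (q.1 / merR q) + (α - 2) * (α - 1) * f (q.1 / merR q)) := by
  have hq0 := ne_zero_of_snd_pos hq
  have hR := merR_pos hq0
  have hsq := merR_sq q
  have h0 : HasDerivAt f (deriv f (q.1 / merR q)) (q.1 / merR q) :=
    (hf.differentiable (by norm_num) _).hasDerivAt
  obtain ⟨hr, hax⟩ := hasDerivAt_profiles (α := α) hf (q.1 / merR q)
  obtain ⟨F', hF, hFz, hFr⟩ := exists_hasFDerivAt_homog (γ := α) hq0 h0
  obtain ⟨a', ha, haz, har⟩ := exists_hasFDerivAt_homog (γ := α + 1) hq0 hr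
  obtain ⟨c', hc, hcz, hcr⟩ := exists_hasFDerivAt_homog (γ := α) hq0 hax
  have h2 : HasFDerivAt (fun p : ℝ × ℝ => p.2) (ContinuousLinearMap.snd ℝ ℝ ℝ) q := hasFDerivAt_snd
  have hψ : HasFDerivAt (fun q : ℝ × ℝ => profileStream α f q.1 q.2) _ q := (h2.pow 2).mul hF
  refine ⟨_, a', c', hψ, ha, hc, ?_, ?_, ?_, ?_⟩
  all_goals
    simp only [_root_.add_apply, _root_.smul_apply, smul_eq_mul, ContinuousLinearMap.coe_snd',
      hFz, hFr, haz, har, hcz, hcr, homog, radialProfile, axialProfile, neg_add,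
      Real.rpow_add hR, Real.rpow_neg_one, nsmul_eq_mul]
    -- With τ = z/ρ and r² = ρ²(1 - τ²), all four claims become rational identities in ρ, r, τ and
    -- the values of f and its derivatives.
    generalize hτ : q.1 / merR q = τ
    rw [div_eq_iff hR.ne'] at hτ
    have hq2 : q.2 ^ 2 = merR q ^ 2 * (1 - τ ^ 2) := by
      rw [hτ] at hsq
      linear_combination -hsq
    generalize merR q ^ (-α) = E
    generalize merR q = ρ at *
    generalize q.2 = r at *
    generalize f τ = f₀
    generalize deriv f τ = f₁
    generalize deriv (deriv f) τ = f₂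
  · have : 1 - τ ^ 2 ≠ 0 := by
      intro h
      rw [h, mul_zero] at hq2
      exact (pow_pos hq 2).ne' hq2
    simp
    field_simp
    ring
  · simp
    field_simp
    rw [hq2]
    field_simp
    ring
  · field_simp
    rw [hq2]
    field_simp
    ring
  · field_simp
    ring

end Profile

end

/-! ### The constructed fields solve the Euler equations. -/

section

variable {x : E3} {α C₁ C₂ : ℝ} {f : ℝ → ℝ}

/-- The nonlinearity of the profile equation. -/
def clebschNonlinearity (α C₁ C₂ : ℝ) (hα : 2 < α) (hα3 : α < 3) (hC₁ : C₁ ≤ 0)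
    (hC : C₁ ≠ 0 ∨ C₂ ≠ 0) : Nonlinearity where
  κ := (α - 2) * (α - 1)
  c₁ := -C₁ * (2 + 4 / (α - 2))
  c₂ := C₂ ^ 2 * (1 + 1 / (α - 2))
  m := 4 / (α - 2)
  q := 2 / (α - 2)
  κ_nonneg := mul_nonneg (by linarith) (by linarith)
  -- (α - 2)(α - 1) - 2 = α(α - 3) < 0.
  κ_lt := by nlinarith
  c₁_nonneg := by
    have := sub_pos.2 hα
    exact mul_nonneg (neg_nonneg.2 hC₁) (by positivity)
  c₂_nonneg := by
    have := sub_pos.2 hα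
    positivity
  c_ne := by
    have := sub_pos.2 hα
    refine hC.imp (fun h => ?_) fun h => ?_
    · have h1 : 2 + 4 / (α - 2) ≠ 0 := by positivity
      exact mul_ne_zero (neg_ne_zero.2 h) h1
    · positivity
  m_gt := by
    rw [lt_div_iff₀ (sub_pos.2 hα)]
    linarith
  -- Equivalent to β < 1, that is, to α < 3.
  q_gt := by
    rw [lt_div_iff₀ (sub_pos.2 hα)]
    linarith

/-- A positive solution of the profile equation. -/
structure IsProfile (α C₁ C₂ : ℝ) (f : ℝ → ℝ) : Prop where
  smooth : ContDiff ℝ 3 f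
  pos : ∀ τ ∈ Icc (-1 : ℝ) 1, 0 < f τ
  ode : ∀ τ ∈ Icc (-1 : ℝ) 1,
    (1 - τ ^ 2) * deriv (deriv f) τ - 4 * τ * deriv f τ - 2 * f τ + (α - 2) * (α - 1) * f τ =
      -(-C₁ * (2 + 4 / (α - 2)) * ((1 - τ ^ 2) * f τ) ^ (1 + 4 / (α - 2))
        + C₂ ^ 2 * (1 + 1 / (α - 2)) *
          ((1 - τ ^ 2) ^ (2 / (α - 2)) * f τ ^ (1 + 2 / (α - 2))))

theorem exists_isProfile (hα : 2 < α) (hα3 : α < 3) (hC₁ : C₁ ≤ 0) (hC : C₁ ≠ 0 ∨ C₂ ≠ 0) :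
    ∃ f, IsProfile α C₁ C₂ f := by
  obtain ⟨f, h1, h2, h3⟩ := (clebschNonlinearity α C₁ C₂ hα hα3 hC₁ hC).exists_profile
  refine ⟨f, h1, h2, fun τ hτ => ?_⟩
  rw [h3 τ hτ]
  simp only [Nonlinearity.N, clebschNonlinearity]
  ring

/-- One factor ψ = r² `homog α f` of Γ absorbs the division by r², so `swirlCoeff` is a form of Γ/r²
without a singularity at the axis. -/
theorem swirlCoeff_eq (hpos : ∀ τ ∈ Icc (-1 : ℝ) 1, 0 < f τ) {q : ℝ × ℝ} (hq : 0 < q.2) :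
    swirlCoeff α C₂ f q = clebschFactor C₂ (α - 2) (profileStream α f q.1 q.2) / q.2 ^ 2 := by
  rw [clebschFactor, abs_of_pos (profileStream_pos hpos hq), swirlCoeff]
  have : profileStream α f q.1 q.2 = q.2 ^ 2 * homog α f q := rfl
  rw [eq_div_iff (pow_pos hq 2).ne', mul_assoc C₂ (profileStream _ _ _ _), this]
  ring

theorem profileStream_eq {q : ℝ × ℝ} (hq : q ≠ 0) :
    profileStream α f q.1 q.2
      = merR q ^ (-(α - 2)) * ((1 - (q.1 / merR q) ^ 2) * f (q.1 / merR q)) := by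
  have hR := merR_pos hq
  have hsq := merR_sq q
  rw [profileStream, homog, show -(α - 2) = -α + (2 : ℕ) by push_cast; ring,
    Real.rpow_add_natCast hR.ne']
  have : q.2 ^ 2 = merR q ^ 2 * (1 - (q.1 / merR q) ^ 2) := by
    field_simp
    linarith
  rw [this]
  ring

/-- Explains the Clebsch exponents: for n = 2 (the term ΓΓ') and n = 4 (the term Π') the powers of ρ
become ρ^(-β-2) and ρ^(-β-4), so ρ cancels from the equation and an ODE in τ remains. -/
theorem rpow_balance {ρ β y : ℝ} (hρ : 0 < ρ) (hβ : 0 < β) (hy : 0 ≤ y) (n : ℕ) :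
    (ρ ^ (-β) * y) ^ (1 + n / β) = ρ ^ (-β) / ρ ^ n * y ^ (1 + n / β) := by
  rw [Real.mul_rpow (Real.rpow_nonneg hρ.le _) hy, ← Real.rpow_mul hρ.le,
    show -β * (1 + n / β) = -β - n by field_simp; ring, Real.rpow_sub_natCast hρ.ne']

/-- The Grad–Shafranov equation for the constructed stream function. -/
theorem IsProfile.balance (h : IsProfile α C₁ C₂ f) (hα : 2 < α) {q : ℝ × ℝ} (hq : 0 < q.2) :
    -merR q ^ (-α) / merR q ^ 2 *
        ((1 - (q.1 / merR q) ^ 2) * deriv (deriv f) (q.1 / merR q)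
          - 4 * (q.1 / merR q) * deriv f (q.1 / merR q)
          - 2 * f (q.1 / merR q) + (α - 2) * (α - 1) * f (q.1 / merR q))
      - C₂ * (1 + 1 / (α - 2)) * profileStream α f q.1 q.2 ^ (1 / (α - 2))
        * (clebschFactor C₂ (α - 2) (profileStream α f q.1 q.2) / q.2 ^ 2)
      = -(C₁ * (2 + 4 / (α - 2)) * profileStream α f q.1 q.2 ^ (1 + 4 / (α - 2))) := by
  have hq0 := ne_zero_of_snd_pos hq
  have hβ : 0 < α - 2 := sub_pos.2 hα
  have hR := merR_pos hq0
  have hψ := profileStream_pos (α := α) h.pos hq (z := q.1)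
  have hf := h.pos _ (cos_mem q)
  have hv : 0 < 1 - (q.1 / merR q) ^ 2 := by
    have h1 := merR_sq q
    rw [div_pow, sub_pos, div_lt_one (by positivity)]
    nlinarith
  have hq2 : q.2 ^ 2 = merR q ^ 2 * (1 - (q.1 / merR q) ^ 2) := by
    have h1 := merR_sq q
    field_simp
    linarith
  rw [h.ode _ (cos_mem q)]
  have e1 : profileStream α f q.1 q.2 ^ (1 / (α - 2))
      * clebschFactor C₂ (α - 2) (profileStream α f q.1 q.2)
      = C₂ * profileStream α f q.1 q.2 ^ (1 + 2 / (α - 2)) := by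
    rw [clebschFactor, abs_of_pos hψ,
      show (1 + 2 / (α - 2)) = 1 / (α - 2) + (1 + 1 / (α - 2)) by ring, Real.rpow_add hψ,
      Real.rpow_add hψ, Real.rpow_one]
    ring
  have e2 : C₂ * (1 + 1 / (α - 2)) * profileStream α f q.1 q.2 ^ (1 / (α - 2))
        * (clebschFactor C₂ (α - 2) (profileStream α f q.1 q.2) / q.2 ^ 2)
      = C₂ ^ 2 * (1 + 1 / (α - 2)) * (profileStream α f q.1 q.2 ^ (1 + 2 / (α - 2)) / q.2 ^ 2) := by
    rw [mul_div_assoc', mul_assoc (C₂ * (1 + 1 / (α - 2))), e1]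
    ring
  rw [e2, profileStream_eq hq0]
  have b2 := rpow_balance hR hβ (mul_pos hv hf).le 2
  have b4 := rpow_balance hR hβ (mul_pos hv hf).le 4
  push_cast at b2 b4
  rw [b2, b4, hq2]
  have hvf : ((1 - (q.1 / merR q) ^ 2) * f (q.1 / merR q)) ^ (1 + 2 / (α - 2))
      = (1 - (q.1 / merR q) ^ 2) * ((1 - (q.1 / merR q) ^ 2) ^ (2 / (α - 2))
        * f (q.1 / merR q) ^ (1 + 2 / (α - 2))) := by
    rw [Real.mul_rpow hv.le hf.le, Real.rpow_add hv, Real.rpow_one, mul_assoc]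
  have hE : merR q ^ (-(α - 2)) = merR q ^ (-α) * merR q ^ 2 := by
    rw [show -(α - 2) = -α + (2 : ℕ) by push_cast; ring, Real.rpow_add_natCast hR.ne']
  rw [hvf, hE]
  generalize ((1 - (q.1 / merR q) ^ 2) * f (q.1 / merR q)) ^ (1 + 4 / (α - 2)) = Y₁
  generalize (1 - (q.1 / merR q) ^ 2) ^ (2 / (α - 2))
        * f (q.1 / merR q) ^ (1 + 2 / (α - 2)) = Y₂
  generalize merR q ^ (-α) = E
  generalize 2 + 4 / (α - 2) = k₁
  generalize 1 + 1 / (α - 2) = k₂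
  generalize 1 - (q.1 / merR q) ^ 2 = v at hv
  field_simp
  ring

theorem profileField_eq (hpos : ∀ τ ∈ Icc (-1 : ℝ) 1, 0 < f τ) (hx : 0 < cylR x) :
    profileField α C₂ f x = axisField (homog (α + 1) (radialProfile α f))
      (fun q => clebschFactor C₂ (α - 2) (profileStream α f q.1 q.2) / q.2 ^ 2)
      (homog α (axialProfile α f)) x := by
  simp only [profileField, axisField, swirlCoeff_eq hpos (q := (x 2, cylR x)) hx]

theorem profileField_eventuallyEq (hpos : ∀ τ ∈ Icc (-1 : ℝ) 1, 0 < f τ) (hx : 0 < cylR x) :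
    profileField α C₂ f =ᶠ[𝓝 x] axisField (homog (α + 1) (radialProfile α f))
      (fun q => clebschFactor C₂ (α - 2) (profileStream α f q.1 q.2) / q.2 ^ 2)
      (homog α (axialProfile α f)) := by
  filter_upwards [isOpen_offAxis.mem_nhds hx] with y hy using profileField_eq hpos hy

/-- By `IsProfile.balance` the azimuthal coefficient is exactly -Π'(ψ), which is what cancels ∇Π in
the Lamb form. -/
theorem IsProfile.curl_eq (h : IsProfile α C₁ C₂ f) (hα : 2 < α) (hx : 0 < cylR x) :
    curl (profileField α C₂ f) x =
      (C₂ * (1 + 1 / (α - 2)) * profileStream α f (x 2) (cylR x) ^ (1 / (α - 2)))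
          • profileField α C₂ f x
        + (-(C₁ * (2 + 4 / (α - 2)) * profileStream α f (x 2) (cylR x) ^ (1 + 4 / (α - 2))))
          • azimuthal x := by
  obtain ⟨ψ', a', c', hψ, ha, hc, haψ, hcψ, -, hgs⟩ :=
    exists_profile_derivatives (α := α) h.smooth (q := (x 2, cylR x)) hx
  rw [IsDipoleSolution.curl_congr (profileField_eventuallyEq h.pos hx),
    curl_clebsch hx hψ (hasDerivAt_clebschFactor (profileStream_pos h.pos hx)) ha hc haψ hcψ, hgs,
    profileField_eq h.pos hx]
  congr 2
  exact h.balance hα (q := (x 2, cylR x)) hx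

theorem IsProfile.contDiffOn_coeff (h : IsProfile α C₁ C₂ f) :
    ContDiffOn ℝ 2 (fun x : E3 => homog (α + 1) (radialProfile α f) (x 2, cylR x)) {0}ᶜ ∧
    ContDiffOn ℝ 2 (fun x : E3 => homog α (axialProfile α f) (x 2, cylR x)) {0}ᶜ :=
  ⟨contDiffOn_homog_cyl _ (contDiff_radialProfile h.smooth),
    contDiffOn_homog_cyl _ (contDiff_axialProfile h.smooth)⟩

/-- ψ vanishes on the axis, so its power is C¹ there because 1/β ≥ 1, which holds as α < 3. -/
theorem IsProfile.contDiffOn_swirl (h : IsProfile α C₁ C₂ f) (hα : 2 < α) (hα3 : α < 3) :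
    ContDiffOn ℝ 1 (fun x : E3 => swirlCoeff α C₂ f (x 2, cylR x)) {0}ᶜ := by
  have h1 : ContDiffOn ℝ 1 (fun x : E3 => homog α f (x 2, cylR x)) {0}ᶜ :=
    (contDiffOn_homog_cyl α h.smooth).of_le (by norm_num)
  have h2 : ContDiffOn ℝ 1 (fun x : E3 => profileStream α f (x 2) (cylR x)) {0}ᶜ :=
    (contDiffOn_profileStream_cyl h.smooth).of_le (by norm_num)
  have h3 := h2.rpow_const_of_le (m := 1) (p := 1 / (α - 2)) (by
    rw [le_div_iff₀ (sub_pos.2 hα)]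
    push_cast
    linarith)
  exact (contDiffOn_const.mul h1).mul h3

theorem IsProfile.contDiffOn_field (h : IsProfile α C₁ C₂ f) (hα : 2 < α) (hα3 : α < 3) :
    ContDiffOn ℝ 1 (profileField α C₂ f) {0}ᶜ :=
  contDiffOn_axisField (h.contDiffOn_coeff.1.of_le one_le_two) (h.contDiffOn_swirl hα hα3)
    (h.contDiffOn_coeff.2.of_le one_le_two)

theorem IsProfile.contDiffOn_pressure (h : IsProfile α C₁ C₂ f) (hα : 2 < α) (hα3 : α < 3) :
    ContDiffOn ℝ 2 (profilePressure α C₁ C₂ f) {0}ᶜ := by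
  have hβ := sub_pos.2 hα
  obtain ⟨ha, hc⟩ := h.contDiffOn_coeff
  have hη : ContDiffOn ℝ 2 (fun x : E3 => homog α f (x 2, cylR x)) {0}ᶜ :=
    (contDiffOn_homog_cyl α h.smooth).of_le (by norm_num)
  have hψ : ContDiffOn ℝ 2 (fun x : E3 => profileStream α f (x 2) (cylR x)) {0}ᶜ :=
    (contDiffOn_profileStream_cyl h.smooth).of_le (by norm_num)
  have h1 := hψ.rpow_const_of_le (m := 2) (p := 2 + 4 / (α - 2)) (by
    have : 0 < 4 / (α - 2) := by positivity
    push_cast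
    linarith)
  have h2 := hψ.rpow_const_of_le (m := 2) (p := 2 / (α - 2)) (by
    rw [le_div_iff₀ hβ]
    push_cast
    linarith)
  have h3 : ContDiffOn ℝ 2 (fun x : E3 => x 0 ^ 2 + x 1 ^ 2) {0}ᶜ :=
    ContDiff.contDiffOn (by fun_prop)
  have h4 : ContDiffOn ℝ 2 (fun x : E3 => (C₂ * homog α f (x 2, cylR x)) ^ 2
      * profileStream α f (x 2) (cylR x) ^ (2 / (α - 2))) {0}ᶜ :=
    ((contDiffOn_const.mul hη).pow 2).mul h2
  have h5 := (contDiffOn_const (c := C₁)).mul h1 |>.sub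
    (((h3.mul ((ha.pow 2).add h4)).add (hc.pow 2)).div_const 2)
  refine h5.congr fun x hx => ?_
  have hnn := profileStream_nonneg (α := α) h.pos hx
  -- The swirl is only shown to be C¹, but the pressure contains its square, in which ψ has exponent
  -- 2/β ≥ 2; so the pressure is C².
  have e : swirlCoeff α C₂ f (x 2, cylR x) ^ 2 = (C₂ * homog α f (x 2, cylR x)) ^ 2
      * profileStream α f (x 2) (cylR x) ^ (2 / (α - 2)) := by
    rw [swirlCoeff, mul_pow, ← Real.rpow_natCast (_ ^ (1 / (α - 2))), ← Real.rpow_mul hnn]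
    congr 2
    push_cast
    ring
  rw [profilePressure, profileField, norm_sq_axisField, e]

theorem gradient_bernoulli_profile (h : IsProfile α C₁ C₂ f) (hx : 0 < cylR x) :
    gradient (bernoulli (profileField α C₂ f) (profilePressure α C₁ C₂ f)) x =
      (C₁ * (2 + 4 / (α - 2)) * profileStream α f (x 2) (cylR x) ^ (1 + 4 / (α - 2))) •
        !₂[x 0 * homog α (axialProfile α f) (x 2, cylR x),
          x 1 * homog α (axialProfile α f) (x 2, cylR x),
          -(x 0 ^ 2 + x 1 ^ 2) * homog (α + 1) (radialProfile α f) (x 2, cylR x)] := by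
  obtain ⟨ψ', a', c', hψ, ha, hc, haψ, hcψ, -, -⟩ :=
    exists_profile_derivatives (α := α) h.smooth (q := (x 2, cylR x)) hx
  have e : bernoulli (profileField α C₂ f) (profilePressure α C₁ C₂ f) = fun y : E3 =>
      (fun q : ℝ × ℝ => C₁ * profileStream α f q.1 q.2 ^ (2 + 4 / (α - 2))) (y 2, cylR y) :=
    funext fun y => bernoulli_profile α C₁ C₂ f y
  have hpos := profileStream_pos (α := α) h.pos hx (z := x 2)
  have h1 := ((Real.hasDerivAt_rpow_const (p := 2 + 4 / (α - 2))
    (Or.inl hpos.ne')).const_mul C₁).comp_hasFDerivAt (x 2, cylR x) hψ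
  have h2 := hasFDerivAt_comp_cyl hx h1
  have hexp : 2 + 4 / (α - 2) - 1 = 1 + 4 / (α - 2) := by ring
  rw [hexp] at h2
  have h3 : ∀ v, fderiv ℝ (bernoulli (profileField α C₂ f) (profilePressure α C₁ C₂ f)) x v =
      C₁ * ((2 + 4 / (α - 2)) * profileStream α f (x 2) (cylR x) ^ (1 + 4 / (α - 2))) *
        (ψ' (1, 0) * v 2 + ψ' (0, 1) * (x 0 / cylR x * v 0 + x 1 / cylR x * v 1)) := fun v => by
    rw [e]
    refine (congrArg (fun L : E3 →L[ℝ] ℝ => L v) h2.fderiv).trans ?_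
    simp
    ring
  have hr := cylR_sq x
  ext i
  rw [gradient_apply, h3, haψ, hcψ]
  fin_cases i
  · simp
    ring
  · simp
    ring
  · simp
    rw [show -x 1 ^ 2 + -x 0 ^ 2 = -cylR x ^ 2 by rw [hr]; ring]
    field_simp

theorem continuousOn_div {u : E3 → E3} (hu : ContDiffOn ℝ 1 u {0}ᶜ) :
    ContinuousOn (div u) {0}ᶜ := by
  have h1 : ContinuousOn (fderiv ℝ u) {0}ᶜ :=
    hu.continuousOn_fderiv_of_isOpen isOpen_compl_singleton le_rfl
  have h2 : ∀ i j, ContinuousOn (partialD u i j) {0}ᶜ := fun i j =>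
    (continuous_apply j |>.comp (PiLp.continuous_ofLp 2 _)).comp_continuousOn
      (h1.clm_apply continuousOn_const)
  unfold div
  exact continuousOn_finsetSum _ fun i _ => h2 i i

/-- Off the axis the Lamb form reads -Π'(ψ)∇ψ + Π'(ψ)∇ψ = 0. Both equations extend to the axis by
continuity of the first derivatives. -/
theorem IsProfile.isEulerSolution (h : IsProfile α C₁ C₂ f) (hα : 2 < α) (hα3 : α < 3) :
    IsEulerSolution (profileField α C₂ f) (profilePressure α C₁ C₂ f) := by
  have hu := h.contDiffOn_field hα hα3
  have hp := (h.contDiffOn_pressure hα hα3).of_le one_le_two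
  have hu' : ContinuousOn (fderiv ℝ (profileField α C₂ f)) {0}ᶜ :=
    hu.continuousOn_fderiv_of_isOpen isOpen_compl_singleton le_rfl
  have hp' : ContinuousOn (gradient (profilePressure α C₁ C₂ f)) {0}ᶜ :=
    (LinearIsometryEquiv.continuous _).comp_continuousOn
      (hp.continuousOn_fderiv_of_isOpen isOpen_compl_singleton le_rfl)
  refine ⟨hu, hp, fun x hx => ⟨?_, ?_⟩⟩
  · refine eq_of_eq_offAxis (f := fun x => fderiv ℝ (profileField α C₂ f) x
      (profileField α C₂ f x) + gradient (profilePressure α C₁ C₂ f) x) (g := fun _ => 0)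
      ((hu'.clm_apply hu.continuousOn).add hp') continuousOn_const (fun y hy => ?_) hx
    have hy0 : y ∈ ({0}ᶜ : Set E3) := ne_zero_of_cylR_pos hy
    have hnhds := isOpen_compl_singleton.mem_nhds hy0
    rw [euler_iff_lamb ((hu.contDiffAt hnhds).differentiableAt one_ne_zero)
      ((hp.contDiffAt hnhds).differentiableAt one_ne_zero), gradient_bernoulli_profile h hy,
      h.curl_eq hα hy]
    have := cross_azimuthal (x := y) (a := homog (α + 1) (radialProfile α f))
      (b := swirlCoeff α C₂ f) (c := homog α (axialProfile α f))
      (C₂ * (1 + 1 / (α - 2)) * profileStream α f (y 2) (cylR y) ^ (1 / (α - 2)))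
      (-(C₁ * (2 + 4 / (α - 2)) * profileStream α f (y 2) (cylR y) ^ (1 + 4 / (α - 2))))
    rw [profileField, this, neg_smul, neg_add_cancel]
  · refine eq_of_eq_offAxis (g := fun _ => 0) (continuousOn_div hu) continuousOn_const
      (fun y hy => ?_) hx
    obtain ⟨ψ', a', c', hψ, ha, hc, -, -, hdiv, -⟩ :=
      exists_profile_derivatives (α := α) h.smooth (q := (y 2, cylR y)) hy
    have hG : HasFDerivAt (fun q : ℝ × ℝ =>
        clebschFactor C₂ (α - 2) (profileStream α f q.1 q.2)) _ (y 2, cylR y) :=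
      HasDerivAt.comp_hasFDerivAt (y 2, cylR y)
        (hasDerivAt_clebschFactor (profileStream_pos h.pos hy)) hψ
    rw [IsDipoleSolution.div_congr (profileField_eventuallyEq h.pos hy),
      div_axisField hy ha (hasFDerivAt_div_sq hy hG) hc]
    exact hdiv

theorem profileField_smul (hpos : ∀ τ ∈ Icc (-1 : ℝ) 1, 0 < f τ) (hα : 2 < α) {l : ℝ} (hl : 0 < l)
    (hx : x ≠ 0) : profileField α C₂ f (l • x) = l ^ (-α) • profileField α C₂ f x := by
  have hq : ((l • x) 2, cylR (l • x)) = l • (x 2, cylR x) := by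
    simp [cylR_smul hl.le]
  have hβ := (sub_pos.2 hα).ne'
  have hψ := profileStream_nonneg (α := α) hpos hx
  have hb : swirlCoeff α C₂ f (l • (x 2, cylR x))
      = l ^ (-(α + 1)) * swirlCoeff α C₂ f (x 2, cylR x) := by
    rw [swirlCoeff, swirlCoeff, homog_smul hl, Prod.smul_fst, Prod.smul_snd, smul_eq_mul,
      smul_eq_mul, profileStream_smul hl, Real.mul_rpow (Real.rpow_nonneg hl.le _) hψ,
      ← Real.rpow_mul hl.le, show -(α - 2) * (1 / (α - 2)) = -1 by field_simp,
      show -(α + 1) = -α + -1 by ring, Real.rpow_add hl]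
    ring
  have hl1 : l ^ (-(α + 1)) = l ^ (-α) / l := by
    rw [show -(α + 1) = -α - 1 by ring, Real.rpow_sub_one hl.ne']
  rw [profileField]
  unfold axisField
  rw [hq, hb, homog_smul hl, homog_smul hl, hl1]
  ext i
  fin_cases i
  · simp
    field_simp
  · simp
    field_simp
  · simp

theorem IsProfile.isDipoleSolution (h : IsProfile α C₁ C₂ f) (hα : 2 < α) (hα3 : α < 3)
    (hC : C₁ ≠ 0 ∨ C₂ ≠ 0) :
    IsDipoleSolution α C₁ C₂ (profileStream α f) (profileField α C₂ f)
      (profilePressure α C₁ C₂ f) where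
  euler := h.isEulerSolution hα hα3
  homogeneous l hl x hx := by
    have hlα : l ^ α * l ^ (-α) = 1 := by rw [← Real.rpow_add hl]; simp
    constructor
    · rw [profileField_smul h.pos hα hl hx, smul_smul, hlα, one_smul]
    · have hβ := (sub_pos.2 hα).ne'
      have e : l ^ (2 * α) * (l ^ (-α)) ^ 2 = 1 := by
        rw [two_mul, Real.rpow_add hl]
        linear_combination (l ^ α * l ^ (-α) + 1) * hlα
      rw [profilePressure, profilePressure, profileField_smul h.pos hα hl hx, norm_smul,
        Real.norm_of_nonneg (Real.rpow_nonneg hl.le _), cylR_smul hl.le, PiLp.smul_apply,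
        smul_eq_mul, profileStream_smul hl,
        Real.mul_rpow (Real.rpow_nonneg hl.le _) (profileStream_nonneg h.pos hx),
        ← Real.rpow_mul hl.le, show -(α - 2) * (2 + 4 / (α - 2)) = -α + -α by field_simp; ring,
        Real.rpow_add hl]
      linear_combination (-C₁ * profileStream α f (x 2) (cylR x) ^ (2 + 4 / (α - 2))
        + ‖profileField α C₂ f x‖ ^ 2 / 2) * e
  axisymmetric ϑ x _ := by
    refine ⟨axisField_rotZ _ _ _ ϑ, ?_⟩
    rw [profilePressure, profilePressure, profileField, axisField_rotZ, norm_rotZ, rotZ_apply_two,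
      cylR_rotZ]
  rotational := by
    -- Test point (1, 0, 0), where u^z = (2 - α) f(0) ≠ 0. If the curl vanished there, its
    -- z-component would give C₂ = 0 and then its y-component C₁ = 0.
    have hx : cylR (EuclideanSpace.single 0 1) = 1 := by simp [cylR]
    have hx0 : 0 < cylR (EuclideanSpace.single 0 1) := by rw [hx]; exact one_pos
    refine ⟨EuclideanSpace.single 0 1, ne_zero_of_cylR_pos hx0, fun h0 => ?_⟩
    rw [h.curl_eq hα hx0] at h0
    have hβ := sub_pos.2 hα
    have hψ := profileStream_pos (α := α) h.pos hx0 (z := (EuclideanSpace.single 0 1 : E3) 2)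
    have e1 := congrArg (fun v : E3 => v 1) h0
    have e2 := congrArg (fun v : E3 => v 2) h0
    have hf := h.pos 0 (by norm_num)
    have hg := (Real.rpow_pos_of_pos hψ (1 / (α - 2))).ne'
    have hg' := (Real.rpow_pos_of_pos hψ (1 + 4 / (α - 2))).ne'
    have hC₂ : C₂ = 0 := by
      simp only [hx] at e2 hg
      have h1 : 1 + (α - 2)⁻¹ ≠ 0 := by positivity
      simp only [one_div] at hg
      simp [profileField, axisField, azimuthal, homog, merR, axialProfile, hx, h1] at e2
      rcases e2 with (e2 | e2) | e2
      · exact e2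
      · simp only [PiLp.single_apply, Fin.reduceEq, if_false] at hg
        exact absurd e2 hg
      · have : (α - 2) * f 0 = 0 := by linarith
        exact absurd this (mul_pos hβ hf).ne'
    have hC₁ : C₁ ≠ 0 := hC.resolve_right (not_not.2 hC₂)
    have h1 : 2 + 4 / (α - 2) ≠ 0 := by positivity
    simp only [hx] at e1 hg'
    simp [hC₂, azimuthal, hC₁, h1] at e1
    exact hg' (by simpa using e1)
  poloidal_regular := by
    obtain ⟨ha, hc⟩ := h.contDiffOn_coeff
    refine (contDiffOn_axisField ha (b := 0) contDiffOn_const hc).congr fun x _ => ?_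
    rw [profileField, poloidal_axisField]
  pressure_regular := h.contDiffOn_pressure hα hα3
  toroidal_regular := by
    refine (contDiffOn_axisField (a := 0) (c := 0) contDiffOn_const (h.contDiffOn_swirl hα hα3)
      contDiffOn_const).congr fun x _ => ?_
    rw [profileField, toroidal_axisField]
    ext i
    fin_cases i
    · simp [axisField, azimuthal]
      ring
    · simp [axisField, azimuthal]
      ring
    · simp [axisField, azimuthal]
  stream_regular := ((contDiffOn_profileStream h.smooth).of_le (by norm_num)).mono
    fun q hq => ne_zero_of_snd_pos hq
  stream_continuous := (contDiffOn_profileStream h.smooth).continuousOn.mono fun q hq => hq.2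
  stream_axis z _ := by simp [profileStream]
  stream_homogeneous l z r hl _ := by
    rw [profileStream_smul hl, ← mul_assoc, ← Real.rpow_add hl]
    simp
  stream_pos z r hr := profileStream_pos h.pos hr
  clebsch x hx := by
    obtain ⟨ψ', a', c', hψ, -, -, haψ, hcψ, -, -⟩ :=
      exists_profile_derivatives (α := α) h.smooth (q := (x 2, cylR x)) hx
    rw [curl_stream hx hψ, ← haψ, ← hcψ, profileField_eq h.pos hx]
    ext i
    fin_cases i
    · simp [axisField, gradAngle, clebschFactor]
      ring
    · simp [axisField, gradAngle, clebschFactor]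
      ring
    · simp [axisField, gradAngle]
  bernoulli_eq x hx := by
    rw [bernoulli_profile, abs_of_pos (profileStream_pos h.pos hx)]

end

end HomEuler

end

/-! ### The main theorem. -/

theorem corollary1p11 (α C₁ C₂ : ℝ) (hα : 2 < α) (hα3 : α < 3) (hC₁ : C₁ ≤ 0)
    (hC : C₁ ≠ 0 ∨ C₂ ≠ 0) :
    (∃ (ψ : ℝ → ℝ → ℝ) (u : E3 → E3) (p : E3 → ℝ), HomEuler.IsDipoleSolution α C₁ C₂ ψ u p) ∧
    ∀ (ψ : ℝ → ℝ → ℝ) (u : E3 → E3) (p : E3 → ℝ), HomEuler.IsDipoleSolution α C₁ C₂ ψ u p →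
      (∀ c : ℝ, Nonempty
        (HomEuler.streamLevel ψ c ≃ₜ HomEuler.streamLevel HomEuler.dipoleStream c)) ∧
      (C₁ ≠ 0 → HomEuler.HasNestedInftyLevels (HomEuler.bernoulli u p) C₁) ∧
      (C₁ = 0 →
        (∃ φ : E3 → ℝ, HomEuler.IsProportionalityFactor u φ) ∧
        ∀ φ : E3 → ℝ, HomEuler.IsProportionalityFactor u φ →
          (∀ x : E3, x ≠ 0 →
            φ x = C₂ * (1 + 1 / (α - 2)) *
              |ψ (x 2) (HomEuler.cylR x)| ^ (1 / (α - 2))) ∧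
          HomEuler.HasNestedInftyLevels φ C₂) := by
  have hβ : 0 < α - 2 := sub_pos.2 hα
  refine ⟨?_, fun ψ u p h => ⟨fun c => ?_, fun hC₁' => ?_, ?_⟩⟩
  · obtain ⟨f, hf⟩ := HomEuler.exists_isProfile hα hα3 hC₁ hC
    exact ⟨_, _, _, hf.isDipoleSolution hα hα3 hC⟩
  · exact h.isAxisStream.toIsHomogeneousStream.streamLevel_homeomorph
      HomEuler.isHomogeneousStream_dipoleStream hβ one_pos h.isAxisStream.smooth.continuousOn
      HomEuler.continuousOn_dipoleStream c
  · exact h.isAxisStream.hasNestedInftyLevels hβ (κ := 2 + 4 / (α - 2)) (by positivity)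
      (mul_self_pos.2 hC₁') fun x hx => h.bernoulli_eq_off_origin hα hx
  · rintro rfl
    refine ⟨⟨_, h.beltrami hα⟩, fun φ hφ => ?_⟩
    have hC₂ : C₂ ≠ 0 := hC.resolve_left (not_not.2 rfl)
    have hφ' := fun x (hx : x ≠ 0) => h.proportionalityFactor_eq hα hφ hx
    refine ⟨fun x hx => ?_, ?_⟩
    · rw [hφ' x hx, abs_of_nonneg (h.isAxisStream.nonneg_cyl hx)]
    · refine h.isAxisStream.hasNestedInftyLevels hβ (κ := 1 / (α - 2)) (by positivity) ?_ hφ'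
      rw [← mul_assoc]
      have := mul_self_pos.2 hC₂
      positivity
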